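/- There are a constant $\kappa$ and a single word-RAM query program $P$ such that for every constant $K$ there is a constant $C$ for which the following holds. Let $n\ge 0$, let $0<\varepsilon\le 1$, let the word size $w$ satisfy $\kappa(\lfloor\lg n\rfloor+1)\le w\le K(\lfloor\lg n\rfloor+1)$ (that is, $w=\Theta(\lg n)$; read $\lfloor\lg 0\rfloor$ as $0$), and let $c_1,\dots,c_n$ be a sequence of elements of an arbitrary set. Then there is a data structure $D$, a list of $w$-bit words occupying at most $C\,n/\varepsilon$ bits in total, such that for all $1\le a\le b\le n$ the program $P$, started with only $D$ in memory and with input $(a,b)$ (in particular without access to the sequence $c$, and with $n$ and $\varepsilon$ available only as far as $D$ encodes them), halts after at most $C\,(1+\lg(1/\varepsilon))$ steps and outputs the position $p$, $a\le p\le b$, of a $(1+\varepsilon)$-approximate mode of $c_a,\dots,c_b$, i.e. $(1+\varepsilon)\,F_{c_p}(c_{a..b})\ge \max_x F_x(c_{a..b})$, where $F_x(c_{a..b})$ is the number of indices $i$ with $a\le i\le b$ and $c_i=x$. Here the word RAM has $2^w$ memory words of $w$ bits and finitely many $w$-bit registers; indirect loads and stores, unsigned addition, subtraction and multiplication modulo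 $2^w$, integer division and remainder, bitwise and/or/xor, shifts, and tests for equality and order of two words each take one step; control flow is by sequencing, branching and loops. -/

import Mathlib

/-! ### Range mode -/

/-- `F_x(c_{a..b})`: the number of positions `i` with `a ≤ i ≤ b` and `c i = x`. -/
def freq {α : Type*} [DecidableEq α] (c : ℕ → α) (a b : ℕ) (x : α) : ℕ :=
  ((Finset.Icc a b).filter (fun i => c i = x)).card

/-- `F(c_{a..b}) = max_x F_x(c_{a..b})`.  An element that does not occur in the range has
frequency `0`, so the maximum is taken over the elements that occur in it. -/
def modeFreq {α : Type*} [DecidableEq α] (c : ℕ → α) (a b : ℕ) : ℕ :=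
  (Finset.Icc a b).sup (fun i => freq c a b (c i))

/-- `p` is the position, inside the range `a..b`, of a `(1 + ε)`-approximate mode of
`c_{a..b}`. -/
def IsApproxRangeMode {α : Type*} [DecidableEq α] (ε : ℝ) (c : ℕ → α) (a b p : ℕ) : Prop :=
  a ≤ p ∧ p ≤ b ∧ (modeFreq c a b : ℝ) ≤ (1 + ε) * (freq c a b (c p) : ℝ)

/-! ### A word RAM with `w`-bit words -/

namespace WordRAM

/-- The source of an operand: a register, or a constant written in the program. -/
inductive Operand where
  | reg (r : ℕ)
  | const (v : ℕ)

/-- Unit-cost word operations. -/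
inductive BinOp where
  | add | sub | mul | div | mod | and | or | xor | shl | shr

/-- Unit-cost (unsigned) tests on words. -/
inductive Test where
  | eq | lt

/-- Structured word RAM programs.  A program is a finite object that does not mention the word
size, so it uses finitely many registers; `load` and `store` address the memory indirectly. -/
inductive Program where
  | skip
  | op (f : BinOp) (dst : ℕ) (x y : Operand)
  | load (dst : ℕ) (addr : Operand)
  | store (addr val : Operand)
  | seq (p q : Program)
  | branch (t : Test) (x y : Operand) (p q : Program)
  | loop (t : Test) (x y : Operand) (p : Program)

/-- A configuration: the registers, and a memory of `2 ^ w` words of `w` bits. -/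
@[ext] structure State (w : ℕ) where
  reg : ℕ → BitVec w
  mem : BitVec w → BitVec w

/-- The value of an operand. -/
def Operand.val {w : ℕ} (s : State w) : Operand → BitVec w
  | .reg r => s.reg r
  | .const v => BitVec.ofNat w v

/-- Unsigned arithmetic modulo `2 ^ w`, integer quotient and remainder, bitwise operations and
shifts (a shift by `w` or more gives `0`). -/
def BinOp.eval {w : ℕ} : BinOp → BitVec w → BitVec w → BitVec w
  | .add, x, y => x + y
  | .sub, x, y => x - y
  | .mul, x, y => x * y
  | .div, x, y => x / y
  | .mod, x, y => x % y
  | .and, x, y => x &&& y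
  | .or, x, y => x ||| y
  | .xor, x, y => x ^^^ y
  | .shl, x, y => x <<< y.toNat
  | .shr, x, y => x >>> y.toNat

/-- When a test succeeds. -/
def Test.Holds {w : ℕ} : Test → BitVec w → BitVec w → Prop
  | .eq, x, y => x = y
  | .lt, x, y => x.toNat < y.toNat

/-- Writing the word `v` into register `r`. -/
def State.setReg {w : ℕ} (s : State w) (r : ℕ) (v : BitVec w) : State w :=
  { s with reg := Function.update s.reg r v }

/-- Writing the word `v` into memory cell `i`. -/
def State.setMem {w : ℕ} (s : State w) (i v : BitVec w) : State w :=
  { s with mem := Function.update s.mem i v }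

/-- `Exec p s t s'`: started in state `s`, the program `p` halts in state `s'` after exactly `t`
steps.  Every operation, every memory access and every evaluation of a test is one step. -/
inductive Exec {w : ℕ} : Program → State w → ℕ → State w → Prop where
  | skip (s : State w) : Exec .skip s 1 s
  | op (f : BinOp) (dst : ℕ) (x y : Operand) (s : State w) :
      Exec (.op f dst x y) s 1 (s.setReg dst (f.eval (x.val s) (y.val s)))
  | load (dst : ℕ) (addr : Operand) (s : State w) :
      Exec (.load dst addr) s 1 (s.setReg dst (s.mem (addr.val s)))
  | store (addr val : Operand) (s : State w) :
      Exec (.store addr val) s 1 (s.setMem (addr.val s) (val.val s))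
  | seq {p q : Program} {s s' s'' : State w} {t t' : ℕ} :
      Exec p s t s' → Exec q s' t' s'' → Exec (.seq p q) s (t + t') s''
  | branchTrue {c : Test} {x y : Operand} {p q : Program} {s s' : State w} {t : ℕ} :
      c.Holds (x.val s) (y.val s) → Exec p s t s' → Exec (.branch c x y p q) s (t + 1) s'
  | branchFalse {c : Test} {x y : Operand} {p q : Program} {s s' : State w} {t : ℕ} :
      ¬ c.Holds (x.val s) (y.val s) → Exec q s t s' → Exec (.branch c x y p q) s (t + 1) s'
  | loopTrue {c : Test} {x y : Operand} {p : Program} {s s' s'' : State w} {t t' : ℕ} :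
      c.Holds (x.val s) (y.val s) → Exec p s t s' → Exec (.loop c x y p) s' t' s'' →
        Exec (.loop c x y p) s (t + t' + 1) s''
  | loopFalse {c : Test} {x y : Operand} {p : Program} {s : State w} :
      ¬ c.Holds (x.val s) (y.val s) → Exec (.loop c x y p) s 1 s

/-- The initial state for a query `(a, b)` to the data structure whose words are listed in `D`:
the memory holds `D`, followed by zeros; registers `0` and `1` hold `a` and `b`, all other
registers hold `0`. -/
def queryState {w : ℕ} (D : List (BitVec w)) (a b : ℕ) : State w where
  reg := fun r => if r = 0 then BitVec.ofNat w a else if r = 1 then BitVec.ofNat w b else 0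
  mem := fun i => D.getD i.toNat 0

end WordRAM

/-- With nothing but the words of `D` in memory, the program `P` answers every query `(a, b)`,
`1 ≤ a ≤ b ≤ n`, in at most `T` steps, leaving in register `0` the position of a
`(1 + ε)`-approximate mode of `c_{a..b}`. -/
def AnswersApproxRangeMode {α : Type*} [DecidableEq α] {w : ℕ} (P : WordRAM.Program)
    (D : List (BitVec w)) (ε : ℝ) (n : ℕ) (c : ℕ → α) (T : ℝ) : Prop :=
  ∀ a b : ℕ, 1 ≤ a → a ≤ b → b ≤ n →
    ∃ (t : ℕ) (s : WordRAM.State w),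
      WordRAM.Exec P (WordRAM.queryState D a b) t s ∧ (t : ℝ) ≤ T ∧
        IsApproxRangeMode ε c a b (s.reg 0).toNat

/-! Write F for the mode frequency of the half-open range [a, y), y = b + 1. Only frequencies f with
q bits of floating point precision are distinguished, where 2^q is about 8/ε. Let s be the spacing
of these levels at f; s = 1 for small f, and 2^q s ≤ f from f = 2^q on. Rounding a and y inwards to
multiples of s lowers the mode frequency by at most 2(s - 1) (`maxFreq_le_rounded`). So if level f
is reached in its rounded range and F is below the next level plus that level's rounding loss, then
either F = f or F ≤ f + 5s ≤ (1 + 5/2^q) f (`approx_of_brackets`). It remains to find such a level,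
together with an element that occurs f times.

For fixed f and s, the pairs of block endpoints (i, j) whose range reaches f lie under a monotone
staircase. Its heights are not stored. Two bit vectors of length about n/s mark the heights that are
attained and the places where the height increases, and comparing one rank in each decides whether
(i, j) lies under the staircase (`reaches_iff_count_lt`). At every increase a witness position lies
in the block just before it (`stairPos_step`), so lg s bits identify it. A level thus takes
O((n/s)(1 + lg s)) bits. There are 2^q levels per exponent and the strides double from one exponent
to the next, which sums to O(2^q n) = O(n/ε).

Binary search costs O(q) steps provided that F is already known up to a constant factor, which
leaves O(2^q) candidate levels. For this estimate, cut [a, y) at the multiple of 2^t given by the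
highest bit t in which a and y differ. Each half depends on t and one endpoint alone
(`scaleFreq_split`). For each t the positions are grouped into blocks; a block stores the bit length
of the frequency where it is smallest, and the places in the block where the frequency passes the
powers of two that are small compared to the block. Above these powers the frequency cannot double
inside the block (`size_estimate`). All thresholds are compared with the query by one addition, a
mask and a remainder (`parallel_count`). Blocks have length about (lg n)^2, or 2^t if that is less,
so all scales together need O(n) bits.

Popcounts and logarithms come from tables with O(√n) rows for half-words, plus O(lg n) rows for the
scales and exponents. The bits are stored in overlapping windows, so that any short field lies in
one word. Capping q at lg n + 2 handles very small ε: then 2^q exceeds n, and the answer is an exact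
mode. -/

/-! ### Mode frequencies of half-open ranges -/

section ModeFrequency

variable {α : Type*} [DecidableEq α] (c : ℕ → α)

/-- The number of occurrences of `v` at positions in `[x, y)`. -/
def occ (x y : ℕ) (v : α) : ℕ := ((Finset.Ico x y).filter (fun i => c i = v)).card

/-- The largest frequency of an element in the half-open range `[x, y)`. -/
def maxFreq (x y : ℕ) : ℕ := (Finset.Ico x y).sup (fun i => occ c x y (c i))

theorem modeFreq_eq_maxFreq (a b : ℕ) : modeFreq c a b = maxFreq c a (b + 1) := rfl

theorem freq_eq_occ (a b : ℕ) (v : α) : freq c a b v = occ c a (b + 1) v := rfl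

variable {c}

theorem occ_le_maxFreq (x y : ℕ) (v : α) : occ c x y v ≤ maxFreq c x y := by
  by_cases h : ∃ i ∈ Finset.Ico x y, c i = v
  · obtain ⟨i, hi, rfl⟩ := h
    exact Finset.le_sup (f := fun i => occ c x y (c i)) hi
  · push Not at h
    have : occ c x y v = 0 := by
      rw [occ, Finset.card_eq_zero, Finset.filter_eq_empty_iff]
      exact fun i hi => h i hi
    omega

theorem maxFreq_le_iff {x y m : ℕ} : maxFreq c x y ≤ m ↔ ∀ v, occ c x y v ≤ m :=
  ⟨fun h v => (occ_le_maxFreq x y v).trans h, fun h => Finset.sup_le fun i _ => h (c i)⟩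

theorem occ_mono {x y x' y' : ℕ} (hx : x' ≤ x) (hy : y ≤ y') (v : α) :
    occ c x y v ≤ occ c x' y' v :=
  Finset.card_le_card (Finset.filter_subset_filter _ (Finset.Ico_subset_Ico hx hy))

theorem maxFreq_mono {x y x' y' : ℕ} (hx : x' ≤ x) (hy : y ≤ y') :
    maxFreq c x y ≤ maxFreq c x' y' :=
  maxFreq_le_iff.2 fun v => (occ_mono hx hy v).trans (occ_le_maxFreq _ _ v)

theorem occ_split (x m y : ℕ) (v : α) : occ c x y v ≤ occ c x m v + occ c m y v := by
  unfold occ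
  rw [← Finset.card_union_add_card_inter]
  refine le_trans (Finset.card_le_card ?_) (Nat.le_add_right _ _)
  intro i hi
  simp only [Finset.mem_filter, Finset.mem_Ico, Finset.mem_union] at hi ⊢
  rcases lt_or_ge i m with h | h
  · exact Or.inl ⟨⟨hi.1.1, h⟩, hi.2⟩
  · exact Or.inr ⟨⟨h, hi.1.2⟩, hi.2⟩

theorem maxFreq_split (x m y : ℕ) : maxFreq c x y ≤ maxFreq c x m + maxFreq c m y :=
  maxFreq_le_iff.2 fun v => (occ_split x m y v).trans
    (Nat.add_le_add (occ_le_maxFreq _ _ v) (occ_le_maxFreq _ _ v))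

theorem maxFreq_le_length (x y : ℕ) : maxFreq c x y ≤ y - x :=
  maxFreq_le_iff.2 fun v => (Finset.card_filter_le _ _).trans (by simp)

theorem maxFreq_eq_zero {x y : ℕ} (h : y ≤ x) : maxFreq c x y = 0 := by
  have := maxFreq_le_length (c := c) x y
  omega

theorem maxFreq_pos {x y : ℕ} (h : x < y) : 1 ≤ maxFreq c x y := by
  refine le_trans ?_ (occ_le_maxFreq x y (c x))
  refine Finset.card_pos.2 ⟨x, ?_⟩
  simp [h]

/-- If the mode frequency reaches `f` on appending position `p`, then the element at `p` is a
mode. -/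
theorem occ_last_ge {x p f : ℕ} (h₀ : maxFreq c x p < f) (h₁ : f ≤ maxFreq c x (p + 1)) :
    f ≤ occ c x (p + 1) (c p) := by
  by_contra! hlt
  refine absurd h₁ (not_le.2 (lt_of_le_of_lt (b := f - 1) ?_ (by omega)))
  refine maxFreq_le_iff.2 fun v => ?_
  by_cases hv : v = c p
  · subst hv; omega
  · have : occ c x (p + 1) v ≤ occ c x p v := by
      refine Finset.card_le_card fun i hi => ?_
      simp only [Finset.mem_filter, Finset.mem_Ico] at hi ⊢
      have : i ≠ p := fun h => hv (by rw [← hi.2, h])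
      exact ⟨⟨hi.1.1, by omega⟩, hi.2⟩
    have := occ_le_maxFreq (c := c) x p v
    omega

theorem lt_of_maxFreq_pos {x y : ℕ} (h : 1 ≤ maxFreq c x y) : x < y := by
  by_contra! hle
  rw [maxFreq_eq_zero hle] at h
  omega

/-- Rounding the endpoints of a range inwards to multiples of `s`. -/
theorem maxFreq_le_rounded {s i j a y : ℕ} (ha : a ≤ s * i) (ha' : s * i ≤ a + (s - 1))
    (hy : s * j ≤ y) (hy' : y ≤ s * j + (s - 1)) :
    maxFreq c a y ≤ maxFreq c (s * i) (s * j) + 2 * (s - 1) := by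
  rcases le_total (s * i) (s * j) with h | h
  · have h1 := maxFreq_split (c := c) a (s * i) y
    have h2 := maxFreq_split (c := c) (s * i) (s * j) y
    have h3 := maxFreq_le_length (c := c) a (s * i)
    have h4 := maxFreq_le_length (c := c) (s * j) y
    omega
  -- If rounding leaves an empty range, the original range has length at most 2(s - 1).
  · have := maxFreq_le_length (c := c) a y
    omega

end ModeFrequency

/-- Counting a downward closed predicate. -/
theorem lt_count_iff {p : ℕ → Prop} [DecidablePred p] {m i : ℕ}
    (hp : ∀ k l, k ≤ l → l < m → p l → p k) : i < Nat.count p m ↔ i < m ∧ p i := by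
  induction m with
  | zero => simp
  | succ m ih =>
    have ih := ih fun k l h hl => hp k l h (by omega)
    rw [Nat.count_succ]
    have hle : Nat.count p m ≤ m := Nat.count_le _
    by_cases hm : p m
    · have hall : Nat.count p m = m :=
        Nat.count_of_forall fun k hk => hp k m hk.le (Nat.lt_succ_self m) hm
      rw [hall]
      simp only [hm, if_true]
      exact ⟨fun h => ⟨h, hp i m (by omega) (Nat.lt_succ_self m) hm⟩, fun h => h.1⟩
    · simp only [hm, if_false, add_zero, ih]
      constructor
      · exact fun h => ⟨by omega, h.2⟩
      · rintro ⟨h1, h2⟩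
        refine ⟨lt_of_le_of_ne (by omega) ?_, h2⟩
        rintro rfl
        exact hm h2

/-! ### Staircases -/

section Staircase

variable {α : Type*} [DecidableEq α] (c : ℕ → α) (s f : ℕ)

/-- The range of blocks `[i, j)`, with blocks of length `s`, has mode frequency at least `f`. -/
def Reaches (i j : ℕ) : Prop := f ≤ maxFreq c (s * i) (s * j)

open Classical in
/-- The number of left block endpoints `i` from which the frequency `f` is reached at `j`. -/
noncomputable def stair (j : ℕ) : ℕ := Nat.count (fun i => Reaches c s f i j) j

/-- The positive values of `stair`. -/
def IsStairValue (v : ℕ) : Prop := 0 < v ∧ ∃ j, stair c s f j = v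

/-- The places where `stair` increases. -/
def IsStairStep (j : ℕ) : Prop := stair c s f (j - 1) < stair c s f j

/-- A position at which the frequency `f` is first reached from the left block endpoint
`v - 1`. -/
noncomputable def stairPos (v : ℕ) : ℕ := sInf {p | f ≤ maxFreq c (s * (v - 1)) (p + 1)}

variable {c s f}

theorem Reaches.mono {i j i' j' : ℕ} (h : Reaches c s f i j) (hi : i' ≤ i) (hj : j ≤ j') :
    Reaches c s f i' j' :=
  le_trans h (maxFreq_mono (Nat.mul_le_mul_left s hi) (Nat.mul_le_mul_left s hj))

theorem Reaches.lt {i j : ℕ} (hf : 1 ≤ f) (h : Reaches c s f i j) : i < j :=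
  lt_of_mul_lt_mul_left (lt_of_maxFreq_pos (le_trans hf h)) (Nat.zero_le s)

/-- The left endpoints that reach f form an initial segment, so their number determines them.
Positivity of f keeps them all below j, the range of the count. -/
theorem lt_stair_iff (hf : 1 ≤ f) {i j : ℕ} : i < stair c s f j ↔ Reaches c s f i j := by
  classical
  have := lt_count_iff (p := fun i => Reaches c s f i j) (m := j) (i := i)
    fun k l h _ hl => hl.mono h le_rfl
  exact ⟨fun h => (this.1 h).2, fun h => this.2 ⟨h.lt hf, h⟩⟩

theorem stair_le (j : ℕ) : stair c s f j ≤ j := by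
  classical
  exact Nat.count_le _

theorem stair_mono (hf : 1 ≤ f) : Monotone (stair c s f) := by
  intro j j' h
  by_contra! hlt
  exact absurd ((lt_stair_iff hf).2 (((lt_stair_iff hf).1 hlt).mono le_rfl h)) (lt_irrefl _)

-- Each increase of the staircase produces exactly one new height. Hence the rank of a height can be
-- found by counting increases, without storing the height itself.
open Classical in
theorem count_stairStep (hf : 1 ≤ f) (j : ℕ) :
    Nat.count (IsStairStep c s f) (j + 1) =
      Nat.count (IsStairValue c s f) (stair c s f j + 1) := by
  induction j with
  | zero =>
    -- Height 0 is excluded from `IsStairValue` so that both counts start at zero.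
    have h0 : stair c s f 0 = 0 := by simpa using stair_le (c := c) (s := s) (f := f) 0
    simp [h0, Nat.count_succ, IsStairStep, IsStairValue]
  | succ j ih =>
    rw [Nat.count_succ, ih]
    rcases (stair_mono (c := c) (s := s) hf (show j ≤ j + 1 by omega)).lt_or_eq with h | h
    · have hstep : IsStairStep c s f (j + 1) := by simpa [IsStairStep] using h
      have hval : IsStairValue c s f (stair c s f (j + 1)) := ⟨by omega, _, rfl⟩
      rw [if_pos hstep, Nat.count_succ _ (stair c s f (j + 1)), if_pos hval]
      congr 1
      obtain ⟨d, hd⟩ : ∃ d, stair c s f (j + 1) = stair c s f j + 1 + d :=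
        ⟨_, (Nat.add_sub_of_le h).symm⟩
      -- By monotonicity, no number strictly between two consecutive heights is ever attained.
      have hzero : Nat.count (fun k => IsStairValue c s f (stair c s f j + 1 + k)) d = 0 := by
        rw [Nat.count_iff_forall_not]
        rintro k hk ⟨-, j', hj'⟩
        rcases le_or_gt j' j with h' | h'
        · have := stair_mono (c := c) (s := s) hf h'
          omega
        · have := stair_mono (c := c) (s := s) hf (show j + 1 ≤ j' from h')
          omega
      rw [hd, Nat.count_add _ (stair c s f j + 1) d, hzero, add_zero]
    · have hstep : ¬ IsStairStep c s f (j + 1) := by simp [IsStairStep, h]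
      rw [if_neg hstep, add_zero, ← h]

open Classical in
/-- The staircase test by comparing two ranks. -/
theorem reaches_iff_count_lt (hf : 1 ≤ f) (i j : ℕ) :
    Reaches c s f i j ↔
      Nat.count (IsStairValue c s f) (i + 1) < Nat.count (IsStairStep c s f) (j + 1) := by
  rw [count_stairStep hf, ← lt_stair_iff hf]
  constructor
  · intro h
    refine lt_of_le_of_lt (Nat.count_monotone _ (show i + 1 ≤ stair c s f j by omega)) ?_
    -- The inequality is strict because `stair c s f j` is itself an attained height.
    exact Nat.count_strict_mono (m := stair c s f j) ⟨by omega, _, rfl⟩ (Nat.lt_succ_self _)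
  · intro h
    by_contra! hle
    exact absurd (Nat.count_monotone (IsStairValue c s f) (Nat.succ_le_succ hle)) (by
      simpa using h)

theorem not_isStairStep_zero : ¬ IsStairStep c s f 0 := by
  simp [IsStairStep]

/-- The staircase is constant between consecutive steps. -/
theorem stair_eq_of_no_step (hf : 1 ≤ f) {j₀ j : ℕ} (h : j₀ ≤ j)
    (hn : ∀ k, j₀ < k → k ≤ j → ¬ IsStairStep c s f k) : stair c s f j = stair c s f j₀ := by
  induction j, h using Nat.le_induction with
  | base => rfl
  | succ j hj ih =>
    rw [← ih fun k h1 h2 => hn k h1 (by omega)]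
    have := hn (j + 1) (by omega) le_rfl
    have h2 := stair_mono (c := c) (s := s) hf (Nat.le_succ j)
    simp only [IsStairStep, Nat.add_sub_cancel, not_lt] at this
    exact le_antisymm this h2

/-- The set whose infimum is taken contains s * j - 1, so the infimum is attained. By minimality the
mode frequency passes f exactly there, and `occ_last_ge` makes the element at that position a
witness. -/
theorem stairPos_spec {v j : ℕ} (hf : 1 ≤ f) (h : Reaches c s f (v - 1) j) :
    s * (v - 1) ≤ stairPos c s f v ∧ stairPos c s f v < s * j ∧
      f ≤ occ c (s * (v - 1)) (stairPos c s f v + 1) (c (stairPos c s f v)) := by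
  have hlt : s * (v - 1) < s * j := lt_of_maxFreq_pos (le_trans hf h)
  have hmem : s * j - 1 ∈ {p | f ≤ maxFreq c (s * (v - 1)) (p + 1)} := by
    simp only [Set.mem_ofPred_eq]
    rw [show s * j - 1 + 1 = s * j by omega]
    exact h
  have h1 : f ≤ maxFreq c (s * (v - 1)) (stairPos c s f v + 1) := Nat.sInf_mem ⟨_, hmem⟩
  have h2 : stairPos c s f v ≤ s * j - 1 := Nat.sInf_le hmem
  have h3 := lt_of_maxFreq_pos (le_trans hf h1)
  refine ⟨by omega, by omega, occ_last_ge ?_ h1⟩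
  rcases Nat.eq_zero_or_pos (stairPos c s f v) with h0 | h0
  · rw [h0, maxFreq_eq_zero (Nat.zero_le _)]
    omega
  · have : stairPos c s f v - 1 ∉ {p | f ≤ maxFreq c (s * (v - 1)) (p + 1)} :=
      Nat.notMem_of_lt_sInf (show stairPos c s f v - 1 < stairPos c s f v by omega)
    simp only [Set.mem_ofPred_eq, not_le] at this
    rwa [show stairPos c s f v - 1 + 1 = stairPos c s f v by omega] at this

/-- The position found at a step of the staircase lies in the block before the step. -/
theorem stairPos_step (hf : 1 ≤ f) {j : ℕ} (h : IsStairStep c s f j) :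
    s * (j - 1) ≤ stairPos c s f (stair c s f j) ∧ stairPos c s f (stair c s f j) < s * j := by
  have hpos : stair c s f j - 1 < stair c s f j := by
    have : stair c s f (j - 1) < stair c s f j := h
    omega
  have hs := stairPos_spec hf ((lt_stair_iff hf).1 hpos)
  refine ⟨?_, hs.2.1⟩
  by_contra! hlt
  -- A witness before the last block would put the same left endpoint under the staircase already at
  -- j - 1, so there would be no increase at j.
  have : Reaches c s f (stair c s f j - 1) (j - 1) :=
    le_trans hs.2.2 ((occ_mono le_rfl hlt _).trans (occ_le_maxFreq _ _ _))
  have := (lt_stair_iff hf).2 this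
  have h' : stair c s f (j - 1) < stair c s f j := h
  omega

end Staircase

/-! ### Packing bit fields into natural numbers -/

/-- The `l` bits of `X` from bit `o` on. -/
def slice (X o l : ℕ) : ℕ := X / 2 ^ o % 2 ^ l

theorem testBit_slice (X o l k : ℕ) :
    (slice X o l).testBit k = (decide (k < l) && X.testBit (o + k)) := by
  rw [slice, Nat.testBit_mod_two_pow, Nat.testBit_div_two_pow, Nat.add_comm]

theorem slice_lt (X o l : ℕ) : slice X o l < 2 ^ l := Nat.mod_lt _ (by positivity)

theorem slice_eq_self {X l : ℕ} (h : X < 2 ^ l) : slice X 0 l = X := by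
  simp [slice, Nat.mod_eq_of_lt h]

theorem slice_slice {X o l o' l' : ℕ} (h : o' + l' ≤ l) :
    slice (slice X o l) o' l' = slice X (o + o') l' := by
  refine Nat.eq_of_testBit_eq fun k => ?_
  simp only [testBit_slice, Nat.add_assoc]
  by_cases hk : k < l'
  · simp [hk, show o' + k < l by omega]
  · simp [hk]

/-- The offset of the `i`-th field, when the fields have sizes `size 0, size 1, …`. -/
def fieldOffset (size : ℕ → ℕ) (i : ℕ) : ℕ := ∑ j ∈ Finset.range i, size j

/-- The concatenation of the first `N` fields; the `i`-th one holds `size i` bits of `v i`. -/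
def pack (size v : ℕ → ℕ) (N : ℕ) : ℕ :=
  ∑ i ∈ Finset.range N, 2 ^ fieldOffset size i * (v i % 2 ^ size i)

theorem fieldOffset_succ (size : ℕ → ℕ) (i : ℕ) :
    fieldOffset size (i + 1) = fieldOffset size i + size i := Finset.sum_range_succ _ _

theorem fieldOffset_mono (size : ℕ → ℕ) : Monotone (fieldOffset size) :=
  monotone_nat_of_le_succ fun i => by rw [fieldOffset_succ]; omega

theorem fieldOffset_const (l i : ℕ) : fieldOffset (fun _ => l) i = i * l := by
  simp [fieldOffset]

theorem fieldOffset_add_le {size : ℕ → ℕ} {i N o : ℕ} (hi : i < N) (ho : o ≤ size i) :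
    fieldOffset size i + o ≤ fieldOffset size N := by
  have := fieldOffset_mono size (show i + 1 ≤ N from hi)
  rw [fieldOffset_succ] at this
  omega

theorem pack_succ (size v : ℕ → ℕ) (N : ℕ) :
    pack size v (N + 1) = 2 ^ fieldOffset size N * (v N % 2 ^ size N) + pack size v N := by
  rw [pack, Finset.sum_range_succ, Nat.add_comm]
  rfl

theorem pack_lt (size v : ℕ → ℕ) (N : ℕ) : pack size v N < 2 ^ fieldOffset size N := by
  induction N with
  | zero => simp [pack, fieldOffset]
  | succ N ih =>
    rw [pack_succ, fieldOffset_succ, pow_add]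
    have : v N % 2 ^ size N + 1 ≤ 2 ^ size N := Nat.mod_lt _ (by positivity)
    nlinarith [Nat.mul_le_mul_left (2 ^ fieldOffset size N) this]

/-- Since `pack` truncates every field to its slot, a field can be read back whatever the others
contain. In particular, meaningless entries do no harm. -/
theorem slice_pack {size v : ℕ → ℕ} {N i o l : ℕ} (hi : i < N) (h : o + l ≤ size i) :
    slice (pack size v N) (fieldOffset size i + o) l = slice (v i) o l := by
  induction N with
  | zero => omega
  | succ N ih =>
    refine Nat.eq_of_testBit_eq fun k => ?_
    rcases Nat.lt_succ_iff_lt_or_eq.1 hi with h' | rfl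
    · rw [← ih h']
      simp only [testBit_slice]
      by_cases hk : k < l
      · have := fieldOffset_add_le (size := size) h' (le_refl (size i))
        rw [pack_succ, Nat.testBit_two_pow_mul_add _ (pack_lt _ _ _), if_pos (by omega)]
      · simp [hk]
    · simp only [testBit_slice]
      by_cases hk : k < l
      · rw [pack_succ, Nat.testBit_two_pow_mul_add _ (pack_lt _ _ _), if_neg (by omega),
          Nat.testBit_mod_two_pow]
        simp [hk, show fieldOffset size i + o + k - fieldOffset size i = o + k by omega,
          show o + k < size i by omega]
      · simp [hk]

/-- An array of `l`-bit fields. -/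
theorem slice_pack_const {l N i o l' : ℕ} {v : ℕ → ℕ} (hi : i < N) (h : o + l' ≤ l) :
    slice (pack (fun _ => l) v N) (i * l + o) l' = slice (v i) o l' := by
  rw [← fieldOffset_const, slice_pack hi h]

/-! ### Bit vectors, ranks and predecessors -/

open Classical in
/-- The number whose `k`-th bit, for `k < n`, tells whether `p k`. -/
noncomputable def bitsOf (p : ℕ → Prop) (n : ℕ) : ℕ :=
  pack (fun _ => 1) (fun k => if p k then 1 else 0) n

theorem bitsOf_lt (p : ℕ → Prop) (n : ℕ) : bitsOf p n < 2 ^ n := by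
  simpa [bitsOf, fieldOffset] using pack_lt (fun _ => 1) _ n

open Classical in
theorem testBit_bitsOf (p : ℕ → Prop) (n k : ℕ) :
    (bitsOf p n).testBit k = decide (k < n ∧ p k) := by
  by_cases hk : k < n
  · have h := slice_pack_const (l := 1) (o := 0) (l' := 1)
      (v := fun k => if p k then 1 else 0) hk le_rfl
    have h2 := congrArg (fun x => x.testBit 0) h
    simp only [testBit_slice] at h2
    simp only [mul_one, add_zero, Nat.lt_one_iff, decide_true, Bool.true_and] at h2
    rw [bitsOf, h2]
    by_cases hp : p k <;> simp [hp, hk]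
  · rw [Nat.testBit_lt_two_pow ((bitsOf_lt p n).trans_le (Nat.pow_le_pow_right two_pos (by omega)))]
    simp [hk]

/-- The number of ones among the lowest `n` bits of `x`. -/
def popCount (n x : ℕ) : ℕ := Nat.count (fun k => x.testBit k = true) n

open Classical in
theorem popCount_bitsOf {p : ℕ → Prop} {n z : ℕ} (hz : z ≤ n) :
    popCount n (bitsOf p n % 2 ^ z) = Nat.count p z := by
  have h1 : ∀ k, (bitsOf p n % 2 ^ z).testBit k = true ↔ k < z ∧ p k := by
    intro k
    rw [Nat.testBit_mod_two_pow, testBit_bitsOf]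
    simp only [Bool.and_eq_true, decide_eq_true_eq]
    exact ⟨fun h => ⟨h.1, h.2.2⟩, fun h => ⟨h.1, by omega, h.2⟩⟩
  obtain ⟨d, rfl⟩ := Nat.exists_eq_add_of_le hz
  unfold popCount
  rw [Nat.count_add]
  have h2 : Nat.count (fun k => (bitsOf p (z + d) % 2 ^ z).testBit (z + k) = true) d = 0 := by
    rw [Nat.count_iff_forall_not]
    intro k _ h
    have := (h1 _).1 h
    omega
  rw [h2, add_zero, Nat.count_eq_card_filter_range, Nat.count_eq_card_filter_range]
  congr 1
  refine Finset.filter_congr fun k hk => ?_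
  rw [h1]
  simp [Finset.mem_range.1 hk]

open Classical in
/-- Ranks from a rank at the start of a chunk and the bits of the chunk. -/
theorem count_eq_add_popCount {p : ℕ → Prop} {start n z : ℕ} (hz : z ≤ n) :
    Nat.count p (start + z) =
      Nat.count p start + popCount n (bitsOf (fun k => p (start + k)) n % 2 ^ z) := by
  rw [popCount_bitsOf hz, Nat.count_add]

/-- There is nothing in the chunk if the bits vanish. -/
theorem not_of_bitsOf_eq_zero {p : ℕ → Prop} {n z : ℕ} (hz : z ≤ n)
    (h : bitsOf p n % 2 ^ z = 0) {k : ℕ} (hk : k < z) : ¬ p k := by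
  classical
  intro hp
  have h2 : (bitsOf p n % 2 ^ z).testBit k = true := by
    rw [Nat.testBit_mod_two_pow, testBit_bitsOf]
    simp [hk, hp, show k < n by omega]
  simp [h] at h2

/-- Predecessors by means of the logarithm. -/
theorem log_bitsOf {p : ℕ → Prop} {n z : ℕ} (h : bitsOf p n % 2 ^ z ≠ 0) :
    Nat.log 2 (bitsOf p n % 2 ^ z) < z ∧ p (Nat.log 2 (bitsOf p n % 2 ^ z)) ∧
      ∀ k, Nat.log 2 (bitsOf p n % 2 ^ z) < k → k < z → z ≤ n → ¬ p k := by
  classical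
  set x := bitsOf p n % 2 ^ z with hx
  have h1 : ∀ k, x.testBit k = true ↔ k < z ∧ k < n ∧ p k := by
    intro k
    rw [hx, Nat.testBit_mod_two_pow, testBit_bitsOf]
    simp
  have h2 : x.testBit (Nat.log 2 x) = true := by
    rw [← Nat.log2_eq_log_two]
    exact Nat.testBit_log2 h
  refine ⟨((h1 _).1 h2).1, ((h1 _).1 h2).2.2, fun k hk hz hn hp => ?_⟩
  have h3 : x.testBit k = false := by
    refine Nat.testBit_lt_two_pow ((Nat.lt_pow_succ_log_self one_lt_two x).trans_le ?_)
    exact Nat.pow_le_pow_right two_pos hk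
  rw [(h1 k).2 ⟨hz, by omega, hp⟩] at h3
  cases h3

/-! ### Word-parallel comparison -/

/-- The number with `n` ones at distance `m`. -/
def ones (m n : ℕ) : ℕ := ∑ k ∈ Finset.range n, 2 ^ (m * k)

/-- Fields of `m` bits, side by side. -/
def fields (m : ℕ) (y : ℕ → ℕ) (n : ℕ) : ℕ := ∑ k ∈ Finset.range n, y k * 2 ^ (m * k)

theorem fields_succ' (m : ℕ) (y : ℕ → ℕ) (n : ℕ) :
    fields m y (n + 1) = 2 ^ m * fields m (fun k => y (k + 1)) n + y 0 := by
  rw [fields, Finset.sum_range_succ', fields, Finset.mul_sum]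
  simp only [mul_zero, pow_zero, mul_one, Nat.add_right_cancel_iff]
  refine Finset.sum_congr rfl fun k _ => ?_
  ring

theorem fields_one (m n : ℕ) : fields m (fun _ => 1) n = ones m n := by
  simp [fields, ones]

theorem fields_lt {m : ℕ} {y : ℕ → ℕ} (n : ℕ) (hy : ∀ k, y k < 2 ^ m) :
    fields m y n < 2 ^ (m * n) := by
  induction n generalizing y with
  | zero => simp [fields]
  | succ n ih =>
    rw [fields_succ', Nat.mul_succ, pow_add]
    have h1 := ih (y := fun k => y (k + 1)) fun k => hy _
    have h2 := hy 0
    have h3 : fields m (fun k => y (k + 1)) n + 1 ≤ 2 ^ (m * n) := h1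
    nlinarith [Nat.mul_le_mul_left (2 ^ m) h3]

theorem fields_add_mul_ones (m : ℕ) (y : ℕ → ℕ) (z n : ℕ) :
    fields m y n + z * ones m n = fields m (fun k => y k + z) n := by
  simp only [fields, ones, Finset.mul_sum, ← Finset.sum_add_distrib, add_mul]

/-- The shift moves the top bit of each field to the bottom of that field, and the mask removes what
entered from the next field. The induction peels off the lowest field. -/
theorem fields_shift_and_ones {m : ℕ} (hm : 2 ≤ m) {y : ℕ → ℕ} (n : ℕ)
    (hy : ∀ k, y k < 2 ^ m) :
    (fields m y n / 2 ^ (m - 1)) &&& ones m n = fields m (fun k => y k / 2 ^ (m - 1)) n := by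
  induction n generalizing y with
  | zero => simp [fields, ones]
  | succ n ih =>
    have ih := ih (y := fun k => y (k + 1)) fun k => hy _
    have hb : y 0 / 2 ^ (m - 1) < 2 := by
      rw [Nat.div_lt_iff_lt_mul (by positivity), ← pow_succ']
      simpa [show m - 1 + 1 = m by omega] using hy 0
    have h4 : (2 : ℕ) < 2 ^ m := by
      calc 2 < 2 ^ 2 := by norm_num
        _ ≤ 2 ^ m := Nat.pow_le_pow_right two_pos hm
    rw [← fields_one, fields_succ', fields_succ', fields_succ', fields_one, ← ih]
    refine Nat.eq_of_testBit_eq fun k => ?_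
    rw [Nat.testBit_and, Nat.testBit_div_two_pow,
      Nat.testBit_two_pow_mul_add _ (by omega : y 0 / 2 ^ (m - 1) < 2 ^ m),
      Nat.testBit_two_pow_mul_add _ (by omega : 1 < 2 ^ m),
      Nat.testBit_two_pow_mul_add _ (hy 0)]
    rcases Nat.eq_zero_or_pos k with rfl | hk
    · simp [show m - 1 < m by omega, show 0 < m by omega,
        Nat.testBit_eq_decide_div_mod_eq (x := y 0)]
    · by_cases hkm : k < m
      · have h1 : Nat.testBit 1 k = false := Nat.testBit_lt_two_pow
          (Nat.one_lt_two_pow (by omega))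
        have h2 : (y 0 / 2 ^ (m - 1)).testBit k = false := Nat.testBit_lt_two_pow
          (hb.trans_le (by simpa using Nat.pow_le_pow_right two_pos hk))
        simp [hkm, h1, h2]
      · simp only [hkm, show ¬ k + (m - 1) < m by omega, if_false, Nat.testBit_and,
          Nat.testBit_div_two_pow]
        rw [show k + (m - 1) - m = k - m + (m - 1) by omega]

/-- Casting out 2^m - 1: since 2^m ≡ 1, the remainder adds up the digits. -/
theorem fields_mod {m : ℕ} (y : ℕ → ℕ) (n : ℕ) :
    fields m y n ≡ ∑ k ∈ Finset.range n, y k [MOD 2 ^ m - 1] := by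
  have hone : 2 ^ m ≡ 1 [MOD 2 ^ m - 1] := by
    have : 2 ^ m = (2 ^ m - 1) + 1 := (Nat.sub_add_cancel Nat.one_le_two_pow).symm
    conv_lhs => rw [this]
    simp [Nat.ModEq]
  induction n with
  | zero => simp [fields, Nat.ModEq]
  | succ n ih =>
    rw [fields, Finset.sum_range_succ, Finset.sum_range_succ]
    refine Nat.ModEq.add ih ?_
    have := (hone.pow n).mul_left (y n)
    simpa [pow_mul] using this

/-- Counting the fields whose highest bit is set. -/
theorem parallel_count {m : ℕ} (hm : 2 ≤ m) {y : ℕ → ℕ} {n : ℕ} (hn : n < 2 ^ m - 1)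
    (hy : ∀ k, y k < 2 ^ m) :
    ((fields m y n / 2 ^ (m - 1)) &&& ones m n) % (2 ^ m - 1) =
      ((Finset.range n).filter (fun k => 2 ^ (m - 1) ≤ y k)).card := by
  rw [fields_shift_and_ones hm n hy]
  have h1 := fields_mod (m := m) (fun k => y k / 2 ^ (m - 1)) n
  have h2 : ∑ k ∈ Finset.range n, y k / 2 ^ (m - 1) =
      ((Finset.range n).filter (fun k => 2 ^ (m - 1) ≤ y k)).card := by
    rw [Finset.card_filter]
    refine Finset.sum_congr rfl fun k _ => ?_
    have hb : y k / 2 ^ (m - 1) < 2 := by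
      rw [Nat.div_lt_iff_lt_mul (by positivity), ← pow_succ']
      simpa [show m - 1 + 1 = m by omega] using hy k
    have hp : 0 < 2 ^ (m - 1) := by positivity
    split_ifs with h
    · have := Nat.div_pos h hp
      omega
    · exact Nat.div_eq_of_lt (by omega)
  rw [h2] at h1
  -- The count is at most n, which is below the modulus, so the congruence is an equality.
  rw [h1, Nat.mod_eq_of_lt]
  refine lt_of_le_of_lt (Finset.card_filter_le _ _) ?_
  simpa using hn

/-! ### Programs with natural-number semantics -/

namespace WordRAM

/-- Expressions over the registers and the memory. -/
inductive Ex where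
  | reg (r : ℕ)
  | const (v : ℕ)
  | bin (f : BinOp) (e₁ e₂ : Ex)
  | load (e : Ex)

/-- Evaluating an expression into register `d`, with the registers beyond `d` as scratch
space. -/
def Ex.compile : Ex → ℕ → Program
  | .reg r, d => .op .add d (.reg r) (.const 0)
  | .const v, d => .op .add d (.const v) (.const 0)
  | .bin f e₁ e₂, d => .seq (e₁.compile d) (.seq (e₂.compile (d + 1))
      (.op f d (.reg d) (.reg (d + 1))))
  | .load e, d => .seq (e.compile d) (.load d (.reg d))

/-- The number of steps that the evaluation takes. -/
def Ex.cost : Ex → ℕ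
  | .reg _ => 1
  | .const _ => 1
  | .bin _ e₁ e₂ => e₁.cost + (e₂.cost + 1)
  | .load e => e.cost + 1

/-- The number of registers that serve as variables; the others are scratch space. -/
def numVars : ℕ := 8

/-- With the values `env` of the variables and the memory contents `M`, the expression evaluates
to a natural number without overflow in `w`-bit words. -/
inductive Ev (w : ℕ) (M env : ℕ → ℕ) : Ex → ℕ → Prop where
  | reg {r : ℕ} : r < numVars → Ev w M env (.reg r) (env r)
  | const {v : ℕ} : v < 2 ^ w → Ev w M env (.const v) v
  | add {a b : Ex} {x y : ℕ} : Ev w M env a x → Ev w M env b y → x + y < 2 ^ w →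
      Ev w M env (.bin .add a b) (x + y)
  | sub {a b : Ex} {x y : ℕ} : Ev w M env a x → Ev w M env b y → y ≤ x →
      Ev w M env (.bin .sub a b) (x - y)
  | mul {a b : Ex} {x y : ℕ} : Ev w M env a x → Ev w M env b y → x * y < 2 ^ w →
      Ev w M env (.bin .mul a b) (x * y)
  | div {a b : Ex} {x y : ℕ} : Ev w M env a x → Ev w M env b y →
      Ev w M env (.bin .div a b) (x / y)
  | mod {a b : Ex} {x y : ℕ} : Ev w M env a x → Ev w M env b y →
      Ev w M env (.bin .mod a b) (x % y)
  | and {a b : Ex} {x y : ℕ} : Ev w M env a x → Ev w M env b y →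
      Ev w M env (.bin .and a b) (x &&& y)
  | xor {a b : Ex} {x y : ℕ} : Ev w M env a x → Ev w M env b y →
      Ev w M env (.bin .xor a b) (x ^^^ y)
  | shl {a b : Ex} {x y : ℕ} : Ev w M env a x → Ev w M env b y → x * 2 ^ y < 2 ^ w →
      Ev w M env (.bin .shl a b) (x * 2 ^ y)
  | shr {a b : Ex} {x y : ℕ} : Ev w M env a x → Ev w M env b y →
      Ev w M env (.bin .shr a b) (x / 2 ^ y)
  | load {a : Ex} {x : ℕ} : Ev w M env a x → Ev w M env (.load a) (M x)

/-- The state has the values `env` of the variables and the memory contents `M`. -/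
structure Agrees {w : ℕ} (M env : ℕ → ℕ) (s : State w) : Prop where
  reg : ∀ r < numVars, (s.reg r).toNat = env r
  mem : ∀ x : BitVec w, (s.mem x).toNat = M x.toNat

variable {w : ℕ} {M env : ℕ → ℕ}

/-- Scratch registers act as a stack: evaluating the second operand from d + 1 upwards leaves the
first one in d intact. The side conditions in `Ev` rule out wraparound, so word arithmetic agrees
with arithmetic in ℕ. -/
theorem exec_compile {e : Ex} {v : ℕ} (h : Ev w M env e v) :
    ∀ (d : ℕ) (s : State w), numVars ≤ d → Agrees M env s →
      ∃ s' : State w, Exec (e.compile d) s e.cost s' ∧ (s'.reg d).toNat = v ∧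
        s'.mem = s.mem ∧ ∀ r < d, s'.reg r = s.reg r := by
  have frame : ∀ {s s' : State w} {d : ℕ}, numVars ≤ d → Agrees M env s → s'.mem = s.mem →
      (∀ r < d, s'.reg r = s.reg r) → Agrees M env s' := by
    intro s s' d hd hs hm hr
    exact ⟨fun r hr' => by rw [hr r (by omega)]; exact hs.reg r hr', fun x => by
      rw [hm]; exact hs.mem x⟩
  have binop : ∀ {f : BinOp} {a b : Ex} {x y z : ℕ},
      (∀ (d : ℕ) (s : State w), numVars ≤ d → Agrees M env s →
        ∃ s' : State w, Exec (a.compile d) s a.cost s' ∧ (s'.reg d).toNat = x ∧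
          s'.mem = s.mem ∧ ∀ r < d, s'.reg r = s.reg r) →
      (∀ (d : ℕ) (s : State w), numVars ≤ d → Agrees M env s →
        ∃ s' : State w, Exec (b.compile d) s b.cost s' ∧ (s'.reg d).toNat = y ∧
          s'.mem = s.mem ∧ ∀ r < d, s'.reg r = s.reg r) →
      (∀ u v : BitVec w, u.toNat = x → v.toNat = y → (f.eval u v).toNat = z) →
      ∀ (d : ℕ) (s : State w), numVars ≤ d → Agrees M env s →
        ∃ s' : State w, Exec ((Ex.bin f a b).compile d) s (Ex.bin f a b).cost s' ∧
          (s'.reg d).toNat = z ∧ s'.mem = s.mem ∧ ∀ r < d, s'.reg r = s.reg r := by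
    intro f a b x y z iha ihb hf d s hd hs
    obtain ⟨s₁, e₁, v₁, m₁, r₁⟩ := iha d s hd hs
    obtain ⟨s₂, e₂, v₂, m₂, r₂⟩ := ihb (d + 1) s₁ (by omega) (frame hd hs m₁ r₁)
    refine ⟨_, .seq e₁ (.seq e₂ (.op f d _ _ _)), ?_, ?_, ?_⟩
    · simp only [State.setReg, Operand.val, Function.update_self]
      exact hf _ _ (by rw [r₂ d (by omega)]; exact v₁) v₂
    · simp [State.setReg, m₁, m₂]
    · intro r hr
      simp only [State.setReg]
      rw [Function.update_of_ne (by omega), r₂ r (by omega), r₁ r hr]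
  induction h with
  | @reg r hr =>
    intro d s hd hs
    refine ⟨_, .op .add d _ _ s, ?_, rfl, ?_⟩
    · simp [State.setReg, BinOp.eval, Operand.val, hs.reg r hr]
    · intro r hr
      simp [State.setReg, Function.update_of_ne (show r ≠ d by omega)]
  | @const v hv =>
    intro d s hd hs
    refine ⟨_, .op .add d _ _ s, ?_, rfl, ?_⟩
    · simp [State.setReg, BinOp.eval, Operand.val, Nat.mod_eq_of_lt hv]
    · intro r hr
      simp [State.setReg, Function.update_of_ne (show r ≠ d by omega)]
  | add _ _ h iha ihb =>
    refine binop iha ihb fun u v hu hv => ?_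
    simp only [BinOp.eval]
    rw [BitVec.toNat_add, hu, hv, Nat.mod_eq_of_lt h]
  | sub _ _ h iha ihb =>
    refine binop iha ihb fun u v hu hv => ?_
    simp only [BinOp.eval]
    rw [BitVec.toNat_sub_of_le (by rw [BitVec.le_def]; omega), hu, hv]
  | mul _ _ h iha ihb =>
    refine binop iha ihb fun u v hu hv => ?_
    simp only [BinOp.eval]
    rw [BitVec.toNat_mul, hu, hv, Nat.mod_eq_of_lt h]
  | div _ _ iha ihb =>
    refine binop iha ihb fun u v hu hv => ?_
    simp [BinOp.eval, hu, hv]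
  | mod _ _ iha ihb =>
    refine binop iha ihb fun u v hu hv => ?_
    simp [BinOp.eval, hu, hv]
  | and _ _ iha ihb =>
    refine binop iha ihb fun u v hu hv => ?_
    simp [BinOp.eval, hu, hv]
  | xor _ _ iha ihb =>
    refine binop iha ihb fun u v hu hv => ?_
    simp [BinOp.eval, hu, hv]
  | shl _ _ h iha ihb =>
    refine binop iha ihb fun u v hu hv => ?_
    simp only [BinOp.eval]
    rw [BitVec.toNat_shiftLeft, hu, hv, Nat.shiftLeft_eq, Nat.mod_eq_of_lt h]
  | shr _ _ iha ihb =>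
    refine binop iha ihb fun u v hu hv => ?_
    simp only [BinOp.eval]
    rw [BitVec.toNat_ushiftRight, hu, hv, Nat.shiftRight_eq_div_pow]
  | load _ iha =>
    intro d s hd hs
    obtain ⟨s₁, e₁, v₁, m₁, r₁⟩ := iha d s hd hs
    refine ⟨_, .seq e₁ (.load d _ _), ?_, ?_, ?_⟩
    · simp only [State.setReg, Operand.val, Function.update_self]
      rw [m₁, hs.mem, v₁]
    · simp [State.setReg, m₁]
    · intro r hr
      simp only [State.setReg]
      rw [Function.update_of_ne (by omega), r₁ r hr]

/-! ### Hoare triples with step bounds -/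

variable (w M) in
/-- The program takes every state with the variables `env` to one with the variables `env'`, in
at most `T` steps and without changing the memory. -/
def Runs (p : Program) (env : ℕ → ℕ) (T : ℕ) (env' : ℕ → ℕ) : Prop :=
  ∀ s : State w, Agrees M env s → ∃ t s', t ≤ T ∧ Exec p s t s' ∧ Agrees M env' s'

/-- Assigning the value of an expression to a variable. -/
def assign (r : ℕ) (e : Ex) : Program :=
  .seq (e.compile numVars) (.op .add r (.reg numVars) (.const 0))

/-- Branching on the values of two expressions. -/
def ifThenElse (c : Test) (e₁ e₂ : Ex) (p q : Program) : Program :=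
  .seq (e₁.compile numVars) (.seq (e₂.compile (numVars + 1))
    (.branch c (.reg numVars) (.reg (numVars + 1)) p q))

theorem Runs.mono {p : Program} {T T' : ℕ} {env' : ℕ → ℕ} (h : Runs w M p env T env')
    (hT : T ≤ T') : Runs w M p env T' env' := by
  intro s hs
  obtain ⟨t, s', ht, he, ha⟩ := h s hs
  exact ⟨t, s', ht.trans hT, he, ha⟩

/-- A bound for the number of steps of a program without loops. -/
def Program.steps : Program → ℕ
  | .skip => 1
  | .op _ _ _ _ => 1
  | .load _ _ => 1
  | .store _ _ => 1
  | .seq p q => p.steps + q.steps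
  | .branch _ _ _ p q => max p.steps q.steps + 1
  | .loop _ _ _ _ => 1

theorem steps_compile (e : Ex) (d : ℕ) : (e.compile d).steps = e.cost := by
  induction e generalizing d with
  | reg r => rfl
  | const v => rfl
  | bin f a b iha ihb => simp [Ex.compile, Program.steps, Ex.cost, iha, ihb]
  | load e ih => simp [Ex.compile, Program.steps, Ex.cost, ih]

theorem Runs.seq {p q : Program} {T₁ T₂ : ℕ} {env₁ env₂ : ℕ → ℕ}
    (h₁ : Runs w M p env T₁ env₁) (h₂ : Runs w M q env₁ T₂ env₂) :
    Runs w M (.seq p q) env (T₁ + T₂) env₂ := by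
  intro s hs
  obtain ⟨t₁, s₁, ht₁, he₁, ha₁⟩ := h₁ s hs
  obtain ⟨t₂, s₂, ht₂, he₂, ha₂⟩ := h₂ s₁ ha₁
  exact ⟨_, s₂, by omega, .seq he₁ he₂, ha₂⟩

/-- The bound is read off from the program text, so for loop-free parts it is a constant independent
of the word size, the sequence and ε. -/
theorem Runs.seq_steps {p q : Program} {env₁ env₂ : ℕ → ℕ}
    (h₁ : Runs w M p env p.steps env₁) (h₂ : Runs w M q env₁ q.steps env₂) :
    Runs w M (.seq p q) env (Program.seq p q).steps env₂ := h₁.seq h₂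

theorem Runs.skip : Runs w M .skip env Program.skip.steps env :=
  fun s hs => ⟨1, s, le_rfl, .skip s, hs⟩

theorem Runs.assign {r : ℕ} {e : Ex} {v : ℕ} (h : Ev w M env e v) :
    Runs w M (assign r e) env (assign r e).steps (Function.update env r v) := by
  intro s hs
  obtain ⟨s₁, e₁, v₁, m₁, r₁⟩ := exec_compile h numVars s le_rfl hs
  refine ⟨_, _, ?_, .seq e₁ (.op .add r _ _ _), ?_, ?_⟩
  · simp [WordRAM.assign, Program.steps, steps_compile]
  · intro r' hr'
    by_cases h' : r' = r
    · subst h'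
      simp [State.setReg, BinOp.eval, Operand.val, v₁]
    · simp only [State.setReg]
      rw [Function.update_of_ne h', Function.update_of_ne h', r₁ r' hr', hs.reg r' hr']
  · intro x
    simp only [State.setReg]
    rw [m₁, hs.mem]

theorem exec_operands {e₁ e₂ : Ex} {x y : ℕ} (h₁ : Ev w M env e₁ x) (h₂ : Ev w M env e₂ y)
    {s : State w} (hs : Agrees M env s) :
    ∃ s' s'' : State w, Exec (e₁.compile numVars) s e₁.cost s' ∧
      Exec (e₂.compile (numVars + 1)) s' e₂.cost s'' ∧
      (s''.reg numVars).toNat = x ∧ (s''.reg (numVars + 1)).toNat = y ∧ Agrees M env s'' := by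
  obtain ⟨s₁, e₁, v₁, m₁, r₁⟩ := exec_compile h₁ numVars s le_rfl hs
  have hs₁ : Agrees M env s₁ := ⟨fun r hr => by rw [r₁ r hr, hs.reg r hr], fun x => by
    rw [m₁, hs.mem]⟩
  obtain ⟨s₂, e₂, v₂, m₂, r₂⟩ := exec_compile h₂ (numVars + 1) s₁ (by omega) hs₁
  exact ⟨s₁, s₂, e₁, e₂, by rw [r₂ _ (by omega)]; exact v₁, v₂,
    fun r hr => by rw [r₂ r (by omega), hs₁.reg r hr], fun x => by rw [m₂, hs₁.mem]⟩

/-- Branching on the order of two expressions. -/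
theorem Runs.ifLt {e₁ e₂ : Ex} {x y : ℕ} {p q : Program} {env' : ℕ → ℕ}
    (h₁ : Ev w M env e₁ x) (h₂ : Ev w M env e₂ y)
    (hp : x < y → Runs w M p env p.steps env') (hq : y ≤ x → Runs w M q env q.steps env') :
    Runs w M (ifThenElse .lt e₁ e₂ p q) env (ifThenElse .lt e₁ e₂ p q).steps env' := by
  intro s hs
  obtain ⟨s₁, s₂, c₁, c₂, v₁, v₂, hs₂⟩ := exec_operands h₁ h₂ hs
  simp only [ifThenElse, Program.steps, steps_compile]
  rcases lt_or_ge x y with h | h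
  · obtain ⟨t, s', ht, he, ha⟩ := hp h s₂ hs₂
    exact ⟨_, s', by omega, .seq c₁ (.seq c₂ (.branchTrue (by
      simpa [Test.Holds, Operand.val, v₁, v₂] using h) he)), ha⟩
  · obtain ⟨t, s', ht, he, ha⟩ := hq h s₂ hs₂
    exact ⟨_, s', by omega, .seq c₁ (.seq c₂ (.branchFalse (by
      simpa [Test.Holds, Operand.val, v₁, v₂] using h) he)), ha⟩

theorem Runs.loop_done {x y : ℕ} {p : Program} (hx : x < numVars) (hy : y < numVars)
    (h : env y ≤ env x) : Runs w M (.loop .lt (.reg x) (.reg y) p) env 1 env := by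
  intro s hs
  refine ⟨1, s, le_rfl, .loopFalse ?_, hs⟩
  simpa [Test.Holds, Operand.val, hs.reg x hx, hs.reg y hy] using h

theorem Runs.loop_step {x y T₁ T₂ : ℕ} {p : Program} {env₁ env₂ : ℕ → ℕ} (hx : x < numVars)
    (hy : y < numVars) (h : env x < env y) (h₁ : Runs w M p env T₁ env₁)
    (h₂ : Runs w M (.loop .lt (.reg x) (.reg y) p) env₁ T₂ env₂) :
    Runs w M (.loop .lt (.reg x) (.reg y) p) env (T₁ + T₂ + 1) env₂ := by
  intro s hs
  obtain ⟨t₁, s₁, ht₁, he₁, ha₁⟩ := h₁ s hs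
  obtain ⟨t₂, s₂, ht₂, he₂, ha₂⟩ := h₂ s₁ ha₁
  refine ⟨_, s₂, by omega, .loopTrue ?_ he₁ he₂, ha₂⟩
  simpa [Test.Holds, Operand.val, hs.reg x hx, hs.reg y hy] using h

end WordRAM

/-! ### Estimating the mode frequency up to a constant factor -/

section Scale

variable {α : Type*} [DecidableEq α] (c : ℕ → α)

/-- The mode frequency between `x` and the odd multiple of `2 ^ t` next to it: the end of the block
of length `2 ^ t` around `x` if this is an even one, and its beginning otherwise. -/
def scaleFreq (t x : ℕ) : ℕ :=
  if x / 2 ^ t % 2 = 0 then maxFreq c x ((x / 2 ^ t + 1) * 2 ^ t)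
  else maxFreq c (x / 2 ^ t * 2 ^ t) x

variable {c}

/-- As t is the highest bit in which a and y differ, the quotients by 2^t are an even number and its
successor. The multiple of 2^t between them is the cut point for both values of `scaleFreq`. The
left part is never empty, whereas the right one may be. -/
theorem scaleFreq_split {a y t : ℕ} (h : a < y) (ht : t = Nat.log 2 (a ^^^ y)) :
    maxFreq c a y ≤ scaleFreq c t a + scaleFreq c t y ∧ scaleFreq c t a ≤ maxFreq c a y ∧
      scaleFreq c t y ≤ maxFreq c a y ∧ 1 ≤ scaleFreq c t a ∧
        a / 2 ^ t % 2 = 0 ∧ y / 2 ^ t % 2 = 1 := by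
  have hne : a ^^^ y ≠ 0 := by
    rw [Ne, Nat.xor_eq_zero_iff]
    omega
  have hx : (a / 2 ^ t) ^^^ (y / 2 ^ t) = 1 := by
    rw [← Nat.xor_div_two_pow, ht]
    have h1 := Nat.pow_log_le_self 2 hne
    have h2 := Nat.lt_pow_succ_log_self one_lt_two (a ^^^ y)
    rw [pow_succ] at h2
    exact Nat.div_eq_of_lt_le (by omega) (by omega)
  have hle : a / 2 ^ t ≤ y / 2 ^ t := Nat.div_le_div_right h.le
  have h1 : (a / 2 ^ t / 2) ^^^ (y / 2 ^ t / 2) = 0 := by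
    have := Nat.xor_div_two_pow (a := a / 2 ^ t) (b := y / 2 ^ t) (n := 1)
    rw [hx] at this
    simpa using this.symm
  rw [Nat.xor_eq_zero_iff] at h1
  have h2 : (a / 2 ^ t + y / 2 ^ t) % 2 = 1 := by
    have := Nat.xor_mod_two_eq (m := a / 2 ^ t) (n := y / 2 ^ t)
    rw [hx] at this
    omega
  have hA : a / 2 ^ t % 2 = 0 := by omega
  have hY : y / 2 ^ t = a / 2 ^ t + 1 := by omega
  have hY' : ¬ (a / 2 ^ t + 1) % 2 = 0 := by omega
  have ham : a < (a / 2 ^ t + 1) * 2 ^ t := by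
    have := Nat.lt_div_mul_add (a := a) (b := 2 ^ t) (by positivity)
    rw [add_mul, one_mul]
    exact this
  have hmy : (a / 2 ^ t + 1) * 2 ^ t ≤ y := by
    rw [← hY]
    exact Nat.div_mul_le_self _ _
  unfold scaleFreq
  rw [hY, if_pos hA, if_neg hY']
  exact ⟨maxFreq_split _ _ _, maxFreq_mono le_rfl hmy, maxFreq_mono ham.le le_rfl,
    maxFreq_pos ham, hA, by omega⟩

/-- The `z`-th position of the `u`-th block of length `2 ^ b`, in the direction in which
`scaleFreq c t` increases. -/
def blockPos (b t u z : ℕ) : ℕ :=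
  if u * 2 ^ b / 2 ^ t % 2 = 0 then u * 2 ^ b + (2 ^ b - 1 - z) else u * 2 ^ b + z

variable (c) in
/-- The values of `scaleFreq` in a block, in increasing order. -/
def blockFreq (b t u z : ℕ) : ℕ := scaleFreq c t (blockPos b t u z)

/-- A small dyadic block lies inside a single larger one, so one cut point and one direction serve
the whole small block. -/
theorem block_div {b t u w : ℕ} (hb : b ≤ t) (hw : w < 2 ^ b) :
    (u * 2 ^ b + w) / 2 ^ t = u * 2 ^ b / 2 ^ t := by
  obtain ⟨d, rfl⟩ := Nat.exists_eq_add_of_le hb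
  rw [pow_add, ← Nat.div_div_eq_div_mul, ← Nat.div_div_eq_div_mul, Nat.mul_comm u,
    Nat.mul_add_div (by positivity), Nat.div_eq_of_lt hw, Nat.mul_div_cancel_left _ (by positivity),
    add_zero]

theorem blockFreq_even {b t u z : ℕ} (hb : b ≤ t) (h : u * 2 ^ b / 2 ^ t % 2 = 0) :
    blockFreq c b t u z =
      maxFreq c (u * 2 ^ b + (2 ^ b - 1 - z)) ((u * 2 ^ b / 2 ^ t + 1) * 2 ^ t) := by
  have hp : 0 < 2 ^ b := by positivity
  rw [blockFreq, blockPos, if_pos h, scaleFreq, block_div hb (by omega), if_pos h]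

theorem blockFreq_odd {b t u z : ℕ} (hb : b ≤ t) (h : ¬ u * 2 ^ b / 2 ^ t % 2 = 0)
    (hz : z < 2 ^ b) :
    blockFreq c b t u z = maxFreq c (u * 2 ^ b / 2 ^ t * 2 ^ t) (u * 2 ^ b + z) := by
  rw [blockFreq, blockPos, if_neg h, scaleFreq, block_div hb hz, if_neg h]

/-- Increasing z lengthens the range, at its left end in even blocks and at its right end in odd
ones. Each added position raises the mode frequency by at most one. -/
theorem blockFreq_mono {b t u z z' : ℕ} (hb : b ≤ t) (h : z ≤ z') (hz : z' < 2 ^ b) :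
    blockFreq c b t u z ≤ blockFreq c b t u z' ∧
      blockFreq c b t u z' ≤ blockFreq c b t u z + (z' - z) := by
  by_cases h0 : u * 2 ^ b / 2 ^ t % 2 = 0
  · rw [blockFreq_even hb h0, blockFreq_even hb h0]
    refine ⟨maxFreq_mono (by omega) le_rfl, ?_⟩
    have h1 := maxFreq_split (c := c) (u * 2 ^ b + (2 ^ b - 1 - z'))
      (u * 2 ^ b + (2 ^ b - 1 - z)) ((u * 2 ^ b / 2 ^ t + 1) * 2 ^ t)
    have h2 := maxFreq_le_length (c := c) (u * 2 ^ b + (2 ^ b - 1 - z'))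
      (u * 2 ^ b + (2 ^ b - 1 - z))
    omega
  · rw [blockFreq_odd hb h0 (by omega), blockFreq_odd hb h0 hz]
    refine ⟨maxFreq_mono le_rfl (by omega), ?_⟩
    have h1 := maxFreq_split (c := c) (u * 2 ^ b / 2 ^ t * 2 ^ t) (u * 2 ^ b + z)
      (u * 2 ^ b + z')
    have h2 := maxFreq_le_length (c := c) (u * 2 ^ b + z) (u * 2 ^ b + z')
    omega

theorem blockFreq_left {b t a : ℕ} (hb : b ≤ t) (ha : a / 2 ^ t % 2 = 0) :
    blockFreq c b t (a / 2 ^ b) (2 ^ b - 1 - a % 2 ^ b) = scaleFreq c t a := by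
  have hlt : a % 2 ^ b < 2 ^ b := Nat.mod_lt _ (by positivity)
  have h1 := block_div (u := a / 2 ^ b) hb hlt
  have h2 := Nat.div_add_mod' a (2 ^ b)
  rw [h2] at h1
  unfold blockFreq blockPos
  rw [← h1, if_pos ha, show 2 ^ b - 1 - (2 ^ b - 1 - a % 2 ^ b) = a % 2 ^ b by omega, h2]

theorem blockFreq_right {b t a : ℕ} (hb : b ≤ t) (ha : a / 2 ^ t % 2 = 1) :
    blockFreq c b t (a / 2 ^ b) (a % 2 ^ b) = scaleFreq c t a := by
  have hlt : a % 2 ^ b < 2 ^ b := Nat.mod_lt _ (by positivity)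
  have h1 := block_div (u := a / 2 ^ b) hb hlt
  have h2 := Nat.div_add_mod' a (2 ^ b)
  rw [h2] at h1
  unfold blockFreq blockPos
  rw [← h1, if_neg (by omega), h2]

/-- This keeps the stored bit length at most t + 1, so it fits into a field of t + 1 bits. -/
theorem blockFreq_zero_lt {b t u : ℕ} (hb : b ≤ t) :
    blockFreq c b t u 0 < 2 ^ (t + 1) := by
  have hp : 2 ^ b ≤ 2 ^ t := Nat.pow_le_pow_right two_pos hb
  have hpos : 0 < 2 ^ b := by positivity
  by_cases h0 : u * 2 ^ b / 2 ^ t % 2 = 0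
  · rw [blockFreq_even hb h0, add_mul, pow_succ]
    refine lt_of_le_of_lt (maxFreq_le_length _ _) ?_
    have := Nat.div_mul_le_self (u * 2 ^ b) (2 ^ t)
    omega
  · rw [blockFreq_odd hb h0 hpos, pow_succ]
    refine lt_of_le_of_lt (maxFreq_le_length _ _) ?_
    have h := Nat.lt_div_mul_add (a := u * 2 ^ b) (b := 2 ^ t) (by positivity)
    omega

/-! ### Thresholds inside a block -/

variable (c) in
/-- The place in the block where `blockFreq` reaches `2 ^ k`. -/
def threshold (b t u k : ℕ) : ℕ := Nat.count (fun z => blockFreq c b t u z < 2 ^ k) (2 ^ b)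

variable (c) in
/-- The thresholds of a block, packed for parallel comparison. -/
def thresholdWord (b t u : ℕ) : ℕ :=
  fields (b + 2) (fun k => 2 ^ (b + 1) - threshold c b t u k) (b + 1)

theorem threshold_le (b t u k : ℕ) : threshold c b t u k ≤ 2 ^ b := Nat.count_le _

theorem threshold_le_iff {b t u k z : ℕ} (hb : b ≤ t) (hz : z < 2 ^ b) :
    threshold c b t u k ≤ z ↔ 2 ^ k ≤ blockFreq c b t u z := by
  have := lt_count_iff (p := fun z => blockFreq c b t u z < 2 ^ k) (m := 2 ^ b) (i := z)
    fun z z' h h' hl => lt_of_le_of_lt (blockFreq_mono hb h h').1 hl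
  rw [← not_lt, threshold, this]
  simp [hz]

/-- Each field stays below 2^(b + 1) + 2^b, so adding z to all fields at once produces no carry
between them. -/
theorem thresholdWord_add_lt {b t u z : ℕ} (hz : z < 2 ^ b) :
    thresholdWord c b t u + z * ones (b + 2) (b + 1) < 2 ^ ((b + 2) * (b + 1)) := by
  rw [thresholdWord, fields_add_mul_ones]
  refine fields_lt _ fun k => ?_
  rw [pow_succ 2 (b + 1), pow_succ]
  omega

/-- The number of powers of two, up to `2 ^ b`, that are reached at `z`. -/
def thresholdRank (b Y z : ℕ) : ℕ :=
  ((Y + z * ones (b + 2) (b + 1)) / 2 ^ (b + 1) &&& ones (b + 2) (b + 1)) % (2 ^ (b + 2) - 1)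

/-- After the addition, the top bit of field k, of weight 2^(b + 1), is set exactly when the k-th
threshold is at most z. Only the powers 2^0, ..., 2^b have fields, whence the minimum. -/
theorem thresholdRank_eq {b t u z : ℕ} (hb : b ≤ t) (hz : z < 2 ^ b) :
    thresholdRank b (thresholdWord c b t u) z = min (b + 1) (Nat.size (blockFreq c b t u z)) := by
  have hy : ∀ k, 2 ^ (b + 1) - threshold c b t u k + z < 2 ^ (b + 2) := by
    intro k
    rw [pow_succ 2 (b + 1), pow_succ]
    omega
  have hn : b + 1 < 2 ^ (b + 2) - 1 := by
    have : b + 2 < 2 ^ (b + 2) := Nat.lt_two_pow_self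
    omega
  rw [thresholdRank, thresholdWord, fields_add_mul_ones]
  have h := parallel_count (by omega : 2 ≤ b + 2) hn hy
  rw [show b + 2 - 1 = b + 1 by omega] at h
  rw [h]
  have : (Finset.range (b + 1)).filter
      (fun k => 2 ^ (b + 1) ≤ 2 ^ (b + 1) - threshold c b t u k + z) =
      Finset.range (min (b + 1) (Nat.size (blockFreq c b t u z))) := by
    ext k
    have h1 := threshold_le (c := c) b t u k
    have h2 := threshold_le_iff (c := c) (u := u) (k := k) hb hz
    have h3 : 2 ^ b ≤ 2 ^ (b + 1) := Nat.pow_le_pow_right two_pos (by omega)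
    simp only [Finset.mem_filter, Finset.mem_range, lt_min_iff, Nat.lt_size]
    rw [← h2]
    exact and_congr_right fun _ => by omega
  rw [this, Finset.card_range]

/-- The size of `blockFreq` is determined up to one by its value at the beginning of the block and
the thresholds. -/
theorem size_estimate {b t u z : ℕ} (hb : b ≤ t) (hz : z < 2 ^ b) :
    max (Nat.size (blockFreq c b t u 0)) (thresholdRank b (thresholdWord c b t u) z) ≤
        Nat.size (blockFreq c b t u z) ∧
      (Nat.size (blockFreq c b t u z) ≤
        max (Nat.size (blockFreq c b t u 0)) (thresholdRank b (thresholdWord c b t u) z) + 1) ∧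
      (1 ≤ blockFreq c b t u z →
        1 ≤ max (Nat.size (blockFreq c b t u 0)) (thresholdRank b (thresholdWord c b t u) z)) := by
  have hm := blockFreq_mono (c := c) (u := u) hb (Nat.zero_le z) hz
  rw [thresholdRank_eq hb hz]
  have h0 : Nat.size (blockFreq c b t u 0) ≤ Nat.size (blockFreq c b t u z) :=
    Nat.size_le_size hm.1
  refine ⟨by omega, ?_, ?_⟩
  · by_cases hs : Nat.size (blockFreq c b t u z) ≤ b + 1
    · omega
    · push Not at hs
      have h1 : 2 ^ (b + 1) ≤ blockFreq c b t u z := Nat.lt_size.1 hs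
      have h2 : 2 ^ (Nat.size (blockFreq c b t u z) - 1) ≤ blockFreq c b t u z :=
        Nat.lt_size.1 (by omega)
      -- Beyond 2^(b + 1) no threshold is needed: the growth inside the block is below 2^b, so the
      -- initial value is more than half the current one.
      have h3 : Nat.size (blockFreq c b t u z) - 2 < Nat.size (blockFreq c b t u 0) := by
        rw [Nat.lt_size]
        rw [show Nat.size (blockFreq c b t u z) - 1 =
          Nat.size (blockFreq c b t u z) - 2 + 1 by omega, pow_succ] at h2
        rw [pow_succ] at h1
        omega
      omega
  · intro h
    have : 0 < Nat.size (blockFreq c b t u z) := Nat.size_pos.2 h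
    omega

/-- Combining the two estimates on either side of a multiple of a power of two. -/
theorem maxFreq_estimate {F G G' K K' : ℕ} (hF : F ≤ G + G') (hG : G ≤ F) (hG' : G' ≤ F)
    (h1 : K ≤ Nat.size G) (h2 : Nat.size G ≤ K + 1) (h3 : K' ≤ Nat.size G')
    (h4 : Nat.size G' ≤ K' + 1) (h5 : 1 ≤ K) :
    2 ^ (max K K' - 1) ≤ F ∧ F < 2 ^ (max K K' + 2) := by
  constructor
  · rw [← Nat.lt_size]
    have := Nat.size_le_size hG
    have := Nat.size_le_size hG'
    omega
  · have h6 : G < 2 ^ (max K K' + 1) := Nat.size_le.1 (by omega)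
    have h7 : G' < 2 ^ (max K K' + 1) := Nat.size_le.1 (by omega)
    rw [show max K K' + 2 = max K K' + 1 + 1 by omega, pow_succ]
    omega

end Scale

/-! ### The frequencies that are distinguished -/

section Levels

variable (q : ℕ)

/-- The stride of a level is `2 ^ shift`. -/
def levelShift (l : ℕ) : ℕ := l / 2 ^ q - 1

/-- The frequency of a level: floating point numbers with `q` bits of precision. -/
def levelFreq (l : ℕ) : ℕ :=
  if l < 2 ^ q then l else (2 ^ q + l % 2 ^ q) * 2 ^ levelShift q l

/-- The level of the frequency `2 ^ m`. -/
def powLevel (m : ℕ) : ℕ := if m < q then 2 ^ m else (m - q + 1) * 2 ^ q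

variable {q}

/-- The spacing of floating point numbers. When the mantissa overflows, (2 * 2^q - 1) s + s = 2^q *
(2 s) is the first number of the next exponent. -/
theorem levelFreq_succ (l : ℕ) :
    levelFreq q (l + 1) = levelFreq q l + 2 ^ levelShift q l := by
  have hp : 0 < 2 ^ q := by positivity
  have hd := Nat.div_add_mod l (2 ^ q)
  have hm := Nat.mod_lt l hp
  unfold levelFreq levelShift
  by_cases h1 : l + 1 < 2 ^ q
  · rw [if_pos h1, if_pos (by omega), Nat.div_eq_of_lt (by omega)]
    simp
  · rw [if_neg h1]
    by_cases h2 : l < 2 ^ q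
    · have : l + 1 = 2 ^ q := by omega
      rw [if_pos h2, this, Nat.div_self hp, Nat.mod_self, Nat.div_eq_of_lt h2]
      simp [← this]
    · rw [if_neg h2]
      have hge : 1 ≤ l / 2 ^ q := Nat.div_pos (by omega) hp
      by_cases h3 : l % 2 ^ q + 1 < 2 ^ q
      · have h4 : (l + 1) / 2 ^ q = l / 2 ^ q := by
          rw [Nat.div_eq_iff hp, Nat.mul_comm]
          omega
        have h5 : (l + 1) % 2 ^ q = l % 2 ^ q + 1 := by
          have := Nat.div_add_mod (l + 1) (2 ^ q)
          rw [h4] at this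
          omega
        rw [h4, h5]
        ring
      · have h6 : l + 1 = 2 ^ q * (l / 2 ^ q + 1) := by
          rw [mul_add]
          omega
        have h4 : (l + 1) / 2 ^ q = l / 2 ^ q + 1 := by
          rw [h6, Nat.mul_div_cancel_left _ hp]
        have h5 : (l + 1) % 2 ^ q = 0 := by rw [h6, Nat.mul_mod_right]
        rw [h4, h5, show l / 2 ^ q + 1 - 1 = (l / 2 ^ q - 1) + 1 by omega, pow_succ]
        have h7 : l % 2 ^ q + 1 = 2 ^ q := by omega
        have : 2 ^ q + l % 2 ^ q = 2 * 2 ^ q - 1 := by omega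
        rw [this]
        generalize 2 ^ (l / 2 ^ q - 1) = s
        zify [show 1 ≤ 2 * 2 ^ q by omega]
        ring

theorem levelShift_eq_zero {l : ℕ} (h : l < 2 * 2 ^ q) : levelShift q l = 0 := by
  have : l / 2 ^ q < 2 := (Nat.div_lt_iff_lt_mul (by positivity)).2 h
  unfold levelShift
  omega

theorem levelShift_succ_le (l : ℕ) : levelShift q (l + 1) ≤ levelShift q l + 1 := by
  have : (l + 1) / 2 ^ q ≤ l / 2 ^ q + 1 := by
    rw [Nat.succ_div]
    split_ifs <;> omega
  unfold levelShift
  omega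

theorem two_pow_mul_stride_le {l : ℕ} (h : 2 ^ q ≤ l) :
    2 ^ q * 2 ^ levelShift q l ≤ levelFreq q l := by
  rw [levelFreq, if_neg (by omega)]
  exact Nat.mul_le_mul_right _ (by omega)

theorem levelFreq_powLevel (m : ℕ) : levelFreq q (powLevel q m) = 2 ^ m := by
  unfold powLevel levelFreq levelShift
  split_ifs with h1 h2 h2
  · rfl
  · exact absurd (Nat.pow_lt_pow_right one_lt_two h1) h2
  · have : 0 < 2 ^ q := by positivity
    nlinarith
  · rw [Nat.mul_div_cancel _ (by positivity), Nat.mul_mod_left, add_zero, ← pow_add]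
    congr 1
    omega

/-- Doubling a frequency passes at most 2^q levels, so an estimate up to a constant factor leaves
O(2^q) levels to search. -/
theorem powLevel_succ_le (m : ℕ) : powLevel q (m + 1) ≤ powLevel q m + 2 ^ q := by
  unfold powLevel
  split_ifs with h1 h2 h2
  · exact (Nat.pow_le_pow_right two_pos h1.le).trans (Nat.le_add_left _ _)
  · omega
  · have : m + 1 = q := by omega
    rw [this]
    simp
  · rw [show m + 1 - q + 1 = m - q + 1 + 1 by omega, add_mul _ 1]
    omega

theorem powLevel_pos (m : ℕ) : 1 ≤ powLevel q m := by
  unfold powLevel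
  split_ifs
  · exact Nat.one_le_two_pow
  · exact Nat.mul_pos (by omega) (by positivity)

theorem one_le_levelFreq {l : ℕ} (h : 1 ≤ l) : 1 ≤ levelFreq q l := by
  unfold levelFreq
  split_ifs
  · exact h
  · have : 0 < 2 ^ q := by positivity
    exact Nat.mul_pos (by omega) (by positivity)

end Levels

/-! ### The contents of the data structure -/

/-- The parameters of the data structure: the length of the sequence and the precision of the
levels. -/
structure Layout where
  n : ℕ
  q : ℕ

namespace Layout

variable (S : Layout)

/-- Positions in the sequence have fewer bits than this. -/
def bits : ℕ := Nat.log 2 S.n + 2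

/-- The number of positions described by a record of a level. -/
def chunk : ℕ := S.bits / 2 + 1

/-- The greatest length of a field that is read. -/
def window : ℕ := 20 * S.bits

/-- The logarithm of the greatest length of the blocks of a scale. -/
def maxBlock : ℕ := 2 * Nat.log 2 S.bits + 2

/-- The logarithm of the length of the blocks of a scale. -/
def blockLog (t : ℕ) : ℕ := min t S.maxBlock

/-- The first summand is for the bit length at the start of the block, the second for the threshold
word. -/
def scaleRecBits (t : ℕ) : ℕ := (t + 1) + (S.blockLog t + 2) * (S.blockLog t + 1)

def scaleBlocks (t : ℕ) : ℕ := (S.n + 1) / 2 ^ S.blockLog t + 1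

/-- Levels with exponent e have stride 2^(e - 1). The inner + 1 makes room for left endpoints
rounded up past n + 1. -/
def levelBlocks (e : ℕ) : ℕ := ((S.n + 1) / 2 ^ (e - 1) + 1) / S.chunk + 1

def levelRecBits (e : ℕ) : ℕ := 3 * S.bits + 2 * S.chunk + S.chunk * (e - 1)

/-- There is a section for every scale and a section for every exponent of the levels. -/
def sectionBits (x : ℕ) : ℕ :=
  if x < S.bits then S.scaleBlocks x * S.scaleRecBits x
  else 2 ^ S.q * S.levelBlocks (x - S.bits) * S.levelRecBits (x - S.bits)

/-- Every level that the search evaluates is below (bits + 3) * 2^q, so its exponent is below bits +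
3. -/
def numSections : ℕ := S.bits + (S.bits + 3)

def totalBits : ℕ := fieldOffset S.sectionBits S.numSections

def levelFieldBits (e k : ℕ) : ℕ := if k < 3 then S.bits else if k < 5 then S.chunk else e - 1

variable {α : Type*} [DecidableEq α] (c : ℕ → α)

/-- The record of a block at scale `t`. -/
def scaleRec (t u : ℕ) : ℕ :=
  pack (fun k => if k = 0 then t + 1 else (S.blockLog t + 2) * (S.blockLog t + 1))
    (fun k => if k = 0 then Nat.size (blockFreq c (S.blockLog t) t u 0)
      else thresholdWord c (S.blockLog t) t u) 2

open Classical in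
/-- The fields of the record of a chunk at level `l`: two ranks, a position, two bit vectors, and
relative positions. -/
noncomputable def levelField (l u k : ℕ) : ℕ :=
  let s := 2 ^ levelShift S.q l
  let f := levelFreq S.q l
  if k = 0 then Nat.count (IsStairValue c s f) (u * S.chunk)
  else if k = 1 then Nat.count (IsStairStep c s f) (u * S.chunk)
  else if k = 2 then stairPos c s f (stair c s f (u * S.chunk))
  else if k = 3 then bitsOf (fun z => IsStairValue c s f (u * S.chunk + z)) S.chunk
  else if k = 4 then bitsOf (fun z => IsStairStep c s f (u * S.chunk + z)) S.chunk
  else stairPos c s f (stair c s f (u * S.chunk + (k - 5))) - s * (u * S.chunk + (k - 5) - 1)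

/-- The record of a chunk at level `l`. -/
noncomputable def levelRec (l u : ℕ) : ℕ :=
  pack (S.levelFieldBits (l / 2 ^ S.q)) (S.levelField c l u) (5 + S.chunk)

/-- All the bits of the data structure apart from the tables. -/
noncomputable def content : ℕ :=
  pack S.sectionBits (fun x => if x < S.bits then
      pack (fun _ => S.scaleRecBits x) (S.scaleRec c x) (S.scaleBlocks x)
    else pack (fun _ => S.levelRecBits (x - S.bits))
      (fun i => S.levelRec c ((x - S.bits) * 2 ^ S.q + i / S.levelBlocks (x - S.bits))
        (i % S.levelBlocks (x - S.bits)))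
      (2 ^ S.q * S.levelBlocks (x - S.bits))) S.numSections

def scaleAddr (t u : ℕ) : ℕ := fieldOffset S.sectionBits t + u * S.scaleRecBits t

def levelAddr (l u : ℕ) : ℕ :=
  fieldOffset S.sectionBits (S.bits + l / 2 ^ S.q) +
    (l % 2 ^ S.q * S.levelBlocks (l / 2 ^ S.q) + u) * S.levelRecBits (l / 2 ^ S.q)

/-! ### Addresses of records and reading back their fields -/

variable {S}

theorem length_lt : S.n + 1 < 2 ^ S.bits := by
  have h := Nat.lt_pow_succ_log_self one_lt_two S.n
  rw [bits, pow_succ]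
  omega

theorem chunk_pos : 0 < S.chunk := Nat.succ_pos _

theorem mul_add_le_mul {i N l o : ℕ} (hi : i < N) (ho : o ≤ l) : i * l + o ≤ N * l := by
  calc i * l + o ≤ i * l + l := by omega
    _ = (i + 1) * l := by ring
    _ ≤ N * l := Nat.mul_le_mul_right _ hi

theorem scale_section {t u o : ℕ} (ht : t < S.bits) (hu : u < S.scaleBlocks t)
    (ho : o ≤ S.scaleRecBits t) :
    u * S.scaleRecBits t + o ≤ S.sectionBits t := by
  rw [sectionBits, if_pos ht]
  exact mul_add_le_mul hu ho

theorem scaleAddr_le {t u o : ℕ} (ht : t < S.bits) (hu : u < S.scaleBlocks t)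
    (ho : o ≤ S.scaleRecBits t) : S.scaleAddr t u + o ≤ S.totalBits := by
  rw [scaleAddr, add_assoc]
  exact fieldOffset_add_le (by rw [numSections]; omega) (scale_section ht hu ho)

theorem slice_content_scale {t u o w : ℕ} (ht : t < S.bits) (hu : u < S.scaleBlocks t)
    (ho : o + w ≤ S.scaleRecBits t) :
    slice (S.content c) (S.scaleAddr t u + o) w = slice (S.scaleRec c t u) o w := by
  have h := scale_section ht hu ho
  rw [scaleAddr, add_assoc, content, slice_pack (by rw [numSections]; omega) (by omega), if_pos ht,
    slice_pack_const hu ho]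

theorem level_index_lt {l u : ℕ} (hu : u < S.levelBlocks (l / 2 ^ S.q)) :
    l % 2 ^ S.q * S.levelBlocks (l / 2 ^ S.q) + u < 2 ^ S.q * S.levelBlocks (l / 2 ^ S.q) :=
  mul_add_le_mul (o := u + 1) (Nat.mod_lt _ (by positivity)) hu

theorem level_section {l u o : ℕ} (hu : u < S.levelBlocks (l / 2 ^ S.q))
    (ho : o ≤ S.levelRecBits (l / 2 ^ S.q)) :
    (l % 2 ^ S.q * S.levelBlocks (l / 2 ^ S.q) + u) * S.levelRecBits (l / 2 ^ S.q) + o ≤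
      S.sectionBits (S.bits + l / 2 ^ S.q) := by
  rw [sectionBits, if_neg (not_lt.2 (Nat.le_add_right _ _)), Nat.add_sub_cancel_left]
  exact mul_add_le_mul (level_index_lt hu) ho

theorem levelAddr_le {l u o : ℕ} (he : l / 2 ^ S.q < S.bits + 3)
    (hu : u < S.levelBlocks (l / 2 ^ S.q)) (ho : o ≤ S.levelRecBits (l / 2 ^ S.q)) :
    S.levelAddr l u + o ≤ S.totalBits := by
  rw [levelAddr, add_assoc]
  exact fieldOffset_add_le (by rw [numSections]; omega) (level_section hu ho)

theorem slice_content_level {l u o w : ℕ} (he : l / 2 ^ S.q < S.bits + 3)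
    (hu : u < S.levelBlocks (l / 2 ^ S.q)) (ho : o + w ≤ S.levelRecBits (l / 2 ^ S.q)) :
    slice (S.content c) (S.levelAddr l u + o) w = slice (S.levelRec c l u) o w := by
  have h := level_section hu ho
  rw [levelAddr, add_assoc, content, slice_pack (by rw [numSections]; omega) (by omega),
    if_neg (not_lt.2 (Nat.le_add_right _ _))]
  simp only [Nat.add_sub_cancel_left]
  rw [slice_pack_const (level_index_lt hu) ho]
  have hN : 0 < S.levelBlocks (l / 2 ^ S.q) := by omega
  rw [Nat.mul_comm (l % 2 ^ S.q), Nat.mul_add_div hN, Nat.div_eq_of_lt hu, Nat.mul_add_mod,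
    Nat.mod_eq_of_lt hu, add_zero, Nat.div_add_mod']

theorem blockLog_le (t : ℕ) : S.blockLog t ≤ t := min_le_left _ _

theorem slice_scale_size {t u : ℕ} (ht : t < S.bits) (hu : u < S.scaleBlocks t) :
    slice (S.content c) (S.scaleAddr t u) (t + 1) =
      Nat.size (blockFreq c (S.blockLog t) t u 0) := by
  rw [← Nat.add_zero (S.scaleAddr t u), slice_content_scale c ht hu (by rw [scaleRecBits]; omega),
    scaleRec]
  have h := slice_pack
    (size := fun k => if k = 0 then t + 1 else (S.blockLog t + 2) * (S.blockLog t + 1))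
    (v := fun k => if k = 0 then Nat.size (blockFreq c (S.blockLog t) t u 0)
      else thresholdWord c (S.blockLog t) t u) (N := 2) (i := 0) (o := 0) (l := t + 1)
    (by omega) (by simp)
  simp only [fieldOffset, Finset.range_zero, Finset.sum_empty, zero_add, if_true] at h
  rw [h, slice_eq_self]
  have h1 : Nat.size (blockFreq c (S.blockLog t) t u 0) ≤ t + 1 :=
    Nat.size_le.2 (blockFreq_zero_lt (blockLog_le t))
  exact lt_of_le_of_lt h1 Nat.lt_two_pow_self

theorem slice_scale_word {t u : ℕ} (ht : t < S.bits) (hu : u < S.scaleBlocks t) :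
    slice (S.content c) (S.scaleAddr t u + (t + 1)) ((S.blockLog t + 2) * (S.blockLog t + 1)) =
      thresholdWord c (S.blockLog t) t u := by
  rw [slice_content_scale c ht hu (by rw [scaleRecBits]), scaleRec]
  have h := slice_pack
    (size := fun k => if k = 0 then t + 1 else (S.blockLog t + 2) * (S.blockLog t + 1))
    (v := fun k => if k = 0 then Nat.size (blockFreq c (S.blockLog t) t u 0)
      else thresholdWord c (S.blockLog t) t u) (N := 2) (i := 1) (o := 0)
    (l := (S.blockLog t + 2) * (S.blockLog t + 1)) (by omega) (by simp)
  simp only [fieldOffset, Finset.range_one, Finset.sum_singleton, if_true, one_ne_zero, if_false,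
    add_zero] at h
  rw [h, slice_eq_self]
  have := thresholdWord_add_lt (c := c) (t := t) (u := u) (z := 0) (b := S.blockLog t)
    (by positivity)
  simpa using this

theorem fieldOffset_level (e : ℕ) :
    fieldOffset (S.levelFieldBits e) 0 = 0 ∧ fieldOffset (S.levelFieldBits e) 1 = S.bits ∧
    fieldOffset (S.levelFieldBits e) 2 = 2 * S.bits ∧
    fieldOffset (S.levelFieldBits e) 3 = 3 * S.bits ∧
    fieldOffset (S.levelFieldBits e) 4 = 3 * S.bits + S.chunk ∧
    ∀ z, fieldOffset (S.levelFieldBits e) (5 + z) =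
      3 * S.bits + 2 * S.chunk + z * (e - 1) := by
  refine ⟨by simp [fieldOffset], ?_, ?_, ?_, ?_, fun z => ?_⟩
  · simp [fieldOffset, levelFieldBits]
  · simp [fieldOffset, Finset.sum_range_succ, levelFieldBits]; ring
  · simp [fieldOffset, Finset.sum_range_succ, levelFieldBits]; ring
  · simp [fieldOffset, Finset.sum_range_succ, levelFieldBits]; ring
  · induction z with
    | zero => simp [fieldOffset, Finset.sum_range_succ, levelFieldBits]; ring
    | succ z ih =>
      rw [← add_assoc, fieldOffset_succ, ih, levelFieldBits, if_neg (by omega), if_neg (by omega)]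
      ring

/-- Reading a field of a record of a level. -/
theorem slice_level_field {l u k o : ℕ} (he : l / 2 ^ S.q < S.bits + 3)
    (hu : u < S.levelBlocks (l / 2 ^ S.q)) (hk : k < 5 + S.chunk)
    (ho : fieldOffset (S.levelFieldBits (l / 2 ^ S.q)) k = o)
    (hv : S.levelField c l u k < 2 ^ S.levelFieldBits (l / 2 ^ S.q) k) :
    slice (S.content c) (S.levelAddr l u + o) (S.levelFieldBits (l / 2 ^ S.q) k) =
      S.levelField c l u k := by
  have h := fieldOffset_add_le (size := S.levelFieldBits (l / 2 ^ S.q)) hk le_rfl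
  rw [(fieldOffset_level (l / 2 ^ S.q)).2.2.2.2.2] at h
  rw [slice_content_level c he hu (by rw [levelRecBits]; omega), levelRec, ← ho,
    ← Nat.add_zero (fieldOffset _ k), slice_pack hk (by omega), slice_eq_self hv]

theorem div_chunk_lt {l i : ℕ} (hi : i ≤ (S.n + 1) / 2 ^ levelShift S.q l + 1) :
    i / S.chunk < S.levelBlocks (l / 2 ^ S.q) :=
  Nat.lt_succ_of_le (Nat.div_le_div_right hi)

open Classical in
/-- Reading a rank of a place among the values of a staircase. -/
theorem read_rank_value {l i : ℕ} (he : l / 2 ^ S.q < S.bits + 3)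
    (hi : i ≤ (S.n + 1) / 2 ^ levelShift S.q l + 1) (hi' : i ≤ S.n + 1) :
    slice (S.content c) (S.levelAddr l (i / S.chunk)) S.bits +
      popCount S.chunk (slice (S.content c) (S.levelAddr l (i / S.chunk) + 3 * S.bits) S.chunk %
        2 ^ (i % S.chunk + 1)) =
      Nat.count (IsStairValue c (2 ^ levelShift S.q l) (levelFreq S.q l)) (i + 1) := by
  have hmod := Nat.mod_lt i (chunk_pos (S := S))
  have hf := fieldOffset_level (S := S) (l / 2 ^ S.q)
  have h0 := slice_level_field c he (div_chunk_lt hi) (k := 0) (by omega) hf.1 (by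
    simp only [levelField, levelFieldBits]
    refine lt_of_le_of_lt (Nat.count_le _) ?_
    have := Nat.div_mul_le_self i S.chunk
    have := length_lt (S := S)
    simp only [if_true, show 0 < 3 by omega]
    omega)
  have h3 := slice_level_field c he (div_chunk_lt hi) (k := 3) (by omega) hf.2.2.2.1 (by
    simp only [levelField, levelFieldBits]
    simpa using bitsOf_lt _ _)
  simp only [levelField, levelFieldBits, add_zero] at h0 h3
  norm_num at h0 h3
  rw [h0, h3, ← count_eq_add_popCount (by omega), ← add_assoc, Nat.div_add_mod']

open Classical in
/-- Reading a rank of a place among the steps of a staircase. -/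
theorem read_rank_step {l i : ℕ} (he : l / 2 ^ S.q < S.bits + 3)
    (hi : i ≤ (S.n + 1) / 2 ^ levelShift S.q l + 1) (hi' : i ≤ S.n + 1) :
    slice (S.content c) (S.levelAddr l (i / S.chunk) + S.bits) S.bits +
      popCount S.chunk (slice (S.content c)
        (S.levelAddr l (i / S.chunk) + (3 * S.bits + S.chunk)) S.chunk %
        2 ^ (i % S.chunk + 1)) =
      Nat.count (IsStairStep c (2 ^ levelShift S.q l) (levelFreq S.q l)) (i + 1) := by
  have hmod := Nat.mod_lt i (chunk_pos (S := S))
  have hf := fieldOffset_level (S := S) (l / 2 ^ S.q)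
  have h0 := slice_level_field c he (div_chunk_lt hi) (k := 1) (by omega) hf.2.1 (by
    simp only [levelField, levelFieldBits]
    norm_num
    refine lt_of_le_of_lt (Nat.count_le _) ?_
    have := Nat.div_mul_le_self i S.chunk
    have := length_lt (S := S)
    omega)
  have h3 := slice_level_field c he (div_chunk_lt hi) (k := 4) (by omega) hf.2.2.2.2.1 (by
    simp only [levelField, levelFieldBits]
    simpa using bitsOf_lt _ _)
  simp only [levelField, levelFieldBits] at h0 h3
  norm_num at h0 h3
  rw [h0, h3, ← count_eq_add_popCount (by omega), ← add_assoc, Nat.div_add_mod']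

/-- The steps of a staircase up to a place, within its chunk. -/
noncomputable def stepWord (S : Layout) (l j : ℕ) : ℕ :=
  slice (S.content c) (S.levelAddr l (j / S.chunk) + (3 * S.bits + S.chunk)) S.chunk %
    2 ^ (j % S.chunk + 1)

theorem stepWord_eq {l j : ℕ} (he : l / 2 ^ S.q < S.bits + 3)
    (hj : j ≤ (S.n + 1) / 2 ^ levelShift S.q l + 1) :
    S.stepWord c l j = bitsOf (fun z => IsStairStep c (2 ^ levelShift S.q l) (levelFreq S.q l)
      (j / S.chunk * S.chunk + z)) S.chunk % 2 ^ (j % S.chunk + 1) := by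
  have hf := fieldOffset_level (S := S) (l / 2 ^ S.q)
  have h3 := slice_level_field c he (div_chunk_lt hj) (k := 4) (by omega) hf.2.2.2.2.1 (by
    simp only [levelField, levelFieldBits]
    simpa using bitsOf_lt _ _)
  simp only [levelField, levelFieldBits] at h3
  norm_num at h3
  rw [stepWord, h3]

/-- Reading the position for a place with no step before it in its chunk. -/
theorem read_pos_of_zero {l j : ℕ} (he : l / 2 ^ S.q < S.bits + 3) (hl : 1 ≤ l)
    (hj : j ≤ (S.n + 1) / 2 ^ levelShift S.q l + 1) (hj' : 2 ^ levelShift S.q l * j ≤ S.n + 1)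
    (hpos : 0 < stair c (2 ^ levelShift S.q l) (levelFreq S.q l) j)
    (h0 : S.stepWord c l j = 0) :
    slice (S.content c) (S.levelAddr l (j / S.chunk) + 2 * S.bits) S.bits =
      stairPos c (2 ^ levelShift S.q l) (levelFreq S.q l)
        (stair c (2 ^ levelShift S.q l) (levelFreq S.q l) j) := by
  have hf1 := one_le_levelFreq (q := S.q) hl
  have hmod := Nat.mod_lt j (chunk_pos (S := S))
  have hdm := Nat.div_add_mod' j S.chunk
  rw [stepWord_eq c he hj] at h0
  -- No step precedes j in its chunk, so the position stored for the start of the chunk still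
  -- applies.
  have hst : stair c (2 ^ levelShift S.q l) (levelFreq S.q l) j =
      stair c (2 ^ levelShift S.q l) (levelFreq S.q l) (j / S.chunk * S.chunk) := by
    refine stair_eq_of_no_step hf1 (Nat.div_mul_le_self _ _) fun k hk hkj => ?_
    have := not_of_bitsOf_eq_zero (by omega) h0 (k := k - j / S.chunk * S.chunk) (by omega)
    rwa [show j / S.chunk * S.chunk + (k - j / S.chunk * S.chunk) = k by omega] at this
  have hsp := stairPos_spec hf1 ((lt_stair_iff hf1).1 (show stair c (2 ^ levelShift S.q l)
    (levelFreq S.q l) j - 1 < stair c (2 ^ levelShift S.q l) (levelFreq S.q l) j by omega))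
  have hlen := length_lt (S := S)
  have hf := fieldOffset_level (S := S) (l / 2 ^ S.q)
  have h2 := slice_level_field c he (div_chunk_lt hj) (k := 2) (by omega) hf.2.2.1 (by
    simp only [levelField, levelFieldBits]
    norm_num
    rw [← hst]
    omega)
  simp only [levelField, levelFieldBits] at h2
  norm_num at h2
  rw [h2, ← hst]

/-- Reading the position for a place with a step before it in its chunk. -/
theorem read_pos_of_ne_zero {l j : ℕ} (he : l / 2 ^ S.q < S.bits + 3) (hl : 1 ≤ l)
    (hj : j ≤ (S.n + 1) / 2 ^ levelShift S.q l + 1) (h0 : S.stepWord c l j ≠ 0) :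
    1 ≤ j / S.chunk * S.chunk + Nat.log 2 (S.stepWord c l j) ∧
    Nat.log 2 (S.stepWord c l j) ≤ j % S.chunk ∧
    (j / S.chunk * S.chunk + Nat.log 2 (S.stepWord c l j) - 1) * 2 ^ levelShift S.q l +
      slice (S.content c) (S.levelAddr l (j / S.chunk) + (3 * S.bits + 2 * S.chunk +
        Nat.log 2 (S.stepWord c l j) * levelShift S.q l)) (levelShift S.q l) =
      stairPos c (2 ^ levelShift S.q l) (levelFreq S.q l)
        (stair c (2 ^ levelShift S.q l) (levelFreq S.q l) j) := by
  have hf1 := one_le_levelFreq (q := S.q) hl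
  have hmod := Nat.mod_lt j (chunk_pos (S := S))
  have hdm := Nat.div_add_mod' j S.chunk
  rw [stepWord_eq c he hj] at h0 ⊢
  obtain ⟨h1, h2, h3⟩ := log_bitsOf h0
  set z := Nat.log 2 (bitsOf (fun z => IsStairStep c (2 ^ levelShift S.q l) (levelFreq S.q l)
      (j / S.chunk * S.chunk + z)) S.chunk % 2 ^ (j % S.chunk + 1)) with hz
  have hst : stair c (2 ^ levelShift S.q l) (levelFreq S.q l) j =
      stair c (2 ^ levelShift S.q l) (levelFreq S.q l) (j / S.chunk * S.chunk + z) := by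
    refine stair_eq_of_no_step hf1 (by omega) fun k hk hkj => ?_
    have := h3 (k - j / S.chunk * S.chunk) (by omega) (by omega) (by omega)
    rwa [show j / S.chunk * S.chunk + (k - j / S.chunk * S.chunk) = k by omega] at this
  -- A step never occurs at place 0, so the subtraction of 1 is not truncated.
  have h1' : 1 ≤ j / S.chunk * S.chunk + z := by
    by_contra! h
    rw [show j / S.chunk * S.chunk + z = 0 by omega] at h2
    exact not_isStairStep_zero h2
  -- The witness at a step lies in the preceding block, so its offset is below the stride and fits
  -- into its field.
  have hstep := stairPos_step hf1 h2
  have hf := fieldOffset_level (S := S) (l / 2 ^ S.q)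
  have hp : 2 ^ levelShift S.q l * (j / S.chunk * S.chunk + z) =
      2 ^ levelShift S.q l * (j / S.chunk * S.chunk + z - 1) + 2 ^ levelShift S.q l := by
    conv_lhs => rw [show j / S.chunk * S.chunk + z = j / S.chunk * S.chunk + z - 1 + 1 by omega]
    rw [mul_add, mul_one]
  have h5 := slice_level_field c he (div_chunk_lt hj) (k := 5 + z) (by omega)
    (hf.2.2.2.2.2 z) (by
    simp only [levelField, levelFieldBits]
    rw [if_neg (by omega), if_neg (by omega), if_neg (by omega), if_neg (by omega),
      if_neg (by omega), if_neg (by omega), if_neg (by omega), Nat.add_sub_cancel_left]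
    change _ < 2 ^ levelShift S.q l
    omega)
  simp only [levelField, levelFieldBits] at h5
  rw [if_neg (by omega), if_neg (by omega), if_neg (by omega), if_neg (by omega),
    if_neg (by omega), if_neg (by omega), if_neg (by omega), Nat.add_sub_cancel_left] at h5
  refine ⟨h1', by omega, ?_⟩
  change slice _ (_ + (_ + _ * levelShift S.q l)) (levelShift S.q l) = _ at h5
  rw [h5, hst, Nat.mul_comm (_ - 1)]
  omega

end Layout

/-! ### Tables and memory -/

namespace Layout

variable (S : Layout)

/-- The number of rows of the tables. -/
def rows : ℕ := 2 ^ S.chunk + S.bits + 8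

/-- The columns of the tables: parameters, popcounts and logarithms of short words, and the
parameters of the scales and of the levels. -/
def column (j i : ℕ) : ℕ :=
  match j with
  | 0 => S.chunk
  | 1 => S.window
  | 2 => 17 * S.rows
  | 3 => S.q
  | 4 => S.bits
  | 5 => popCount S.chunk i
  | 6 => Nat.log 2 i
  | 7 => fieldOffset S.sectionBits i
  | 8 => S.blockLog i
  | 9 => S.scaleRecBits i
  | 10 => ones (S.blockLog i + 2) (S.blockLog i + 1)
  | 11 => fieldOffset S.sectionBits (S.bits + i)
  | 12 => S.levelBlocks i
  | 13 => S.levelRecBits i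
  | 14 => powLevel S.q (i - 2)
  | 15 => powLevel S.q (i + 2)
  | _ => i - 1

/-- The memory `M` of `w`-bit words holds the tables and the bits of the data structure, and words
are long enough for the computations of a query. -/
structure Fits {α : Type*} [DecidableEq α] (c : ℕ → α) (w : ℕ) (M : ℕ → ℕ) : Prop where
  row : ∀ i j, j < 17 → i < S.rows → S.column j i < 2 ^ w → M (i * 17 + j) = S.column j i
  win : ∀ i ≤ S.totalBits / S.window,
    M (17 * S.rows + i) = slice (S.content c) (S.window * i) (2 * S.window)
  addr : 17 * S.rows + S.totalBits < 2 ^ w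
  word : 2 * S.window ≤ w
  prec : S.q ≤ S.bits

variable {S}

theorem two_le_bits : 2 ≤ S.bits := Nat.le_add_left _ _

theorem bits_le_two_mul_chunk : S.bits ≤ 2 * S.chunk := by
  unfold chunk
  omega

theorem chunk_le_bits : S.chunk ≤ S.bits := by
  have := two_le_bits (S := S)
  unfold chunk
  omega

/-- The factor 20 in `window` makes a whole threshold word readable at once. Its length is quadratic
in lg bits, and (2k + 4)(2k + 3) ≤ 20 * 2^k. -/
theorem block_bits_le (t : ℕ) : (S.blockLog t + 2) * (S.blockLog t + 1) ≤ S.window := by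
  have h1 : S.blockLog t ≤ S.maxBlock := min_le_right _ _
  have h2 : ∀ k : ℕ, (2 * k + 4) * (2 * k + 3) ≤ 20 * 2 ^ k := by
    intro k
    induction k with
    | zero => norm_num
    | succ k ih =>
      rw [pow_succ]
      rcases Nat.lt_or_ge k 2 with hk | hk
      · interval_cases k <;> norm_num
      · nlinarith
  have h3 : 2 ^ Nat.log 2 S.bits ≤ S.bits :=
    Nat.pow_log_le_self 2 (by have := two_le_bits (S := S); omega)
  calc (S.blockLog t + 2) * (S.blockLog t + 1)
      ≤ (2 * Nat.log 2 S.bits + 4) * (2 * Nat.log 2 S.bits + 3) := by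
        unfold maxBlock at h1
        exact Nat.mul_le_mul (by omega) (by omega)
    _ ≤ 20 * 2 ^ Nat.log 2 S.bits := h2 _
    _ ≤ S.window := by unfold window; omega

theorem ones_lt (m n : ℕ) (hm : 1 ≤ m) : ones m n < 2 ^ (m * n) := by
  rw [← fields_one]
  exact fields_lt n fun _ => Nat.one_lt_two_pow (by omega)

theorem powLevel_le {q m : ℕ} : powLevel q m ≤ (m + 1) * 2 ^ q := by
  unfold powLevel
  split_ifs with h
  · exact (Nat.pow_le_pow_right two_pos h.le).trans (Nat.le_mul_of_pos_left _ (by omega))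
  · exact Nat.mul_le_mul_right _ (by omega)

/-! ### Size bounds that exclude overflow -/

namespace Fits

variable {α : Type*} [DecidableEq α] {c : ℕ → α} {w : ℕ} {M env : ℕ → ℕ}

theorem small (H : S.Fits c w M) {x k : ℕ} (h : x < 2 ^ k) (hk : k ≤ 40 * S.bits) : x < 2 ^ w := by
  have := H.word
  unfold window at this
  exact h.trans_le (Nat.pow_le_pow_right two_pos (by omega))

theorem tiny (H : S.Fits c w M) {x : ℕ} (h : x ≤ 40 * S.bits) : x < 2 ^ w :=
  H.small (Nat.lt_two_pow_self.trans_le (Nat.pow_le_pow_right two_pos h)) le_rfl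

theorem two_pow_precision_le (H : S.Fits c w M) : 2 ^ S.q ≤ 2 ^ S.bits :=
  Nat.pow_le_pow_right two_pos H.prec

/-- Levels in use are small numbers. -/
theorem level_small (H : S.Fits c w M) {x k : ℕ} (hx : x ≤ k * 2 ^ S.q) (hk : k ≤ 8 * S.bits) :
    x < 2 ^ w := by
  refine H.small (k := 8 * S.bits + S.bits) ?_ (by omega)
  rw [pow_add]
  calc x ≤ k * 2 ^ S.q := hx
    _ < 2 ^ (8 * S.bits) * 2 ^ S.bits := by
      refine Nat.mul_lt_mul_of_lt_of_le ?_ H.two_pow_precision_le (by positivity)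
      exact Nat.lt_two_pow_self.trans_le (Nat.pow_le_pow_right two_pos hk)

end Fits

end Layout

/-! ### Expressions of the query program -/

namespace WordRAM

/-- A parameter from the first row of the tables. -/
def constE (j : ℕ) : Ex := .load (.const j)

/-- An entry of column `j` of the tables. -/
def colE (j : ℕ) (e : Ex) : Ex := .load (.bin .add (.bin .mul e (.const 17)) (.const j))

/-- A power of two. -/
def twoPowE (e : Ex) : Ex := .bin .shl (.const 1) e

/-- The `l` bits at offset `o` of the data structure. -/
def readE (o l : Ex) : Ex :=
  .bin .mod (.bin .shr (.load (.bin .add (constE 2) (.bin .div o (constE 1))))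
    (.bin .mod o (constE 1))) (twoPowE l)

end WordRAM

namespace Layout.Fits

open WordRAM

variable {S : Layout} {α : Type*} [DecidableEq α] {c : ℕ → α} {w : ℕ} {M env : ℕ → ℕ}

theorem ev_constE (H : S.Fits c w M) {j : ℕ} (hj : j < 17) (hc : S.column j 0 < 2 ^ w) :
    Ev w M env (constE j) (S.column j 0) := by
  have h := H.row 0 j hj (Nat.succ_pos _) hc
  rw [zero_mul, zero_add] at h
  rw [← h]
  exact .load (.const (H.tiny (by have := two_le_bits (S := S); omega)))

theorem ev_colE (H : S.Fits c w M) {e : Ex} {i j : ℕ} (he : Ev w M env e i) (hj : j < 17)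
    (hi : i < S.rows) (hc : S.column j i < 2 ^ w) : Ev w M env (colE j e) (S.column j i) := by
  rw [← H.row i j hj hi hc]
  have := H.addr
  have := two_le_bits (S := S)
  exact .load (.add (.mul he (.const (H.tiny (by omega))) (by omega))
    (.const (H.tiny (by omega))) (by omega))

theorem ev_twoPowE (H : S.Fits c w M) {e : Ex} {x : ℕ} (he : Ev w M env e x)
    (hx : x < 40 * S.bits) : Ev w M env (twoPowE e) (2 ^ x) := by
  have h := Ev.shl (.const (w := w) (M := M) (env := env) (v := 1) (H.tiny (by omega))) he (by
    rw [one_mul]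
    exact H.small (Nat.pow_lt_pow_right one_lt_two hx) le_rfl)
  rwa [one_mul] at h

theorem ev_chunk (H : S.Fits c w M) : Ev w M env (constE 0) S.chunk :=
  H.ev_constE (by omega) (H.tiny (by have := chunk_le_bits (S := S); simp only [column]; omega))

theorem ev_window (H : S.Fits c w M) : Ev w M env (constE 1) S.window :=
  H.ev_constE (by omega) (H.tiny (by simp only [column, window]; omega))

theorem ev_base (H : S.Fits c w M) : Ev w M env (constE 2) (17 * S.rows) :=
  H.ev_constE (by omega) (by have := H.addr; simp only [column]; omega)

theorem ev_precision (H : S.Fits c w M) : Ev w M env (constE 3) S.q :=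
  H.ev_constE (by omega) (H.tiny (by have := H.prec; simp only [column]; omega))

theorem ev_bits (H : S.Fits c w M) : Ev w M env (constE 4) S.bits :=
  H.ev_constE (by omega) (H.tiny (by simp only [column]; omega))

/-- Windows start at multiples of `window` and are twice as long, so a field of at most `window`
bits lies entirely in the window that contains its first bit. -/
theorem ev_readE (H : S.Fits c w M) {o l : Ex} {x y : ℕ} (ho : Ev w M env o x)
    (hl : Ev w M env l y) (hx : x ≤ S.totalBits) (hy : y ≤ S.window) :
    Ev w M env (readE o l) (slice (S.content c) x y) := by
  have hb := two_le_bits (S := S)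
  have hw : 0 < S.window := by unfold window; omega
  have h1 : x / S.window ≤ S.totalBits / S.window := Nat.div_le_div_right hx
  have h2 : S.totalBits / S.window ≤ S.totalBits := Nat.div_le_self _ _
  have h3 := H.addr
  have h4 := Nat.mod_lt x hw
  have h5 : slice (S.content c) x y =
      M (17 * S.rows + x / S.window) / 2 ^ (x % S.window) % 2 ^ y := by
    rw [H.win _ h1, ← slice, slice_slice (by omega), Nat.div_add_mod]
  rw [h5]
  exact .mod (.shr (.load (.add H.ev_base (.div ho H.ev_window) (by omega)))
    (.mod ho H.ev_window)) (H.ev_twoPowE hl (by unfold window at hy; omega))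

end Layout.Fits

/-! ### Estimating the mode frequency -/

namespace WordRAM

def scaleAddrE (t x : Ex) : Ex :=
  .bin .add (colE 7 t) (.bin .mul (.bin .shr x (colE 8 t)) (colE 9 t))

/-- The estimate stored for the block of `x` at scale `t`. -/
def scaleSizeE (t x : Ex) : Ex := readE (scaleAddrE t x) (.bin .add t (.const 1))

/-- The rank of `z` among the thresholds of the block of `x` at scale `t`. -/
def scaleRankE (t x z : Ex) : Ex :=
  .bin .mod (.bin .and (.bin .shr (.bin .add (readE
      (.bin .add (scaleAddrE t x) (.bin .add t (.const 1)))
      (.bin .mul (.bin .add (colE 8 t) (.const 2)) (.bin .add (colE 8 t) (.const 1))))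
      (.bin .mul z (colE 10 t))) (.bin .add (colE 8 t) (.const 1))) (colE 10 t))
    (.bin .sub (twoPowE (.bin .add (colE 8 t) (.const 2))) (.const 1))

/-- The place of `x` in its block. -/
def rightE (t x : Ex) : Ex := .bin .mod x (twoPowE (colE 8 t))

/-- The place of `x` in its block, counted from the end. -/
def leftE (t x : Ex) : Ex :=
  .bin .sub (.bin .sub (twoPowE (colE 8 t)) (.const 1)) (rightE t x)

end WordRAM

namespace Layout.Fits

open WordRAM

variable {S : Layout} {α : Type*} [DecidableEq α] {c : ℕ → α} {w : ℕ} {M env : ℕ → ℕ}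

theorem bits_lt_rows : S.bits + 3 < S.rows := by
  have : 0 < 2 ^ S.chunk := by positivity
  unfold rows
  omega

theorem ev_blockLog (H : S.Fits c w M) {t : Ex} {k : ℕ} (ht : Ev w M env t k) (hk : k < S.bits) :
    Ev w M env (colE 8 t) (S.blockLog k) := by
  refine H.ev_colE ht (by omega) ?_ (H.tiny ?_)
  · have := bits_lt_rows (S := S)
    omega
  · have := blockLog_le (S := S) k
    simp only [column]
    omega

theorem ev_scaleAddrE (H : S.Fits c w M) {t x : Ex} {k a : ℕ} (ht : Ev w M env t k)
    (hx : Ev w M env x a) (hk : k < S.bits) (ha : a ≤ S.n + 1) :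
    Ev w M env (scaleAddrE t x) (S.scaleAddr k (a / 2 ^ S.blockLog k)) := by
  have hu : a / 2 ^ S.blockLog k < S.scaleBlocks k :=
    Nat.lt_succ_of_le (Nat.div_le_div_right ha)
  have h1 := scaleAddr_le hk hu (Nat.zero_le _)
  have h2 := scaleAddr_le hk (show 0 < S.scaleBlocks k from Nat.succ_pos _) (le_refl _)
  have h3 := H.addr
  have hr : k < S.rows := by
    have := bits_lt_rows (S := S)
    omega
  unfold scaleAddr at h1 h2
  exact .add (H.ev_colE ht (j := 7) (by omega) hr (by simp only [column]; omega))
    (.mul (.shr hx (H.ev_blockLog ht hk))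
      (H.ev_colE ht (j := 9) (by omega) hr (by simp only [column]; omega))
      (by omega)) (by omega)

theorem ev_scaleSizeE (H : S.Fits c w M) {t x : Ex} {k a : ℕ} (ht : Ev w M env t k)
    (hx : Ev w M env x a) (hk : k < S.bits) (ha : a ≤ S.n + 1) :
    Ev w M env (scaleSizeE t x)
      (Nat.size (blockFreq c (S.blockLog k) k (a / 2 ^ S.blockLog k) 0)) := by
  have hu : a / 2 ^ S.blockLog k < S.scaleBlocks k :=
    Nat.lt_succ_of_le (Nat.div_le_div_right ha)
  rw [← slice_scale_size c hk hu]
  exact H.ev_readE (H.ev_scaleAddrE ht hx hk ha)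
    (.add ht (.const (H.tiny (by omega))) (H.tiny (by omega)))
    (scaleAddr_le hk hu (Nat.zero_le _)) (by unfold window; omega)

theorem ev_scaleRankE (H : S.Fits c w M) {t x z : Ex} {k a v : ℕ} (ht : Ev w M env t k)
    (hx : Ev w M env x a) (hz : Ev w M env z v) (hk : k < S.bits) (ha : a ≤ S.n + 1)
    (hv : v < 2 ^ S.blockLog k) :
    Ev w M env (scaleRankE t x z) (thresholdRank (S.blockLog k)
      (thresholdWord c (S.blockLog k) k (a / 2 ^ S.blockLog k)) v) := by
  have hu : a / 2 ^ S.blockLog k < S.scaleBlocks k :=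
    Nat.lt_succ_of_le (Nat.div_le_div_right ha)
  have hb := blockLog_le (S := S) k
  have hbits := two_le_bits (S := S)
  have hB := block_bits_le (S := S) k
  have h1 := scaleAddr_le hk hu (o := k + 1) (by unfold scaleRecBits; omega)
  have h2 := thresholdWord_add_lt (c := c) (t := k) (u := a / 2 ^ S.blockLog k) hv
  have h3 : 2 ^ ((S.blockLog k + 2) * (S.blockLog k + 1)) ≤ 2 ^ w :=
    Nat.pow_le_pow_right two_pos (by have := H.word; omega)
  have h4 := ones_lt (S.blockLog k + 2) (S.blockLog k + 1) (by omega)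
  have hone : Ev w M env (.const 1) 1 := .const (H.tiny (by omega))
  have htwo : Ev w M env (.const 2) 2 := .const (H.tiny (by omega))
  have hlog := H.ev_blockLog ht hk
  have hr : k < S.rows := by
    have := bits_lt_rows (S := S)
    omega
  have ht1 : Ev w M env (.bin .add t (.const 1)) (k + 1) := .add ht hone (H.tiny (by omega))
  have hl1 := Ev.add hlog hone (H.tiny (by omega))
  have hl2 := Ev.add hlog htwo (H.tiny (by omega))
  have hones : Ev w M env (colE 10 t) (ones (S.blockLog k + 2) (S.blockLog k + 1)) :=
    H.ev_colE ht (by omega) hr (by simp only [column]; omega)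
  have hY := H.ev_readE
    (.add (H.ev_scaleAddrE ht hx hk ha) ht1 (by have := H.addr; omega))
    (.mul hl2 hl1 (H.tiny (by unfold window at hB; omega)))
    h1 hB
  rw [slice_scale_word c hk hu] at hY
  exact .mod (.and (.shr (.add hY (.mul hz hones (by omega)) (by omega)) hl1) hones)
    (.sub (H.ev_twoPowE hl2 (by omega)) hone Nat.one_le_two_pow)

theorem ev_rightE (H : S.Fits c w M) {t x : Ex} {k a : ℕ} (ht : Ev w M env t k)
    (hx : Ev w M env x a) (hk : k < S.bits) :
    Ev w M env (rightE t x) (a % 2 ^ S.blockLog k) := by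
  have hb := blockLog_le (S := S) k
  exact .mod hx (H.ev_twoPowE (H.ev_blockLog ht hk) (by omega))

theorem ev_leftE (H : S.Fits c w M) {t x : Ex} {k a : ℕ} (ht : Ev w M env t k)
    (hx : Ev w M env x a) (hk : k < S.bits) :
    Ev w M env (leftE t x) (2 ^ S.blockLog k - 1 - a % 2 ^ S.blockLog k) := by
  have hb := blockLog_le (S := S) k
  have hlt : a % 2 ^ S.blockLog k < 2 ^ S.blockLog k := Nat.mod_lt _ (by positivity)
  exact .sub (.sub (H.ev_twoPowE (H.ev_blockLog ht hk) (by omega))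
    (.const (H.tiny (by omega))) (by omega)) (H.ev_rightE ht hx hk) (by omega)

end Layout.Fits

/-! ### Evaluating a level -/

namespace WordRAM

def exponentE (l : Ex) : Ex := .bin .shr l (constE 3)

def shiftE (l : Ex) : Ex := colE 16 (exponentE l)

def levelAddrE (l i : Ex) : Ex :=
  .bin .add (colE 11 (exponentE l)) (.bin .mul (.bin .add
    (.bin .mul (.bin .mod l (twoPowE (constE 3))) (colE 12 (exponentE l)))
    (.bin .div i (constE 0))) (colE 13 (exponentE l)))

/-- The bits up to place `i`, in the bit vector at offset `o` of its record. -/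
def maskedE (l i o : Ex) : Ex :=
  .bin .mod (readE (.bin .add (levelAddrE l i) o) (constE 0))
    (twoPowE (.bin .add (.bin .mod i (constE 0)) (.const 1)))

def valueBitsE : Ex := .bin .mul (.const 3) (constE 4)

def stepBitsE : Ex := .bin .add valueBitsE (constE 0)

def valueRankE (l i : Ex) : Ex :=
  .bin .add (readE (levelAddrE l i) (constE 4)) (colE 5 (maskedE l i valueBitsE))

def stepRankE (l i : Ex) : Ex :=
  .bin .add (readE (.bin .add (levelAddrE l i) (constE 4)) (constE 4))
    (colE 5 (maskedE l i stepBitsE))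

/-- The first block endpoint at or after `a`. -/
def ceilE (l a : Ex) : Ex :=
  .bin .shr (.bin .add a (.bin .sub (twoPowE (shiftE l)) (.const 1))) (shiftE l)

/-- The last block endpoint at or before `y`. -/
def floorE (l y : Ex) : Ex := .bin .shr y (shiftE l)

/-- The position stored at the beginning of the chunk of `j`. -/
def chunkPosE (l j : Ex) : Ex :=
  readE (.bin .add (levelAddrE l j) (.bin .mul (.const 2) (constE 4))) (constE 4)

/-- The position stored for the last step in the chunk of `j`. -/
def stepPosE (l j : Ex) : Ex :=
  .bin .add (.bin .shl (.bin .sub (.bin .add (.bin .mul (.bin .div j (constE 0)) (constE 0))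
      (colE 6 (maskedE l j stepBitsE))) (.const 1)) (shiftE l))
    (readE (.bin .add (levelAddrE l j) (.bin .add (.bin .add valueBitsE
      (.bin .mul (.const 2) (constE 0)))
      (.bin .mul (colE 6 (maskedE l j stepBitsE)) (shiftE l)))) (shiftE l))

end WordRAM

namespace Layout.Fits

open WordRAM

variable {S : Layout} {α : Type*} [DecidableEq α] {c : ℕ → α} {w : ℕ} {M env : ℕ → ℕ}

theorem ev_exponentE (H : S.Fits c w M) {e : Ex} {l : ℕ} (h : Ev w M env e l) :
    Ev w M env (exponentE e) (l / 2 ^ S.q) := .shr h H.ev_precision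

theorem ev_shiftE (H : S.Fits c w M) {e : Ex} {l : ℕ} (h : Ev w M env e l)
    (hl : l / 2 ^ S.q < S.bits + 3) : Ev w M env (shiftE e) (levelShift S.q l) := by
  refine H.ev_colE (j := 16) (H.ev_exponentE h) (by omega) (hl.trans bits_lt_rows) ?_
  have := two_le_bits (S := S)
  refine H.tiny (le_trans (b := S.bits + 3) ?_ (by omega))
  simp only [column]
  exact (Nat.sub_le _ _).trans hl.le

theorem ev_levelAddrE (H : S.Fits c w M) {e ei : Ex} {l i : ℕ} (h : Ev w M env e l)
    (hi : Ev w M env ei i) (hl : l / 2 ^ S.q < S.bits + 3)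
    (hi' : i ≤ (S.n + 1) / 2 ^ levelShift S.q l + 1) :
    Ev w M env (levelAddrE e ei) (S.levelAddr l (i / S.chunk)) := by
  have hbits := two_le_bits (S := S)
  have hu := div_chunk_lt hi'
  have h1 := levelAddr_le hl hu (Nat.zero_le _)
  have h2 := H.addr
  have h3 := level_index_lt hu
  have hr := hl.trans (bits_lt_rows (S := S))
  have h4 := levelAddr_le hl (show 0 < S.levelBlocks (l / 2 ^ S.q) from Nat.succ_pos _)
    (le_refl _)
  have h5 : 0 < S.levelRecBits (l / 2 ^ S.q) := by unfold levelRecBits; omega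
  have h6 := Nat.le_mul_of_pos_right
    (l % 2 ^ S.q * S.levelBlocks (l / 2 ^ S.q) + i / S.chunk) h5
  have h9 := Nat.le_add_right (l % 2 ^ S.q * S.levelBlocks (l / 2 ^ S.q)) (i / S.chunk)
  unfold levelAddr at h1 h4
  have h7 : S.levelBlocks (l / 2 ^ S.q) < 2 ^ w := by
    refine H.small (k := S.bits + 2) ?_ (by omega)
    have h8 : ((S.n + 1) / 2 ^ (l / 2 ^ S.q - 1) + 1) / S.chunk ≤ S.n + 1 + 1 :=
      (Nat.div_le_self _ _).trans (Nat.succ_le_succ (Nat.div_le_self _ _))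
    have := length_lt (S := S)
    rw [levelBlocks, pow_add]
    omega
  exact .add (H.ev_colE (j := 11) (H.ev_exponentE h) (by omega) hr (by simp only [column]; omega))
    (.mul (.add (.mul
      (.mod h (H.ev_twoPowE H.ev_precision (by have := H.prec; omega)))
      (H.ev_colE (j := 12) (H.ev_exponentE h) (by omega) hr h7)
      (by omega)) (.div hi H.ev_chunk) (by omega))
      (H.ev_colE (j := 13) (H.ev_exponentE h) (by omega) hr (by simp only [column]; omega))
      (by omega)) (by omega)

theorem ev_maskedE (H : S.Fits c w M) {e ei eo : Ex} {l i o : ℕ} (h : Ev w M env e l)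
    (hi : Ev w M env ei i) (ho : Ev w M env eo o) (hl : l / 2 ^ S.q < S.bits + 3)
    (hi' : i ≤ (S.n + 1) / 2 ^ levelShift S.q l + 1)
    (ho' : o ≤ S.levelRecBits (l / 2 ^ S.q)) :
    Ev w M env (maskedE e ei eo)
      (slice (S.content c) (S.levelAddr l (i / S.chunk) + o) S.chunk % 2 ^ (i % S.chunk + 1)) := by
  have hbits := two_le_bits (S := S)
  have hc := chunk_le_bits (S := S)
  have hmod := Nat.mod_lt i (chunk_pos (S := S))
  have h1 := levelAddr_le hl (div_chunk_lt hi') ho'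
  have h2 := H.addr
  exact .mod (H.ev_readE (.add (H.ev_levelAddrE h hi hl hi') ho (by omega)) H.ev_chunk h1
    (by unfold window; omega)) (H.ev_twoPowE (.add (.mod hi H.ev_chunk)
      (.const (H.tiny (by omega))) (H.tiny (by omega))) (by omega))

theorem masked_lt (X o z : ℕ) : slice X o S.chunk % 2 ^ z < 2 ^ S.chunk :=
  (Nat.mod_le _ _).trans_lt (slice_lt _ _ _)

theorem ev_popCount (H : S.Fits c w M) {e : Ex} {x : ℕ} (h : Ev w M env e x)
    (hx : x < 2 ^ S.chunk) : Ev w M env (colE 5 e) (popCount S.chunk x) := by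
  refine H.ev_colE (j := 5) h (by omega) (by unfold rows; omega) (H.tiny ?_)
  have : popCount S.chunk x ≤ S.chunk := Nat.count_le _
  have := chunk_le_bits (S := S)
  simp only [column]
  omega

theorem ev_log (H : S.Fits c w M) {e : Ex} {x : ℕ} (h : Ev w M env e x)
    (hx : x < 2 ^ S.chunk) : Ev w M env (colE 6 e) (Nat.log 2 x) := by
  refine H.ev_colE (j := 6) h (by omega) (by unfold rows; omega) (H.tiny ?_)
  have : Nat.log 2 x < S.chunk := Nat.log_lt_of_lt_pow' chunk_pos.ne' hx
  have := chunk_le_bits (S := S)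
  simp only [column]
  omega

theorem ev_valueBitsE (H : S.Fits c w M) : Ev w M env valueBitsE (3 * S.bits) :=
  .mul (.const (H.tiny (by have := two_le_bits (S := S); omega))) H.ev_bits (H.tiny (by omega))

theorem ev_stepBitsE (H : S.Fits c w M) : Ev w M env stepBitsE (3 * S.bits + S.chunk) :=
  .add H.ev_valueBitsE H.ev_chunk (H.tiny (by have := chunk_le_bits (S := S); omega))

open Classical in
theorem ev_valueRankE (H : S.Fits c w M) {e ei : Ex} {l i : ℕ} (h : Ev w M env e l)
    (hi : Ev w M env ei i) (hl : l / 2 ^ S.q < S.bits + 3)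
    (hi' : i ≤ (S.n + 1) / 2 ^ levelShift S.q l + 1) (hi'' : i ≤ S.n + 1) :
    Ev w M env (valueRankE e ei)
      (Nat.count (IsStairValue c (2 ^ levelShift S.q l) (levelFreq S.q l)) (i + 1)) := by
  have hlen := length_lt (S := S)
  rw [← read_rank_value c hl hi' hi'']
  refine .add (H.ev_readE (H.ev_levelAddrE h hi hl hi') H.ev_bits ?_ (by unfold window; omega))
    (H.ev_popCount (H.ev_maskedE h hi H.ev_valueBitsE hl hi' ?_) (masked_lt _ _ _)) ?_
  · exact levelAddr_le hl (div_chunk_lt hi') (Nat.zero_le _)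
  · unfold levelRecBits
    omega
  · rw [read_rank_value c hl hi' hi'']
    exact H.small (k := S.bits + 1) ((Nat.count_le _).trans_lt (by rw [pow_succ]; omega))
      (by have := two_le_bits (S := S); omega)

open Classical in
theorem ev_stepRankE (H : S.Fits c w M) {e ei : Ex} {l i : ℕ} (h : Ev w M env e l)
    (hi : Ev w M env ei i) (hl : l / 2 ^ S.q < S.bits + 3)
    (hi' : i ≤ (S.n + 1) / 2 ^ levelShift S.q l + 1) (hi'' : i ≤ S.n + 1) :
    Ev w M env (stepRankE e ei)
      (Nat.count (IsStairStep c (2 ^ levelShift S.q l) (levelFreq S.q l)) (i + 1)) := by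
  have hlen := length_lt (S := S)
  have h1 := levelAddr_le hl (div_chunk_lt hi') (o := S.bits) (by unfold levelRecBits; omega)
  have h2 := H.addr
  rw [← read_rank_step c hl hi' hi'']
  refine .add (H.ev_readE (.add (H.ev_levelAddrE h hi hl hi') H.ev_bits (by omega)) H.ev_bits h1
      (by unfold window; omega))
    (H.ev_popCount (H.ev_maskedE h hi H.ev_stepBitsE hl hi' ?_) (masked_lt _ _ _)) ?_
  · unfold levelRecBits
    omega
  · rw [read_rank_step c hl hi' hi'']
    exact H.small (k := S.bits + 1) ((Nat.count_le _).trans_lt (by rw [pow_succ]; omega))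
      (by have := two_le_bits (S := S); omega)

theorem levelShift_le {l : ℕ} (hl : l / 2 ^ S.q < S.bits + 3) :
    levelShift S.q l ≤ S.bits + 1 := by
  unfold levelShift
  generalize l / 2 ^ S.q = e at hl ⊢
  omega

theorem ev_floorE (H : S.Fits c w M) {e ey : Ex} {l y : ℕ} (h : Ev w M env e l)
    (hy : Ev w M env ey y) (hl : l / 2 ^ S.q < S.bits + 3) :
    Ev w M env (floorE e ey) (y / 2 ^ levelShift S.q l) := .shr hy (H.ev_shiftE h hl)

theorem ev_ceilE (H : S.Fits c w M) {e ea : Ex} {l a : ℕ} (h : Ev w M env e l)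
    (ha : Ev w M env ea a) (hl : l / 2 ^ S.q < S.bits + 3) (ha' : a ≤ S.n + 1) :
    Ev w M env (ceilE e ea)
      ((a + (2 ^ levelShift S.q l - 1)) / 2 ^ levelShift S.q l) := by
  have hbits := two_le_bits (S := S)
  have hs := levelShift_le hl
  have hlen := length_lt (S := S)
  have hp : 2 ^ levelShift S.q l ≤ 2 ^ (S.bits + 1) := Nat.pow_le_pow_right two_pos hs
  refine .shr (.add ha (.sub (H.ev_twoPowE (H.ev_shiftE h hl) (by omega))
    (.const (H.tiny (by omega))) Nat.one_le_two_pow) ?_) (H.ev_shiftE h hl)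
  refine H.small (k := S.bits + 2) ?_ (by omega)
  rw [pow_succ] at hp
  rw [pow_add]
  omega

theorem ev_stepWord (H : S.Fits c w M) {e ej : Ex} {l j : ℕ} (h : Ev w M env e l)
    (hj : Ev w M env ej j) (hl : l / 2 ^ S.q < S.bits + 3)
    (hj' : j ≤ (S.n + 1) / 2 ^ levelShift S.q l + 1) :
    Ev w M env (maskedE e ej stepBitsE) (S.stepWord c l j) :=
  H.ev_maskedE h hj H.ev_stepBitsE hl hj' (by unfold levelRecBits; omega)

theorem ev_chunkPosE (H : S.Fits c w M) {e ej : Ex} {l j : ℕ} (h : Ev w M env e l)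
    (hj : Ev w M env ej j) (hl : l / 2 ^ S.q < S.bits + 3)
    (hj' : j ≤ (S.n + 1) / 2 ^ levelShift S.q l + 1) :
    Ev w M env (chunkPosE e ej)
      (slice (S.content c) (S.levelAddr l (j / S.chunk) + 2 * S.bits) S.bits) := by
  have h1 := levelAddr_le hl (div_chunk_lt hj') (o := 2 * S.bits) (by unfold levelRecBits; omega)
  have h2 := H.addr
  have hbits := two_le_bits (S := S)
  exact H.ev_readE (.add (H.ev_levelAddrE h hj hl hj')
    (.mul (.const (H.tiny (by omega))) H.ev_bits (H.tiny (by omega))) (by omega)) H.ev_bits h1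
    (by unfold window; omega)

theorem ev_stepPosE (H : S.Fits c w M) {e ej : Ex} {l j p : ℕ} (h : Ev w M env e l)
    (hj : Ev w M env ej j) (hl : l / 2 ^ S.q < S.bits + 3)
    (hj' : j ≤ (S.n + 1) / 2 ^ levelShift S.q l + 1) (hj'' : j ≤ S.n + 1)
    (h1 : 1 ≤ j / S.chunk * S.chunk + Nat.log 2 (S.stepWord c l j))
    (hlog : Nat.log 2 (S.stepWord c l j) ≤ j % S.chunk)
    (hp : (j / S.chunk * S.chunk + Nat.log 2 (S.stepWord c l j) - 1) * 2 ^ levelShift S.q l +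
      slice (S.content c) (S.levelAddr l (j / S.chunk) + (3 * S.bits + 2 * S.chunk +
        Nat.log 2 (S.stepWord c l j) * levelShift S.q l)) (levelShift S.q l) = p)
    (hpn : p ≤ S.n + 1) :
    Ev w M env (stepPosE e ej) p := by
  have hbits := two_le_bits (S := S)
  have hchunk := chunk_le_bits (S := S)
  have hlen := length_lt (S := S)
  have hs := levelShift_le hl
  have hmod := Nat.mod_lt j (chunk_pos (S := S))
  have hdm := Nat.div_add_mod' j S.chunk
  have hz : Nat.log 2 (S.stepWord c l j) * levelShift S.q l ≤ S.chunk * levelShift S.q l :=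
    Nat.mul_le_mul_right _ (by omega)
  have haddr := levelAddr_le hl (div_chunk_lt hj')
    (o := 3 * S.bits + 2 * S.chunk + Nat.log 2 (S.stepWord c l j) * levelShift S.q l) (by
      unfold levelRecBits
      exact Nat.add_le_add_left hz _)
  have hn : ∀ {x}, x ≤ S.n + 1 → x < 2 ^ w := fun hx =>
    H.small (lt_of_le_of_lt hx hlen) (by omega)
  have hA := H.addr
  have hw := H.ev_log (H.ev_stepWord h hj hl hj') (masked_lt _ _ _)
  have hsh := H.ev_shiftE h hl
  have htwo : Ev w M env (.const 2) 2 := .const (H.tiny (by omega))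
  rw [← hp]
  exact .add (.shl (.sub (.add (.mul (.div hj H.ev_chunk) H.ev_chunk (hn (by omega))) hw
    (hn (by omega))) (.const (H.tiny (by omega))) h1) hsh (hn (by omega)))
    (H.ev_readE (.add (H.ev_levelAddrE h hj hl hj') (.add (.add H.ev_valueBitsE
      (.mul htwo H.ev_chunk (H.tiny (by omega))) (H.tiny (by omega)))
      (.mul hw hsh (by omega)) (by omega)) (by omega)) hsh haddr (by unfold window; omega))
    (hn (by omega))

end Layout.Fits

/-! ### The query program -/

namespace WordRAM

/-- The variables of the query program. -/
def vars (a y t k lo hi mid nxt : ℕ) : ℕ → ℕ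
  | 0 => a
  | 1 => y
  | 2 => t
  | 3 => k
  | 4 => lo
  | 5 => hi
  | 6 => mid
  | 7 => nxt
  | _ => 0

section Update

variable (a y t k lo hi mid nxt v : ℕ)

theorem update_vars_zero : Function.update (vars a y t k lo hi mid nxt) 0 v =
    vars v y t k lo hi mid nxt := by
  funext r
  rcases r with _ | _ | _ | _ | _ | _ | _ | _ | r <;> simp [Function.update, vars]

theorem update_vars_one : Function.update (vars a y t k lo hi mid nxt) 1 v =
    vars a v t k lo hi mid nxt := by
  funext r
  rcases r with _ | _ | _ | _ | _ | _ | _ | _ | r <;> simp [Function.update, vars]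

theorem update_vars_two : Function.update (vars a y t k lo hi mid nxt) 2 v =
    vars a y v k lo hi mid nxt := by
  funext r
  rcases r with _ | _ | _ | _ | _ | _ | _ | _ | r <;> simp [Function.update, vars]

theorem update_vars_three : Function.update (vars a y t k lo hi mid nxt) 3 v =
    vars a y t v lo hi mid nxt := by
  funext r
  rcases r with _ | _ | _ | _ | _ | _ | _ | _ | r <;> simp [Function.update, vars]

theorem update_vars_four : Function.update (vars a y t k lo hi mid nxt) 4 v =
    vars a y t k v hi mid nxt := by
  funext r
  rcases r with _ | _ | _ | _ | _ | _ | _ | _ | r <;> simp [Function.update, vars]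

theorem update_vars_five : Function.update (vars a y t k lo hi mid nxt) 5 v =
    vars a y t k lo v mid nxt := by
  funext r
  rcases r with _ | _ | _ | _ | _ | _ | _ | _ | r <;> simp [Function.update, vars]

theorem update_vars_six : Function.update (vars a y t k lo hi mid nxt) 6 v =
    vars a y t k lo hi v nxt := by
  funext r
  rcases r with _ | _ | _ | _ | _ | _ | _ | _ | r <;> simp [Function.update, vars]

theorem update_vars_seven : Function.update (vars a y t k lo hi mid nxt) 7 v =
    vars a y t k lo hi mid v := by
  funext r
  rcases r with _ | _ | _ | _ | _ | _ | _ | _ | r <;> simp [Function.update, vars]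

end Update

/-- Raising a variable to the value of an expression. -/
def raise (r : ℕ) (e : Ex) : Program := ifThenElse .lt (.reg r) e (assign r e) .skip

theorem Runs.raise {w : ℕ} {M env : ℕ → ℕ} {r : ℕ} {e : Ex} {v : ℕ} (hr : r < numVars)
    (h : Ev w M env e v) :
    Runs w M (raise r e) env (raise r e).steps (Function.update env r (max (env r) v)) := by
  refine Runs.ifLt (.reg hr) h (fun hlt => ?_) fun hle => ?_
  · rw [max_eq_right hlt.le]
    exact Runs.assign h
  · rw [max_eq_left hle, Function.update_eq_self]
    exact Runs.skip

/-- Turn the closed range into a half-open one and find the scale at which it is split. -/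
def scaleProgram : Program :=
  .seq (assign 1 (.bin .add (.reg 1) (.const 1)))
    (.seq (assign 2 (.bin .xor (.reg 0) (.reg 1)))
      (ifThenElse .lt (.bin .shr (.reg 2) (constE 0)) (.const 1)
        (assign 2 (colE 6 (.reg 2)))
        (assign 2 (.bin .add (constE 0) (colE 6 (.bin .shr (.reg 2) (constE 0)))))))

/-- Estimate the mode frequency up to a constant factor, and bound the level. -/
def estimateProgram : Program :=
  .seq (assign 3 (scaleSizeE (.reg 2) (.reg 0)))
    (.seq (raise 3 (scaleRankE (.reg 2) (.reg 0) (leftE (.reg 2) (.reg 0))))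
      (.seq (raise 3 (scaleSizeE (.reg 2) (.reg 1)))
        (.seq (raise 3 (scaleRankE (.reg 2) (.reg 1) (rightE (.reg 2) (.reg 1))))
          (.seq (assign 4 (colE 14 (.reg 3)))
            (.seq (assign 5 (colE 15 (.reg 3)))
              (assign 7 (.bin .add (.reg 4) (.const 1))))))))

/-- One step of the binary search for the level. -/
def searchStep : Program :=
  .seq (assign 6 (.bin .div (.bin .add (.reg 4) (.reg 5)) (.const 2)))
    (.seq (ifThenElse .lt (valueRankE (.reg 6) (ceilE (.reg 6) (.reg 0)))
        (stepRankE (.reg 6) (floorE (.reg 6) (.reg 1))) (assign 4 (.reg 6)) (assign 5 (.reg 6)))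
      (assign 7 (.bin .add (.reg 4) (.const 1))))

def searchProgram : Program := .loop .lt (.reg 7) (.reg 5) searchStep

/-- Read the position for the level that was found. -/
def positionProgram : Program :=
  ifThenElse .lt (maskedE (.reg 4) (floorE (.reg 4) (.reg 1)) stepBitsE) (.const 1)
    (assign 0 (chunkPosE (.reg 4) (floorE (.reg 4) (.reg 1))))
    (assign 0 (stepPosE (.reg 4) (floorE (.reg 4) (.reg 1))))

def queryProgram : Program :=
  .seq scaleProgram (.seq estimateProgram (.seq searchProgram positionProgram))

end WordRAM

namespace Layout

open WordRAM

variable {S : Layout} {α : Type*} [DecidableEq α] {c : ℕ → α} {w : ℕ} {M : ℕ → ℕ}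

theorem log_two_add {x k : ℕ} (h : 1 ≤ x / 2 ^ k) : k + Nat.log 2 (x / 2 ^ k) = Nat.log 2 x := by
  have h1 := Nat.log_div_base_pow 2 x k
  have h2 : k ≤ Nat.log 2 x := by
    refine Nat.le_log_of_pow_le one_lt_two ?_
    by_contra! hlt
    rw [Nat.div_eq_of_lt hlt] at h
    omega
  omega

/-- The table gives logarithms of words of `chunk` bits only. Since bits ≤ 2 * chunk, looking up the
upper half, or the lower half when the upper one vanishes, suffices. -/
theorem runs_scaleProgram (H : S.Fits c w M) {a b : ℕ} (ha : a ≤ S.n) (hb : b ≤ S.n) :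
    Runs w M scaleProgram (vars a b 0 0 0 0 0 0) scaleProgram.steps
      (vars a (b + 1) (Nat.log 2 (a ^^^ (b + 1))) 0 0 0 0 0) := by
  have hbits := two_le_bits (S := S)
  have hlen := length_lt (S := S)
  have hx : a ^^^ (b + 1) < 2 ^ S.bits := Nat.xor_lt_two_pow (by omega) (by omega)
  have hone : ∀ {env}, Ev w M env (.const 1) 1 := .const (H.tiny (by omega))
  have h1 : Ev w M (vars a b 0 0 0 0 0 0) (.bin .add (.reg 1) (.const 1)) (b + 1) :=
    .add (.reg (r := 1) (by decide)) hone (H.small (k := S.bits) (by omega)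
      (by omega))
  refine Runs.seq_steps (Runs.assign h1) ?_
  rw [update_vars_one]
  refine Runs.seq_steps (Runs.assign (.xor (.reg (r := 0) (by decide))
    (.reg (r := 1) (by decide)))) ?_
  rw [update_vars_two]
  change Runs w M _ (vars a (b + 1) (a ^^^ (b + 1)) 0 0 0 0 0) _ _
  set x := a ^^^ (b + 1)
  have hreg : Ev w M (vars a (b + 1) x 0 0 0 0 0) (.reg 2) x := .reg (r := 2) (by decide)
  have hshr := Ev.shr hreg H.ev_chunk
  refine Runs.ifLt hshr hone (fun h => ?_) fun h => ?_
  · have hlt : x < 2 ^ S.chunk := by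
      by_contra! hle
      have := Nat.div_pos hle (by positivity)
      omega
    have := Runs.assign (r := 2) (H.ev_log hreg hlt)
    rwa [update_vars_two] at this
  · have hlt : x / 2 ^ S.chunk < 2 ^ S.chunk := by
      rw [Nat.div_lt_iff_lt_mul (by positivity), ← pow_add]
      refine hx.trans_le (Nat.pow_le_pow_right two_pos ?_)
      have := bits_le_two_mul_chunk (S := S)
      omega
    have hlog : Nat.log 2 x < S.bits := by
      refine Nat.log_lt_of_lt_pow' (by omega) hx
    have := Runs.assign (r := 2) (Ev.add H.ev_chunk (H.ev_log hshr hlt) (by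
      rw [log_two_add h]
      exact H.tiny (by omega)))
    rwa [update_vars_two, log_two_add h] at this

/-- The number k is the larger of the estimated bit lengths on the two sides of the cut. Each is too
small by at most one and the two frequencies add up to at most twice their maximum, hence the bounds
k - 1 and k + 2. -/
theorem runs_estimateProgram (H : S.Fits c w M) {a y : ℕ} (hay : a < y) (hy : y ≤ S.n + 1) :
    ∃ k, 1 ≤ k ∧ k ≤ S.bits ∧ 2 ^ (k - 1) ≤ maxFreq c a y ∧ maxFreq c a y < 2 ^ (k + 2) ∧
      Runs w M estimateProgram (vars a y (Nat.log 2 (a ^^^ y)) 0 0 0 0 0) estimateProgram.steps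
        (vars a y (Nat.log 2 (a ^^^ y)) k (powLevel S.q (k - 2)) (powLevel S.q (k + 2)) 0
          (powLevel S.q (k - 2) + 1)) := by
  have hbits := two_le_bits (S := S)
  have hlen := length_lt (S := S)
  have hx : a ^^^ y < 2 ^ S.bits := Nat.xor_lt_two_pow (by omega) (by omega)
  obtain ⟨f1, f2, f3, f4, f5, f6⟩ := scaleFreq_split (c := c) hay rfl
  have ht : Nat.log 2 (a ^^^ y) < S.bits := Nat.log_lt_of_lt_pow' (by omega) hx
  set t := Nat.log 2 (a ^^^ y)
  have hb := blockLog_le (S := S) t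
  have hp : 0 < 2 ^ S.blockLog t := by positivity
  have hzl : 2 ^ S.blockLog t - 1 - a % 2 ^ S.blockLog t < 2 ^ S.blockLog t := by omega
  have hzr : y % 2 ^ S.blockLog t < 2 ^ S.blockLog t := Nat.mod_lt _ hp
  have hA := size_estimate (c := c) (u := a / 2 ^ S.blockLog t) hb hzl
  have hY := size_estimate (c := c) (u := y / 2 ^ S.blockLog t) hb hzr
  rw [blockFreq_left hb f5] at hA
  rw [blockFreq_right hb f6] at hY
  have hF := maxFreq_estimate f1 f2 f3 hA.1 hA.2.1 hY.1 hY.2.1 (hA.2.2 f4)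
  have hK := hA.2.2 f4
  generalize hs1 : Nat.size (blockFreq c (S.blockLog t) t (a / 2 ^ S.blockLog t) 0) = s1
    at hF hK
  generalize hr1 : thresholdRank (S.blockLog t) (thresholdWord c (S.blockLog t) t
    (a / 2 ^ S.blockLog t)) (2 ^ S.blockLog t - 1 - a % 2 ^ S.blockLog t) = r1 at hF hK
  generalize hs2 : Nat.size (blockFreq c (S.blockLog t) t (y / 2 ^ S.blockLog t) 0) = s2 at hF
  generalize hr2 : thresholdRank (S.blockLog t) (thresholdWord c (S.blockLog t) t
    (y / 2 ^ S.blockLog t)) (y % 2 ^ S.blockLog t) = r2 at hF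
  have hk : max (max s1 r1) (max s2 r2) ≤ S.bits := by
    have h1 := maxFreq_le_length (c := c) a y
    have h2 : 2 ^ (max (max s1 r1) (max s2 r2) - 1) < 2 ^ S.bits := by omega
    have := (Nat.pow_lt_pow_iff_right one_lt_two).1 h2
    omega
  have reg0 : ∀ {k lo hi mid nxt}, Ev w M (vars a y t k lo hi mid nxt) (.reg 0) a :=
    .reg (r := 0) (by decide)
  have reg1 : ∀ {k lo hi mid nxt}, Ev w M (vars a y t k lo hi mid nxt) (.reg 1) y :=
    .reg (r := 1) (by decide)
  have reg2 : ∀ {k lo hi mid nxt}, Ev w M (vars a y t k lo hi mid nxt) (.reg 2) t :=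
    .reg (r := 2) (by decide)
  have reg3 : ∀ {k lo hi mid nxt}, Ev w M (vars a y t k lo hi mid nxt) (.reg 3) k :=
    .reg (r := 3) (by decide)
  have reg4 : ∀ {k lo hi mid nxt}, Ev w M (vars a y t k lo hi mid nxt) (.reg 4) lo :=
    .reg (r := 4) (by decide)
  refine ⟨max (max s1 r1) (max s2 r2), by omega, hk, hF.1, hF.2, ?_⟩
  have e1 : Ev w M (vars a y t 0 0 0 0 0) _ s1 :=
    hs1 ▸ H.ev_scaleSizeE reg2 reg0 ht (by omega)
  refine Runs.seq_steps (Runs.assign e1) ?_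
  rw [update_vars_three]
  have e2 : Ev w M (vars a y t s1 0 0 0 0) _ r1 :=
    hr1 ▸ H.ev_scaleRankE reg2 reg0 (H.ev_leftE reg2 reg0 ht) ht (by omega) hzl
  refine Runs.seq_steps (Runs.raise (by decide) e2) ?_
  rw [update_vars_three]
  change Runs w M _ (vars a y t (max s1 r1) 0 0 0 0) _ _
  have e3 : Ev w M (vars a y t (max s1 r1) 0 0 0 0) _ s2 :=
    hs2 ▸ H.ev_scaleSizeE reg2 reg1 ht (by omega)
  refine Runs.seq_steps (Runs.raise (by decide) e3) ?_
  rw [update_vars_three]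
  change Runs w M _ (vars a y t (max (max s1 r1) s2) 0 0 0 0) _ _
  have e4 : Ev w M (vars a y t (max (max s1 r1) s2) 0 0 0 0) _ r2 :=
    hr2 ▸ H.ev_scaleRankE reg2 reg1 (H.ev_rightE reg2 reg1 ht) ht (by omega) hzr
  refine Runs.seq_steps (Runs.raise (by decide) e4) ?_
  rw [update_vars_three]
  change Runs w M _ (vars a y t (max (max (max s1 r1) s2) r2) 0 0 0 0) _ _
  rw [max_assoc (max s1 r1)]
  generalize max (max s1 r1) (max s2 r2) = k at hk ⊢
  have hr : k < S.rows := by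
    have := Fits.bits_lt_rows (S := S)
    omega
  have b1 : powLevel S.q (k - 2) + 1 ≤ (S.bits + 4) * 2 ^ S.q := by
    have h1 := powLevel_le (q := S.q) (m := k - 2)
    have h2 : (k - 2 + 1) * 2 ^ S.q ≤ (S.bits + 3) * 2 ^ S.q := Nat.mul_le_mul_right _ (by omega)
    have h3 : (S.bits + 4) * 2 ^ S.q = (S.bits + 3) * 2 ^ S.q + 2 ^ S.q := by ring
    have h4 : 0 < 2 ^ S.q := by positivity
    omega
  have b2 : powLevel S.q (k + 2) ≤ (S.bits + 3) * 2 ^ S.q :=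
    (powLevel_le (q := S.q)).trans (Nat.mul_le_mul_right _ (by omega))
  have e5 : ∀ {env}, Ev w M env (.reg 3) k → Ev w M env (colE 14 (.reg 3))
      (powLevel S.q (k - 2)) := fun h => H.ev_colE (j := 14) h (by omega) hr
    (H.level_small (k := S.bits + 4) (by simp only [column]; omega) (by omega))
  have e6 : ∀ {env}, Ev w M env (.reg 3) k → Ev w M env (colE 15 (.reg 3))
      (powLevel S.q (k + 2)) := fun h => H.ev_colE (j := 15) h (by omega) hr
    (H.level_small (k := S.bits + 3) (by simpa only [column] using b2) (by omega))
  refine Runs.seq_steps (Runs.assign (e5 reg3)) ?_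
  rw [update_vars_four]
  refine Runs.seq_steps (Runs.assign (e6 reg3)) ?_
  rw [update_vars_five]
  have := Runs.assign (r := 7) (Ev.add (reg4 (k := k) (lo := powLevel S.q (k - 2))
    (hi := powLevel S.q (k + 2)) (mid := 0) (nxt := 0)) (.const (v := 1) (H.tiny (by omega)))
    (H.level_small b1 (by omega)))
  rwa [update_vars_seven] at this

end Layout

/-! ### The search for the level -/

namespace Layout

open WordRAM

variable {S : Layout} {α : Type*} [DecidableEq α] {c : ℕ → α} {w : ℕ} {M : ℕ → ℕ}

variable (S c) in
/-- The frequency of level `l` is reached in the range `[a, y)` rounded inwards. -/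
def Hits (a y l : ℕ) : Prop :=
  Reaches c (2 ^ levelShift S.q l) (levelFreq S.q l)
    ((a + (2 ^ levelShift S.q l - 1)) / 2 ^ levelShift S.q l) (y / 2 ^ levelShift S.q l)

theorem ceil_floor_bounds {a y s : ℕ} (hs : 0 < s) :
    a ≤ s * ((a + (s - 1)) / s) ∧ s * ((a + (s - 1)) / s) ≤ a + (s - 1) ∧
      s * (y / s) ≤ y ∧ y ≤ s * (y / s) + (s - 1) := by
  have h1 := Nat.div_add_mod (a + (s - 1)) s
  have h2 := Nat.mod_lt (a + (s - 1)) hs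
  have h3 := Nat.div_add_mod y s
  have h4 := Nat.mod_lt y hs
  omega

/-- A level can be missed although F reaches it, but only by the rounding loss of at most s - 1
positions at each end. -/
theorem maxFreq_lt_of_not_hits {a y l : ℕ} (h : ¬ S.Hits c a y l) :
    maxFreq c a y < levelFreq S.q l + 2 * (2 ^ levelShift S.q l - 1) := by
  obtain ⟨h1, h2, h3, h4⟩ := ceil_floor_bounds (a := a) (y := y)
    (s := 2 ^ levelShift S.q l) (by positivity)
  have := maxFreq_le_rounded (c := c) h1 h2 h3 h4
  unfold Hits Reaches at h
  omega

theorem hits_of_le {a y l : ℕ}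
    (h : levelFreq S.q l + 2 * (2 ^ levelShift S.q l - 1) ≤ maxFreq c a y) : S.Hits c a y l := by
  by_contra hn
  have := maxFreq_lt_of_not_hits hn
  omega

theorem ceil_le {a s m : ℕ} (hs : 0 < s) (h : a ≤ m) : (a + (s - 1)) / s ≤ m / s + 1 := by
  rw [← Nat.add_div_right m hs]
  exact Nat.div_le_div_right (by omega)

theorem ceil_le_self {a s : ℕ} : (a + (s - 1)) / s ≤ a := by
  rcases Nat.eq_zero_or_pos s with rfl | hs
  · simp
  rcases Nat.eq_zero_or_pos a with rfl | ha
  · simp [Nat.div_eq_of_lt (show s - 1 < s by omega)]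
  · refine Nat.div_le_of_le_mul ?_
    obtain ⟨a, rfl⟩ := Nat.exists_eq_add_of_le ha
    obtain ⟨s, rfl⟩ := Nat.exists_eq_add_of_le hs
    rw [Nat.add_sub_cancel_left]
    nlinarith [Nat.zero_le (s * a)]

/-- The bounds for a level that the binary search maintains. -/
structure Brackets (S : Layout) (c : ℕ → α) (a y lo hi : ℕ) : Prop where
  one_le : 1 ≤ lo
  lt : lo < hi
  le : hi ≤ (S.bits + 3) * 2 ^ S.q
  hits : S.Hits c a y lo
  misses : maxFreq c a y < levelFreq S.q hi + 2 * (2 ^ levelShift S.q hi - 1)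

theorem exponent_lt {l : ℕ} (h : l < (S.bits + 3) * 2 ^ S.q) : l / 2 ^ S.q < S.bits + 3 :=
  (Nat.div_lt_iff_lt_mul (by positivity)).2 h

/-- Either outcome of the rank comparison at the midpoint preserves `Brackets`: a hit moves `lo`,
and a miss gives the upper bound for `hi`. Monotonicity of `Hits` in the level is not used. -/
theorem runs_searchStep (H : S.Fits c w M) {a y t k lo hi mid nxt : ℕ}
    (ha : a ≤ S.n + 1) (hy : y ≤ S.n + 1) (hB : Brackets S c a y lo hi) (hlt : lo + 1 < hi) :
    ∃ lo' hi', Brackets S c a y lo' hi' ∧ 2 * (hi' - lo') ≤ hi - lo + 1 ∧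
      Runs w M searchStep (vars a y t k lo hi mid nxt) searchStep.steps
        (vars a y t k lo' hi' ((lo + hi) / 2) (lo' + 1)) := by
  classical
  have hbits := two_le_bits (S := S)
  have hle := hB.le
  have hlo := hB.one_le
  obtain ⟨m, hm⟩ : ∃ m, m = (lo + hi) / 2 := ⟨_, rfl⟩
  have hmlt : m < (S.bits + 3) * 2 ^ S.q := by omega
  have he := exponent_lt hmlt
  have reg0 : ∀ {lo hi mid nxt}, Ev w M (vars a y t k lo hi mid nxt) (.reg 0) a :=
    .reg (r := 0) (by decide)
  have reg1 : ∀ {lo hi mid nxt}, Ev w M (vars a y t k lo hi mid nxt) (.reg 1) y :=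
    .reg (r := 1) (by decide)
  have reg4 : ∀ {lo hi mid nxt}, Ev w M (vars a y t k lo hi mid nxt) (.reg 4) lo :=
    .reg (r := 4) (by decide)
  have reg5 : ∀ {lo hi mid nxt}, Ev w M (vars a y t k lo hi mid nxt) (.reg 5) hi :=
    .reg (r := 5) (by decide)
  have reg6 : ∀ {lo hi mid nxt}, Ev w M (vars a y t k lo hi mid nxt) (.reg 6) mid :=
    .reg (r := 6) (by decide)
  have hmid : ∀ {mid nxt}, Ev w M (vars a y t k lo hi mid nxt)
      (.bin .div (.bin .add (.reg 4) (.reg 5)) (.const 2)) m := by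
    intro mid nxt
    rw [hm]
    refine .div (.add reg4 reg5 ?_) (.const (H.tiny (by omega)))
    refine H.level_small (k := 2 * (S.bits + 3)) ?_ (by omega)
    rw [mul_assoc]
    omega
  have hsucc : ∀ {lo hi mid nxt}, lo < hi → hi ≤ (S.bits + 3) * 2 ^ S.q →
      Runs w M (assign 7 (.bin .add (.reg 4) (.const 1))) (vars a y t k lo hi mid nxt)
        (assign 7 (.bin .add (.reg 4) (.const 1))).steps
        (vars a y t k lo hi mid (lo + 1)) := by
    intro lo hi mid nxt h1 h2
    have := Runs.assign (r := 7) (Ev.add (reg4 (lo := lo) (hi := hi) (mid := mid) (nxt := nxt))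
      (.const (v := 1) (H.tiny (by omega))) (H.level_small (k := S.bits + 3) (by omega)
      (by omega)))
    rwa [update_vars_seven] at this
  have hs : 0 < 2 ^ levelShift S.q m := by positivity
  have hfl : y / 2 ^ levelShift S.q m ≤ (S.n + 1) / 2 ^ levelShift S.q m :=
    Nat.div_le_div_right hy
  have hv := H.ev_valueRankE (reg6 (lo := lo) (hi := hi) (mid := m) (nxt := nxt))
    (H.ev_ceilE reg6 reg0 he ha) he (ceil_le hs ha) (ceil_le_self.trans ha)
  have hst := H.ev_stepRankE (reg6 (lo := lo) (hi := hi) (mid := m) (nxt := nxt))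
    (H.ev_floorE reg6 reg1 he) he (by omega) ((Nat.div_le_self _ _).trans hy)
  have hiff := reaches_iff_count_lt (c := c) (s := 2 ^ levelShift S.q m)
    (one_le_levelFreq (q := S.q) (show 1 ≤ m by omega))
    ((a + (2 ^ levelShift S.q m - 1)) / 2 ^ levelShift S.q m) (y / 2 ^ levelShift S.q m)
  have key : ∃ lo' hi', Brackets S c a y lo' hi' ∧ 2 * (hi' - lo') ≤ hi - lo + 1 ∧
      Runs w M (ifThenElse .lt (valueRankE (.reg 6) (ceilE (.reg 6) (.reg 0)))
        (stepRankE (.reg 6) (floorE (.reg 6) (.reg 1))) (assign 4 (.reg 6)) (assign 5 (.reg 6)))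
        (vars a y t k lo hi m nxt)
        (ifThenElse .lt (valueRankE (.reg 6) (ceilE (.reg 6) (.reg 0)))
        (stepRankE (.reg 6) (floorE (.reg 6) (.reg 1))) (assign 4 (.reg 6))
        (assign 5 (.reg 6))).steps (vars a y t k lo' hi' m nxt) := by
    by_cases hh : S.Hits c a y m
    · refine ⟨m, hi, ⟨by omega, by omega, hle, hh, hB.misses⟩, by omega,
        Runs.ifLt hv hst (fun _ => ?_) fun h => ?_⟩
      · have := Runs.assign (r := 4) (reg6 (lo := lo) (hi := hi) (mid := m) (nxt := nxt))
        rwa [update_vars_four] at this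
      · exact absurd (hiff.1 hh) (not_lt.2 h)
    · refine ⟨lo, m, ⟨hlo, by omega, by omega, hB.hits, maxFreq_lt_of_not_hits hh⟩, by omega,
        Runs.ifLt hv hst (fun h => ?_) fun _ => ?_⟩
      · exact absurd (hiff.2 h) hh
      · have := Runs.assign (r := 5) (reg6 (lo := lo) (hi := hi) (mid := m) (nxt := nxt))
        rwa [update_vars_five] at this
  obtain ⟨lo', hi', hB', hgap, hrun⟩ := key
  refine ⟨lo', hi', hB', hgap, ?_⟩
  rw [← hm]
  have h1 := Runs.assign (r := 6) (hmid (mid := mid) (nxt := nxt))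
  rw [update_vars_six] at h1
  exact Runs.seq_steps h1 (Runs.seq_steps hrun (hsucc hB'.lt hB'.le))

/-- The gap halves up to rounding, so 2^(d + 1) becomes at most 2^d. Variable 7 holds lo + 1 because
the loop test compares two registers directly. -/
theorem runs_searchProgram (H : S.Fits c w M) {a y t k : ℕ} (ha : a ≤ S.n + 1)
    (hy : y ≤ S.n + 1) (d : ℕ) :
    ∀ {lo hi mid : ℕ}, Brackets S c a y lo hi → hi - lo ≤ 2 ^ d →
      ∃ lo' mid', Brackets S c a y lo' (lo' + 1) ∧
        Runs w M searchProgram (vars a y t k lo hi mid (lo + 1))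
          (d * (searchStep.steps + 1) + 1) (vars a y t k lo' (lo' + 1) mid' (lo' + 1)) := by
  induction d with
  | zero =>
    intro lo hi mid hB hd
    have := hB.lt
    obtain rfl : hi = lo + 1 := by
      rw [pow_zero] at hd
      omega
    exact ⟨lo, mid, hB, (Runs.loop_done (x := 7) (y := 5) (by decide) (by decide) le_rfl).mono
        (Nat.le_add_left _ _)⟩
  | succ d ih =>
    intro lo hi mid hB hd
    have hlt := hB.lt
    by_cases h : lo + 1 < hi
    · obtain ⟨lo₁, hi₁, hB₁, hgap, hrun⟩ := runs_searchStep H (t := t) (k := k) (mid := mid)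
        (nxt := lo + 1) ha hy hB h
      obtain ⟨lo', mid', hB', hrun'⟩ := ih (mid := (lo + hi) / 2) hB₁ (by
        rw [pow_succ] at hd
        omega)
      refine ⟨lo', mid', hB', (Runs.loop_step (by decide) (by decide) h hrun hrun').mono ?_⟩
      rw [add_mul]
      omega
    · obtain rfl : hi = lo + 1 := by omega
      exact ⟨lo, mid, hB, (Runs.loop_done (x := 7) (y := 5) (by decide) (by decide) le_rfl).mono
        (Nat.le_add_left _ _)⟩

/-- The position that is returned is a frequent one. -/
theorem runs_positionProgram (H : S.Fits c w M) {a y t k lo hi mid nxt : ℕ}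
    (hy : y ≤ S.n + 1) (hB : Brackets S c a y lo hi) :
    ∃ p, a ≤ p ∧ p < y ∧ levelFreq S.q lo ≤ occ c a y (c p) ∧
      Runs w M positionProgram (vars a y t k lo hi mid nxt) positionProgram.steps
        (vars p y t k lo hi mid nxt) := by
  have hbits := two_le_bits (S := S)
  have hlen := length_lt (S := S)
  have he := exponent_lt (hB.lt.trans_le hB.le)
  have hlo := hB.one_le
  have hf := one_le_levelFreq (q := S.q) hlo
  obtain ⟨h1, h2, h3, h4⟩ := ceil_floor_bounds (a := a) (y := y)
    (s := 2 ^ levelShift S.q lo) (by positivity)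
  have hh := hB.hits
  unfold Hits at hh
  have hst := (lt_stair_iff hf).2 hh
  have hsp := stairPos_spec hf ((lt_stair_iff hf).1
    (Nat.sub_lt (Nat.zero_lt_of_lt hst) one_pos))
  -- The witness belongs to the last left endpoint under the staircase, which is at or after a
  -- rounded up. So its f occurrences lie within [a, y).
  have hmono : 2 ^ levelShift S.q lo * ((a + (2 ^ levelShift S.q lo - 1)) / 2 ^ levelShift S.q lo) ≤
      2 ^ levelShift S.q lo * (stair c (2 ^ levelShift S.q lo) (levelFreq S.q lo)
        (y / 2 ^ levelShift S.q lo) - 1) :=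
    Nat.mul_le_mul_left _ (Nat.le_sub_one_of_lt hst)
  have hfl : y / 2 ^ levelShift S.q lo ≤ (S.n + 1) / 2 ^ levelShift S.q lo + 1 :=
    (Nat.div_le_div_right hy).trans (Nat.le_succ _)
  have hfl' : y / 2 ^ levelShift S.q lo ≤ S.n + 1 := (Nat.div_le_self _ _).trans hy
  set j := y / 2 ^ levelShift S.q lo
  set p := stairPos c (2 ^ levelShift S.q lo) (levelFreq S.q lo)
    (stair c (2 ^ levelShift S.q lo) (levelFreq S.q lo) j) with hp
  refine ⟨p, by omega, by omega, hsp.2.2.trans (occ_mono (by omega) (by omega) _), ?_⟩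
  have reg1 : Ev w M (vars a y t k lo hi mid nxt) (.reg 1) y := .reg (r := 1) (by decide)
  have reg4 : Ev w M (vars a y t k lo hi mid nxt) (.reg 4) lo := .reg (r := 4) (by decide)
  have ej : Ev w M (vars a y t k lo hi mid nxt) (floorE (.reg 4) (.reg 1)) j :=
    H.ev_floorE reg4 reg1 he
  refine Runs.ifLt (H.ev_stepWord reg4 ej he hfl) (.const (v := 1) (H.tiny (by omega)))
    (fun h0 => ?_) fun h0 => ?_
  · have hr := read_pos_of_zero c he hlo hfl (by omega) (Nat.zero_lt_of_lt hst) (Nat.lt_one_iff.1 h0)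
    have := Runs.assign (r := 0) (H.ev_chunkPosE reg4 ej he hfl)
    rwa [update_vars_zero, hr] at this
  · obtain ⟨r1, r2, r3⟩ := read_pos_of_ne_zero c he hlo hfl (by omega : S.stepWord c lo j ≠ 0)
    have := Runs.assign (r := 0) (H.ev_stepPosE reg4 ej he hfl hfl' r1 r2 r3 (by omega))
    rwa [update_vars_zero] at this

/-- The approximation that a level and the failure of the next one guarantee. -/
theorem approx_of_brackets {a y lo : ℕ} (hB : Brackets S c a y lo (lo + 1)) :
    maxFreq c a y ≤ levelFreq S.q lo ∨ (2 ^ S.q ≤ maxFreq c a y ∧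
      2 ^ S.q * maxFreq c a y ≤ (2 ^ S.q + 5) * levelFreq S.q lo) := by
  have hm := hB.misses
  have hh := hB.hits
  have hF : levelFreq S.q lo ≤ maxFreq c a y := by
    obtain ⟨h1, h2, h3, h4⟩ := ceil_floor_bounds (a := a) (y := y)
      (s := 2 ^ levelShift S.q lo) (by positivity)
    exact le_trans hh (maxFreq_mono h1 h3)
  rw [levelFreq_succ] at hm
  by_cases h0 : lo + 1 < 2 * 2 ^ S.q
  · rw [levelShift_eq_zero h0, levelShift_eq_zero (show lo < 2 * 2 ^ S.q by omega)] at hm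
    left
    simpa using Nat.lt_succ_iff.1 hm
  · right
    have hq : 0 < 2 ^ S.q := by positivity
    have h1 := two_pow_mul_stride_le (q := S.q) (show 2 ^ S.q ≤ lo by omega)
    have h2 : 2 ^ levelShift S.q (lo + 1) ≤ 2 * 2 ^ levelShift S.q lo := by
      rw [← pow_succ']
      exact Nat.pow_le_pow_right two_pos (levelShift_succ_le lo)
    have hs : 0 < 2 ^ levelShift S.q lo := by positivity
    refine ⟨(Nat.le_mul_of_pos_right _ hs).trans (h1.trans hF), ?_⟩
    -- The 5 is one stride up to the next level plus twice that level's stride, which is at most two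
    -- strides of `lo`.
    have h3 : maxFreq c a y ≤ levelFreq S.q lo + 5 * 2 ^ levelShift S.q lo := by omega
    nlinarith [Nat.mul_le_mul_left (2 ^ S.q) h3]

/-- The whole query. -/
theorem runs_queryProgram (H : S.Fits c w M) (hq : 1 ≤ S.q) {a b : ℕ} (hab : a ≤ b)
    (hb : b ≤ S.n) :
    ∃ p, a ≤ p ∧ p ≤ b ∧
      (maxFreq c a (b + 1) ≤ occ c a (b + 1) (c p) ∨ (2 ^ S.q ≤ maxFreq c a (b + 1) ∧
        2 ^ S.q * maxFreq c a (b + 1) ≤ (2 ^ S.q + 5) * occ c a (b + 1) (c p))) ∧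
      ∃ env, env 0 = p ∧ Runs w M queryProgram (vars a b 0 0 0 0 0 0)
        (scaleProgram.steps + estimateProgram.steps + positionProgram.steps + 1 +
          (S.q + 2) * (searchStep.steps + 1)) env := by
  obtain ⟨k, hk1, hk2, hF1, hF2, hest⟩ := runs_estimateProgram H
    (show a < b + 1 by omega) (show b + 1 ≤ S.n + 1 by omega)
  have hB : Brackets S c a (b + 1) (powLevel S.q (k - 2)) (powLevel S.q (k + 2)) := by
    have hpow : 2 ^ (k - 2) < 2 ^ (k + 2) := Nat.pow_lt_pow_right one_lt_two (by omega)
    have hsucc : ∀ m, powLevel S.q m < powLevel S.q (m + 1) := by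
      intro m
      unfold powLevel
      split_ifs with h1 h2 h2
      · exact Nat.pow_lt_pow_right one_lt_two (by omega)
      · calc 2 ^ m < 2 ^ S.q := Nat.pow_lt_pow_right one_lt_two h1
          _ ≤ _ := Nat.le_mul_of_pos_left _ (by omega)
      · omega
      · exact Nat.mul_lt_mul_of_pos_right (by omega) (by positivity)
    refine ⟨powLevel_pos _, strictMono_nat_of_lt_succ hsucc (by omega),
      powLevel_le.trans (Nat.mul_le_mul_right _ (by omega)), ?_, ?_⟩
    · refine hits_of_le ?_
      rw [levelFreq_powLevel]
      by_cases hl : powLevel S.q (k - 2) < 2 * 2 ^ S.q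
      · rw [levelShift_eq_zero hl, pow_zero]
        exact le_trans (Nat.pow_le_pow_right two_pos (by omega)) hF1
      · have hpq : 0 < 2 ^ S.q := by positivity
        have h1 := two_pow_mul_stride_le (q := S.q)
          (show 2 ^ S.q ≤ powLevel S.q (k - 2) by omega)
        rw [levelFreq_powLevel] at h1
        have h2 : 2 ^ 1 ≤ 2 ^ S.q := Nat.pow_le_pow_right two_pos hq
        have h3 := Nat.mul_le_mul_right (2 ^ levelShift S.q (powLevel S.q (k - 2))) h2
        -- With k = 1 the subtraction k - 2 truncates and the level is 1, which has stride 1 and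
        -- belongs to the other case.
        have hk : 2 ≤ k := by
          by_contra! hlt
          have hk0 : k - 2 = 0 := by omega
          rw [hk0] at hl
          exact hl (by rw [powLevel, if_pos (by omega)]; omega)
        have h4 : 2 ^ (k - 1) = 2 * 2 ^ (k - 2) := by
          rw [← pow_succ']
          congr 1
          omega
        omega
    · rw [levelFreq_powLevel]
      omega
  -- From 2^(k - 2) to 2^(k + 2) there are four doublings, or three when k = 1, each passing at most
  -- 2^q levels.
  have hgap : powLevel S.q (k + 2) - powLevel S.q (k - 2) ≤ 2 ^ (S.q + 2) := by
    have h0 := powLevel_succ_le (q := S.q) (k - 2)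
    have h1 : powLevel S.q (k - 2 + 2) ≤ powLevel S.q (k - 2 + 1) + 2 ^ S.q := powLevel_succ_le _
    have h2 : powLevel S.q (k - 2 + 3) ≤ powLevel S.q (k - 2 + 2) + 2 ^ S.q := powLevel_succ_le _
    have h3 : powLevel S.q (k - 2 + 4) ≤ powLevel S.q (k - 2 + 3) + 2 ^ S.q := powLevel_succ_le _
    rw [pow_add]
    rcases Nat.lt_or_ge k 2 with h | h
    · obtain rfl : k = 1 := by omega
      simp only [Nat.reduceSub, Nat.reduceAdd] at *
      omega
    · rw [show k + 2 = k - 2 + 4 by omega]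
      omega
  obtain ⟨lo, mid, hB', hsearch⟩ := runs_searchProgram H (t := Nat.log 2 (a ^^^ (b + 1))) (k := k)
    (by omega : a ≤ S.n + 1) (show b + 1 ≤ S.n + 1 by omega) (S.q + 2) (mid := 0) hB hgap
  obtain ⟨p, hp1, hp2, hp3, hpos⟩ := runs_positionProgram H (t := Nat.log 2 (a ^^^ (b + 1)))
    (k := k) (mid := mid) (nxt := lo + 1) (show b + 1 ≤ S.n + 1 by omega) hB'
  refine ⟨p, hp1, Nat.lt_succ_iff.1 hp2, ?_, _, rfl,
    ((runs_scaleProgram H (hab.trans hb) hb).seq (hest.seq (hsearch.seq hpos))).mono (by omega)⟩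
  rcases approx_of_brackets hB' with h | ⟨h1, h2⟩
  · exact Or.inl (h.trans hp3)
  · exact Or.inr ⟨h1, h2.trans (Nat.mul_le_mul_left _ hp3)⟩

end Layout

/-! ### Space -/

namespace Layout

variable {S : Layout}

theorem sq_le_two_pow (b : ℕ) : b ^ 2 ≤ 2 * 2 ^ b := by
  induction b with
  | zero => norm_num
  | succ b ih =>
    rcases Nat.lt_or_ge b 3 with h | h
    · interval_cases b <;> norm_num
    · rw [pow_succ 2 b]
      nlinarith

theorem cubic_le_two_pow (b : ℕ) : (b + 3) * ((b + 1) * (b + 10)) ≤ 45 * 2 ^ b := by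
  induction b with
  | zero => norm_num
  | succ b ih =>
    rcases Nat.lt_or_ge b 3 with h | h
    · interval_cases b <;> norm_num
    · rw [pow_succ 2 b]
      nlinarith [Nat.mul_le_mul h (Nat.mul_le_mul h h), Nat.mul_le_mul_left b h]

/-- The terms telescope to a closed form whose limit is 20. The next sum is treated in the same way,
with limit 18. -/
theorem sum_scale_le (m : ℕ) :
    ∑ t ∈ Finset.range m, (((t : ℝ) + 1) * (t + 3) / 2 ^ t) ≤ 20 := by
  have h : ∀ m : ℕ, ∑ t ∈ Finset.range m, (((t : ℝ) + 1) * (t + 3) / 2 ^ t) =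
      20 - (2 * (m : ℝ) ^ 2 + 12 * m + 20) / 2 ^ m := by
    intro m
    induction m with
    | zero => norm_num
    | succ m ih =>
      rw [Finset.sum_range_succ, ih]
      push_cast
      field_simp
      ring
  rw [h]
  have : 0 ≤ (2 * (m : ℝ) ^ 2 + 12 * m + 20) / 2 ^ m := by positivity
  linarith

theorem sum_level_le (m : ℕ) : ∑ e ∈ Finset.range m, ((8 + (e : ℝ)) / 2 ^ e) ≤ 18 := by
  have h : ∀ m : ℕ, ∑ e ∈ Finset.range m, ((8 + (e : ℝ)) / 2 ^ e) =
      18 - (2 * (m : ℝ) + 18) / 2 ^ m := by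
    intro m
    induction m with
    | zero => norm_num
    | succ m ih =>
      rw [Finset.sum_range_succ, ih]
      push_cast
      field_simp
      ring
  rw [h]
  have : 0 ≤ (2 * (m : ℝ) + 18) / 2 ^ m := by positivity
  linarith

theorem cast_div_two_pow_le (k : ℕ) :
    (((S.n + 1) / 2 ^ k : ℕ) : ℝ) ≤ 2 ^ S.bits / 2 ^ k := by
  refine Nat.cast_div_le.trans ?_
  push_cast
  gcongr
  exact_mod_cast (length_lt (S := S)).le

theorem sq_bits_le_two_pow_maxBlock : S.bits ^ 2 ≤ 2 ^ S.maxBlock := by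
  have h : S.bits < 2 ^ (Nat.log 2 S.bits + 1) := Nat.lt_pow_succ_log_self one_lt_two _
  calc S.bits ^ 2 ≤ (2 ^ (Nat.log 2 S.bits + 1)) ^ 2 := Nat.pow_le_pow_left h.le 2
    _ = 2 ^ S.maxBlock := by rw [← pow_mul, maxBlock]; congr 1; ring

/-- At small scales a block has length 2^t and the first term is a summable share. At large scales
blocks have length at least bits^2 and records O(bits) bits, so each scale costs O(2^bits / bits);
the last term pays for the extra block. -/
theorem scale_section_le {t : ℕ} (ht : t < S.bits) :
    ((S.scaleBlocks t * S.scaleRecBits t : ℕ) : ℝ) ≤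
      2 ^ S.bits * (((t : ℝ) + 1) * (t + 3) / 2 ^ t) + 21 * (2 ^ S.bits / S.bits) +
        21 * S.bits := by
  have hb : (2 : ℝ) ≤ S.bits := by exact_mod_cast two_le_bits
  have hN : (0 : ℝ) < 2 ^ S.bits := by positivity
  have hrec : (S.scaleRecBits t : ℝ) ≤ 21 * S.bits := by
    have := block_bits_le (S := S) t
    have h : S.scaleRecBits t ≤ 21 * S.bits := by
      unfold scaleRecBits
      unfold window at this
      omega
    exact_mod_cast h
  have hblocks : (S.scaleBlocks t : ℝ) ≤ 2 ^ S.bits / 2 ^ S.blockLog t + 1 := by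
    rw [scaleBlocks, Nat.cast_add, Nat.cast_one]
    exact add_le_add_left (cast_div_two_pow_le _) 1
  have h0 : (0 : ℝ) ≤ S.scaleRecBits t := Nat.cast_nonneg _
  have h1 : (S.scaleBlocks t : ℝ) * S.scaleRecBits t ≤
      2 ^ S.bits / 2 ^ S.blockLog t * S.scaleRecBits t + 21 * S.bits := by
    have := mul_le_mul_of_nonneg_right hblocks h0
    linarith
  push_cast
  rcases le_total t S.maxBlock with h | h
  · have hlog : S.blockLog t = t := min_eq_left h
    have h2 : (S.scaleRecBits t : ℝ) = ((t : ℝ) + 1) * (t + 3) := by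
      rw [scaleRecBits, hlog]
      push_cast
      ring
    have h3 : (0 : ℝ) ≤ 21 * (2 ^ S.bits / S.bits) := by positivity
    rw [h2, hlog] at h1
    rw [h2]
    have h4 : (2 : ℝ) ^ S.bits / 2 ^ t * (((t : ℝ) + 1) * (t + 3)) =
      2 ^ S.bits * (((t : ℝ) + 1) * (t + 3) / 2 ^ t) := by ring
    linarith
  · have hlog : S.blockLog t = S.maxBlock := min_eq_right h
    have hsq : (S.bits : ℝ) ^ 2 ≤ 2 ^ S.maxBlock := by
      exact_mod_cast sq_bits_le_two_pow_maxBlock (S := S)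
    have h2 : (2 : ℝ) ^ S.bits / 2 ^ S.blockLog t * S.scaleRecBits t ≤
        21 * (2 ^ S.bits / S.bits) := by
      rw [hlog]
      calc (2 : ℝ) ^ S.bits / 2 ^ S.maxBlock * S.scaleRecBits t
          ≤ 2 ^ S.bits / (S.bits : ℝ) ^ 2 * (21 * S.bits) := by gcongr
        _ = 21 * (2 ^ S.bits / S.bits) := by field_simp
    have h3 : (0 : ℝ) ≤ 2 ^ S.bits * (((t : ℝ) + 1) * (t + 3) / 2 ^ t) := by positivity
    linarith

/-- Because bits ≤ 2 * chunk, the 3 * bits per record amount to at most 6 bits per place. With the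
two bit vectors and the offset, a place costs at most 8 + (e - 1) bits. -/
theorem level_section_le {e : ℕ} (he : e < S.bits + 3) :
    ((S.levelBlocks e * S.levelRecBits e : ℕ) : ℝ) ≤
      2 ^ S.bits * (2 * ((8 + (e : ℝ)) / 2 ^ e)) + (S.bits + 1) * (S.bits + 10) := by
  have hc := chunk_le_bits (S := S)
  have hc2 := bits_le_two_mul_chunk (S := S)
  have hrec : S.levelRecBits e ≤ S.chunk * (8 + (e - 1)) := by
    unfold levelRecBits
    rw [mul_add]
    omega
  have h1 : S.levelBlocks e * S.levelRecBits e ≤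
      ((S.n + 1) / 2 ^ (e - 1) + 1 + S.chunk) * (8 + (e - 1)) := by
    calc S.levelBlocks e * S.levelRecBits e ≤ S.levelBlocks e * (S.chunk * (8 + (e - 1))) :=
          Nat.mul_le_mul_left _ hrec
      _ = (((S.n + 1) / 2 ^ (e - 1) + 1) / S.chunk * S.chunk + S.chunk) * (8 + (e - 1)) := by
          unfold levelBlocks
          ring
      _ ≤ _ := Nat.mul_le_mul_right _ (Nat.add_le_add_right (Nat.div_mul_le_self _ _) _)
  have h2 : (1 + S.chunk) * (8 + (e - 1)) ≤ (S.bits + 1) * (S.bits + 10) :=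
    Nat.mul_le_mul (by omega) (by omega)
  have h3 : (8 + ((e - 1 : ℕ) : ℝ)) / 2 ^ (e - 1) ≤ 2 * ((8 + (e : ℝ)) / 2 ^ e) := by
    rcases Nat.eq_zero_or_pos e with rfl | h
    · norm_num
    · obtain ⟨d, rfl⟩ := Nat.exists_eq_add_of_le' h
      rw [Nat.add_sub_cancel, pow_succ, mul_div_assoc', mul_comm ((2 : ℝ) ^ d), mul_div_mul_left _ _
        two_ne_zero]
      gcongr
      push_cast
      linarith
  have h4 := cast_div_two_pow_le (S := S) (e - 1)
  have h0 : (0 : ℝ) ≤ 8 + ((e - 1 : ℕ) : ℝ) := by positivity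
  calc ((S.levelBlocks e * S.levelRecBits e : ℕ) : ℝ)
      ≤ (((S.n + 1) / 2 ^ (e - 1) + 1 + S.chunk) * (8 + (e - 1)) : ℕ) := by exact_mod_cast h1
    _ = (((S.n + 1) / 2 ^ (e - 1) : ℕ) : ℝ) * (8 + ((e - 1 : ℕ) : ℝ)) +
        (((1 + S.chunk) * (8 + (e - 1)) : ℕ) : ℝ) := by
        generalize (S.n + 1) / 2 ^ (e - 1) = x
        generalize e - 1 = d
        push_cast
        ring
    _ ≤ 2 ^ S.bits / 2 ^ (e - 1) * (8 + ((e - 1 : ℕ) : ℝ)) +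
        (((S.bits + 1) * (S.bits + 10) : ℕ) : ℝ) := by
        refine add_le_add (mul_le_mul_of_nonneg_right h4 h0) ?_
        exact_mod_cast h2
    _ = 2 ^ S.bits * ((8 + ((e - 1 : ℕ) : ℝ)) / 2 ^ (e - 1)) +
        (S.bits + 1) * (S.bits + 10) := by
        push_cast
        ring
    _ ≤ _ := by gcongr

/-- 164 = 83 + 81: the scales give 20 + 21 + 42 and the levels 36 + 45, where 42 and 45 absorb the
polynomial terms in `bits`. -/
theorem totalBits_le : (S.totalBits : ℝ) ≤ 164 * (2 ^ S.q * 2 ^ S.bits) := by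
  have hb : (2 : ℝ) ≤ S.bits := by exact_mod_cast two_le_bits
  have hN : (0 : ℝ) < 2 ^ S.bits := by positivity
  have hq : (1 : ℝ) ≤ 2 ^ S.q := one_le_pow₀ one_le_two
  have hsq : (S.bits : ℝ) ^ 2 ≤ 2 * 2 ^ S.bits := by exact_mod_cast sq_le_two_pow S.bits
  have hcub : ((S.bits : ℝ) + 3) * ((S.bits + 1) * (S.bits + 10)) ≤ 45 * 2 ^ S.bits := by
    exact_mod_cast cubic_le_two_pow S.bits
  have hsplit : (S.totalBits : ℝ) =
      ∑ t ∈ Finset.range S.bits, ((S.scaleBlocks t * S.scaleRecBits t : ℕ) : ℝ) +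
      2 ^ S.q * ∑ e ∈ Finset.range (S.bits + 3), ((S.levelBlocks e * S.levelRecBits e : ℕ) : ℝ) := by
    rw [totalBits, fieldOffset, numSections, Nat.cast_sum, Finset.sum_range_add, Finset.mul_sum]
    congr 1
    · refine Finset.sum_congr rfl fun t ht => ?_
      rw [sectionBits, if_pos (Finset.mem_range.1 ht)]
    · refine Finset.sum_congr rfl fun e _ => ?_
      rw [sectionBits, if_neg (by omega), Nat.add_sub_cancel_left]
      push_cast
      ring
  have h1 : ∑ t ∈ Finset.range S.bits, ((S.scaleBlocks t * S.scaleRecBits t : ℕ) : ℝ) ≤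
      83 * 2 ^ S.bits := by
    refine (Finset.sum_le_sum fun t ht => scale_section_le (Finset.mem_range.1 ht)).trans ?_
    rw [Finset.sum_add_distrib, Finset.sum_add_distrib, ← Finset.mul_sum, Finset.sum_const,
      Finset.sum_const, Finset.card_range, nsmul_eq_mul, nsmul_eq_mul]
    have h2 := mul_le_mul_of_nonneg_left (sum_scale_le S.bits) hN.le
    have h3 : (S.bits : ℝ) * (21 * (2 ^ S.bits / S.bits)) = 21 * 2 ^ S.bits := by field_simp
    rw [h3]
    nlinarith
  have h2 : ∑ e ∈ Finset.range (S.bits + 3), ((S.levelBlocks e * S.levelRecBits e : ℕ) : ℝ) ≤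
      81 * 2 ^ S.bits := by
    refine (Finset.sum_le_sum fun e he => level_section_le (Finset.mem_range.1 he)).trans ?_
    rw [Finset.sum_add_distrib, ← Finset.mul_sum, ← Finset.mul_sum, Finset.sum_const,
      Finset.card_range, nsmul_eq_mul]
    have h2 := mul_le_mul_of_nonneg_left (sum_level_le (S.bits + 3)) hN.le
    push_cast
    nlinarith
  rw [hsplit]
  have h3 := mul_le_mul_of_nonneg_left h2 (zero_le_one.trans hq)
  nlinarith

/-- The tables have about 2^(bits / 2) rows, which leaves a factor of about 2^(bits / 2) to absorb
`bits`. The constant is 2 + 2 + 8, for the three summands of `rows`. -/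
theorem rows_mul_bits_le : S.rows * S.bits ≤ 12 * 2 ^ S.bits := by
  have h1 := sq_le_two_pow S.bits
  have h2 : S.bits < 2 ^ S.bits := Nat.lt_two_pow_self
  obtain ⟨r, hr⟩ := Nat.exists_eq_add_of_le (chunk_le_bits (S := S))
  have h3 : S.bits ≤ 2 * 2 ^ r := by
    have h4 : r + 1 ≤ 2 ^ r := Nat.lt_two_pow_self
    unfold chunk at hr
    omega
  have h5 : 2 ^ S.chunk * S.bits ≤ 2 * 2 ^ S.bits := by
    calc 2 ^ S.chunk * S.bits ≤ 2 ^ S.chunk * (2 * 2 ^ r) := Nat.mul_le_mul_left _ h3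
      _ = 2 * 2 ^ (S.chunk + r) := by ring
      _ = 2 * 2 ^ S.bits := by rw [← hr]
  unfold rows
  nlinarith

/-! ### The memory image -/

variable (S) in
/-- The number of words of the data structure. -/
def numWords : ℕ := 17 * S.rows + (S.totalBits / S.window + 1)

section Image

variable {α : Type*} [DecidableEq α] (c : ℕ → α)

variable (S) in
/-- The words of the data structure: the tables, followed by overlapping windows of its bits. -/
noncomputable def image (x : ℕ) : ℕ :=
  if x < 17 * S.rows then S.column (x % 17) (x / 17)
  else slice (S.content c) (S.window * (x - 17 * S.rows)) (2 * S.window)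

variable (S) in
/-- The data structure. -/
noncomputable def words (w : ℕ) : List (BitVec w) :=
  (List.range S.numWords).map fun x => BitVec.ofNat w (S.image c x)

theorem length_words (w : ℕ) : (S.words c w).length = S.numWords := by
  simp [words]

theorem words_getD {w x : ℕ} (hx : x < S.numWords) :
    ((S.words c w).getD x 0).toNat = S.image c x % 2 ^ w := by
  simp [words, List.getD, hx]

theorem fits_words {w : ℕ} (hw : 2 * S.window ≤ w) (hq : S.q ≤ S.bits) :
    S.Fits c w fun x => ((S.words c w).getD x 0).toNat where
  row i j hj hi hc := by
    have h1 : i * 17 + j < 17 * S.rows := by omega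
    rw [words_getD c (by unfold numWords; exact h1.trans_le (Nat.le_add_right _ _)), image,
      if_pos h1, show (i * 17 + j) % 17 = j by omega, show (i * 17 + j) / 17 = i by omega,
      Nat.mod_eq_of_lt hc]
  win i hi := by
    rw [words_getD c (by unfold numWords; omega), image, if_neg (by omega), Nat.add_sub_cancel_left,
      Nat.mod_eq_of_lt ((slice_lt _ _ _).trans_le (Nat.pow_le_pow_right two_pos hw))]
  addr := by
    have hb := two_le_bits (S := S)
    have h1 : S.rows ≤ 12 * 2 ^ S.bits :=
      (Nat.le_mul_of_pos_right _ (by omega)).trans rows_mul_bits_le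
    have h2 : S.totalBits ≤ 164 * (2 ^ S.q * 2 ^ S.bits) := by
      exact_mod_cast totalBits_le (S := S)
    have h3 : 2 ^ S.q * 2 ^ S.bits ≤ 2 ^ S.bits * 2 ^ S.bits :=
      Nat.mul_le_mul_right _ (Nat.pow_le_pow_right two_pos hq)
    -- Tables and content are bounded by (17 * 12 + 164) * 2^(2 * bits), and 368 < 2^9.
    have h4 : 2 ^ (9 + (S.bits + S.bits)) ≤ 2 ^ w := by
      unfold window at hw
      exact Nat.pow_le_pow_right two_pos (by omega)
    have h5 : 0 < 2 ^ S.bits := by positivity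
    rw [pow_add, pow_add 2 S.bits] at h4
    nlinarith
  word := hw
  prec := hq

/-- 369 = 17 * 12 + 1 + 164, for the tables, one extra word and the content. The doubling by overlap
is harmless because a new window starts only every 20 * bits bits. -/
theorem numWords_mul_le {K w : ℕ} (hw : w ≤ K * S.bits) :
    ((S.numWords * w : ℕ) : ℝ) ≤ 369 * K * (2 ^ S.q * 2 ^ S.bits) := by
  have hb := two_le_bits (S := S)
  have h1 := rows_mul_bits_le (S := S)
  have h2 : S.totalBits / S.window * S.bits ≤ S.totalBits := by
    refine (Nat.mul_le_mul_left _ ?_).trans (Nat.div_mul_le_self S.totalBits S.window)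
    unfold window
    omega
  have h3 : S.bits < 2 ^ S.bits := Nat.lt_two_pow_self
  have h4 : S.numWords * S.bits ≤ 205 * 2 ^ S.bits + S.totalBits := by
    unfold numWords
    nlinarith
  have h5 : S.numWords * w ≤ K * (205 * 2 ^ S.bits + S.totalBits) := by
    calc S.numWords * w ≤ S.numWords * (K * S.bits) := Nat.mul_le_mul_left _ hw
      _ = K * (S.numWords * S.bits) := by ring
      _ ≤ _ := Nat.mul_le_mul_left _ h4
  have h6 := totalBits_le (S := S)
  have hq : (1 : ℝ) ≤ 2 ^ S.q := one_le_pow₀ one_le_two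
  have hN : (0 : ℝ) < 2 ^ S.bits := by positivity
  have h7 : (205 : ℝ) * 2 ^ S.bits + S.totalBits ≤ 369 * (2 ^ S.q * 2 ^ S.bits) := by
    nlinarith
  calc ((S.numWords * w : ℕ) : ℝ) ≤ (K * (205 * 2 ^ S.bits + S.totalBits) : ℕ) := by
        exact_mod_cast h5
    _ = (K : ℝ) * (205 * 2 ^ S.bits + S.totalBits) := by push_cast; ring
    _ ≤ K * (369 * (2 ^ S.q * 2 ^ S.bits)) := mul_le_mul_of_nonneg_left h7 (Nat.cast_nonneg _)
    _ = _ := by ring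

end Image

end Layout

/-! ### The theorem -/

open WordRAM

/-- The precision of the levels for the approximation factor `1 + ε`. -/
noncomputable def precision (n : ℕ) (ε : ℝ) : ℕ :=
  min (Nat.log 2 n + 2) (Nat.clog 2 ⌈8 / ε⌉₊)

theorem one_le_precision {n : ℕ} {ε : ℝ} (h0 : 0 < ε) (h1 : ε ≤ 1) : 1 ≤ precision n ε := by
  refine le_min (by omega) (Nat.clog_pos one_lt_two ?_)
  have : (8 : ℝ) ≤ 8 / ε := by rw [le_div_iff₀ h0]; linarith
  have h2 : (8 : ℝ) ≤ (⌈8 / ε⌉₊ : ℝ) := this.trans (Nat.le_ceil _)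
  have h3 : 8 ≤ ⌈8 / ε⌉₊ := by exact_mod_cast h2
  omega

/-- Rounding 8/ε up to an integer and then to a power of two gives at most 2 (8/ε + 1), and 2 ≤ 2/ε.
-/
theorem two_pow_precision_le {n : ℕ} {ε : ℝ} (h0 : 0 < ε) (h1 : ε ≤ 1) :
    (2 : ℝ) ^ precision n ε ≤ 18 / ε := by
  have h8 : (8 : ℝ) ≤ 8 / ε := by rw [le_div_iff₀ h0]; linarith
  have hc : 1 < ⌈8 / ε⌉₊ := by
    have h2 : (8 : ℝ) ≤ (⌈8 / ε⌉₊ : ℝ) := h8.trans (Nat.le_ceil _)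
    have h3 : 8 ≤ ⌈8 / ε⌉₊ := by exact_mod_cast h2
    omega
  have h2 := Nat.pow_pred_clog_lt_self one_lt_two hc
  have hpos := Nat.clog_pos one_lt_two hc
  have h3 : 2 ^ Nat.clog 2 ⌈8 / ε⌉₊ ≤ 2 * ⌈8 / ε⌉₊ := by
    rw [← Nat.succ_pred_eq_of_pos hpos, pow_succ]
    omega
  have h4 : (2 : ℝ) ^ precision n ε ≤ 2 ^ Nat.clog 2 ⌈8 / ε⌉₊ :=
    pow_le_pow_right₀ one_le_two (min_le_right _ _)
  have h5 : ((2 ^ Nat.clog 2 ⌈8 / ε⌉₊ : ℕ) : ℝ) ≤ (2 * ⌈8 / ε⌉₊ : ℕ) := by exact_mod_cast h3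
  push_cast at h5
  have h6 := (Nat.ceil_lt_add_one (show (0 : ℝ) ≤ 8 / ε by positivity)).le
  have h7 : (18 : ℝ) / ε = 2 * (8 / ε) + 2 / ε := by ring
  have h9 : (2 : ℝ) ≤ 2 / ε := by rw [le_div_iff₀ h0]; linarith
  linarith

theorem precision_le_logb {n : ℕ} {ε : ℝ} (h0 : 0 < ε) (h1 : ε ≤ 1) :
    (precision n ε : ℝ) ≤ 5 + Real.logb 2 (1 / ε) := by
  have h2 : (2 : ℝ) ^ precision n ε ≤ 2 ^ (5 : ℕ) * (1 / ε) := by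
    refine (two_pow_precision_le h0 h1).trans ?_
    rw [mul_one_div]
    gcongr
    norm_num
  have h3 := Real.logb_le_logb_of_le one_lt_two (by positivity) h2
  rwa [Real.logb_mul (by positivity) (by positivity), ← Real.rpow_natCast, ← Real.rpow_natCast,
    Real.logb_rpow two_pos (by norm_num), Real.logb_rpow two_pos (by norm_num), Nat.cast_ofNat]
    at h3

/-- If the cap on the precision were active, 2^q would exceed n and hence every frequency. So in the
inexact case 2^q is at least 8/ε, and the error 5/2^q is below ε. -/
theorem isApproxRangeMode_of_precision {α : Type*} [DecidableEq α] {c : ℕ → α} {n a b p : ℕ}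
    {ε : ℝ} (h0 : 0 < ε) (hb : b ≤ n) (hap : a ≤ p) (hpb : p ≤ b)
    (h : maxFreq c a (b + 1) ≤ occ c a (b + 1) (c p) ∨
      (2 ^ precision n ε ≤ maxFreq c a (b + 1) ∧
        2 ^ precision n ε * maxFreq c a (b + 1) ≤
          (2 ^ precision n ε + 5) * occ c a (b + 1) (c p))) :
    IsApproxRangeMode ε c a b p := by
  refine ⟨hap, hpb, ?_⟩
  rw [modeFreq_eq_maxFreq, freq_eq_occ]
  have hocc : (0 : ℝ) ≤ occ c a (b + 1) (c p) := Nat.cast_nonneg _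
  rcases h with h | ⟨h2, h3⟩
  · have : (maxFreq c a (b + 1) : ℝ) ≤ occ c a (b + 1) (c p) := by exact_mod_cast h
    nlinarith
  · have hlt : precision n ε < Nat.log 2 n + 2 := by
      have h4 := maxFreq_le_length (c := c) a (b + 1)
      have h5 := Layout.length_lt (S := ⟨n, 0⟩)
      have h6 : 2 ^ precision n ε < 2 ^ (Nat.log 2 n + 2) := by
        change n + 1 < 2 ^ (Nat.log 2 n + 2) at h5
        omega
      exact (Nat.pow_lt_pow_iff_right one_lt_two).1 h6
    have hq : precision n ε = Nat.clog 2 ⌈8 / ε⌉₊ := by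
      unfold precision at hlt ⊢
      omega
    have h7 : 8 / ε ≤ 2 ^ precision n ε := by
      refine (Nat.le_ceil _).trans ?_
      rw [hq]
      exact_mod_cast Nat.le_pow_clog one_lt_two _
    rw [div_le_iff₀ h0] at h7
    have h8 : (2 : ℝ) ^ precision n ε * maxFreq c a (b + 1) ≤
        (2 ^ precision n ε + 5) * occ c a (b + 1) (c p) := by exact_mod_cast h3
    have h9 : (0 : ℝ) < 2 ^ precision n ε := by positivity
    refine le_of_mul_le_mul_left (h8.trans ?_) h9
    nlinarith

theorem mainTheorem1 :
    ∃ (κ : ℕ) (P : WordRAM.Program), ∀ K : ℕ, ∃ C : ℝ,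
      ∀ (n w : ℕ), κ * (Nat.log 2 n + 1) ≤ w → w ≤ K * (Nat.log 2 n + 1) →
      ∀ ε : ℝ, 0 < ε → ε ≤ 1 →
      ∀ (α : Type*) [DecidableEq α] (c : ℕ → α),
        ∃ D : List (BitVec w),
          ((D.length * w : ℕ) : ℝ) ≤ C * ((n : ℝ) / ε) ∧
          AnswersApproxRangeMode P D ε n c (C * (1 + Real.logb 2 (1 / ε))) := by
  -- 80 (lg n + 1) ≥ 40 (lg n + 2) = 2 * `window`, the length of a stored window.
  refine ⟨80, queryProgram, fun K => ?_⟩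
  obtain ⟨A, hA⟩ : ∃ A, A = scaleProgram.steps + estimateProgram.steps +
    positionProgram.steps + 1 := ⟨_, rfl⟩
  obtain ⟨B, hB⟩ : ∃ B, B = searchStep.steps + 1 := ⟨_, rfl⟩
  -- 26568 = 369 * 18 * 4, where 18/ε bounds 2^q and 4n bounds 2^bits. The search takes at most q +
  -- 2 ≤ 7 + lg(1/ε) rounds.
  refine ⟨26568 * K + A + 7 * B, fun n w hw hwK ε h0 h1 α _ c => ?_⟩
  rcases Nat.eq_zero_or_pos n with rfl | hn
  · refine ⟨[], by simp, fun a b ha hab hb => by omega⟩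
  let S : Layout := ⟨n, precision n ε⟩
  have hbits : S.bits = Nat.log 2 n + 2 := rfl
  have hF : S.Fits c w _ := S.fits_words c (by unfold Layout.window; omega) (min_le_left _ _)
  have hA0 : (0 : ℝ) ≤ A := Nat.cast_nonneg _
  have hB0 : (0 : ℝ) ≤ B := Nat.cast_nonneg _
  have hK0 : (0 : ℝ) ≤ K := Nat.cast_nonneg _
  refine ⟨S.words c w, ?_, fun a b ha hab hb => ?_⟩
  · rw [Layout.length_words]
    have h2 := Layout.numWords_mul_le (S := S) (K := K) (w := w)
      (hwK.trans (Nat.mul_le_mul_left _ (by omega)))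
    have h3 : (2 : ℝ) ^ S.bits ≤ 4 * n := by
      have : 2 ^ S.bits ≤ 4 * n := by
        rw [hbits, pow_add]
        have := Nat.pow_log_le_self 2 hn.ne'
        omega
      exact_mod_cast this
    have h4 : (2 : ℝ) ^ S.q * 2 ^ S.bits ≤ 18 / ε * (4 * n) :=
      mul_le_mul (two_pow_precision_le h0 h1) h3 (by positivity) (by positivity)
    have h5 : (0 : ℝ) ≤ n / ε := by positivity
    calc ((S.numWords * w : ℕ) : ℝ) ≤ 369 * K * (2 ^ S.q * 2 ^ S.bits) := h2
      _ ≤ 369 * K * (18 / ε * (4 * n)) := by gcongr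
      _ = 26568 * K * (n / ε) := by ring
      _ ≤ _ := by gcongr; linarith
  · obtain ⟨p, hp1, hp2, hp3, env, henv, hrun⟩ :=
      Layout.runs_queryProgram hF (one_le_precision h0 h1) hab hb
    have hbw : ∀ {x}, x ≤ n → x < 2 ^ w := by
      intro x hx
      have := Layout.length_lt (S := S)
      change n + 1 < _ at this
      exact hF.small (k := S.bits) (by omega) (by omega)
    obtain ⟨t, s, ht, hex, hag⟩ := hrun (queryState (S.words c w) a b) ⟨fun r hr => by
      unfold numVars at hr
      interval_cases r <;> simp [queryState, vars, Nat.mod_eq_of_lt (hbw hb),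
        Nat.mod_eq_of_lt (hbw (hab.trans hb))], fun x => rfl⟩
    refine ⟨t, s, hex, ?_, ?_⟩
    · rw [← hA, ← hB] at ht
      have ht' : (t : ℝ) ≤ A + (S.q + 2) * B := by exact_mod_cast ht
      have hq : (S.q : ℝ) ≤ 5 + Real.logb 2 (1 / ε) := precision_le_logb h0 h1
      have hlog : 0 ≤ Real.logb 2 (1 / ε) :=
        Real.logb_nonneg one_lt_two (by rw [le_div_iff₀ h0]; linarith)
      have h2 := mul_le_mul_of_nonneg_right hq hB0
      have h3 := mul_nonneg hA0 hlog
      have h4 := mul_nonneg hB0 hlog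
      have h5 := mul_nonneg hK0 hlog
      nlinarith
    · rw [hag.reg 0 (by decide), henv]
      exact isApproxRangeMode_of_precision h0 hb hp1 hp2 hp3
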